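/- **Setting.** Let $A=(a_{ij})_{0\le i,j\le 4}$ be the Cartan matrix of $C_4^{(1)}$: $a_{ii}=2$, $a_{01}=-1$, $a_{10}=-2$, $a_{12}=a_{21}=a_{23}=a_{32}=-1$, $a_{34}=-2$, $a_{43}=-1$, and $a_{ij}=0$ otherwise. A *geometric crystal* for $A$ on $X=(\mathbb C^\times)^d$ consists of rational $\mathbb C^\times$-actions $e_i:\mathbb C^\times\times X\dashrightarrow X$, $(c,x)\mapsto e_i^c(x)$ (defined on an open dense subset of $\{1\}\times X$), and rational functions $\gamma_i,\varepsilon_i$ on $X$ such that, as identities of rational maps, $\gamma_j(e_i^c(x))=c^{a_{ij}}\gamma_j(x)$; $\varepsilon_i(e_i^c(x))=c^{-1}\varepsilon_i(x)$; $\varepsilon_i(e_j^c(x))=\varepsilon_i(x)$ if $a_{ij}=a_{ji}=0$; and - $e_i^{c_1}e_j^{c_2}=e_j^{c_2}e_i^{c_1}$ if $a_{ij}=a_{ji}=0$; - $e_i^{c_1}e_j^{c_1c_2}e_i^{c_2}=e_j^{c_2}e_i^{c_1c_2}e_j^{c_1}$ if $a_{ij}=a_{ji}=-1$; - $e_i^{c_1}e_j^{c_1^2c_2}e_i^{c_1c_2}e_j^{c_2}=e_j^{c_2}e_i^{c_1c_2}e_j^{c_1^2c_2}e_i^{c_1}$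 if $a_{ij}=-2,\ a_{ji}=-1$; - $e_i^{c_1}e_j^{c_1^3c_2}e_i^{c_1^2c_2}e_j^{c_1^3c_2^2}e_i^{c_1c_2}e_j^{c_2}=e_j^{c_2}e_i^{c_1c_2}e_j^{c_1^3c_2^2}e_i^{c_1^2c_2}e_j^{c_1^3c_2}e_i^{c_1}$ if $a_{ij}=-3,\ a_{ji}=-1$. It is *positive* if the components of $e_i^c(x)$ (in the variables $c,x$) and all $\gamma_i,\varepsilon_i$ are quotients of nonzero polynomials with nonnegative coefficients. For a word $\mathbf i=(i_1,\dots,i_l)$, coordinates $z=(z_1,\dots,z_l)$ and a letter $i$ of $\mathbf i$, put $T_m=\big(z_1^{a_{i_1,i}}\cdots z_{m-1}^{a_{i_{m-1},i}}z_m\big)^{-1}$. The *Schubert-cell formulas* are $\varepsilon_i(z)=\sum_{i_m=i}T_m$, $\gamma_i(z)=\prod_k z_k^{a_{i_k,i}}$ and $$e_i^c(z)_j=z_j\cdot\frac{\sum_{m\le j,\,i_m=i}cT_m+\sum_{m>j,\,i_m=i}T_m}{\sum_{m<j,\,i_m=i}cT_m+\sum_{m\ge j,\,i_m=i}T_m}.$$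 Let $W(\varpi_4)$ be the fundamental $C_4^{(1)}$-module, realized as the submodule of $\bigwedge^4\mathbb C^8$ generated by $(1,2,3,4)=1\wedge2\wedge3\wedge4$, where $\mathbb C^8$ has the basis $1,2,3,4,\bar4,\bar3,\bar2,\bar1$, the generators $f_i$ act on $\mathbb C^8$ by $f_0:\bar1\mapsto-1$ (the negative of the basis vector $1$), $f_k:k\mapsto k+1,\ \overline{k+1}\mapsto\bar k$ $(k=1,2,3)$, $f_4:4\mapsto\bar4$ (all other basis vectors $\mapsto0$), and $e_i$ acts by the transpose of $f_i$. Let $\alpha_i^\vee=[e_i,f_i]$ and $Y_i(c)=\exp(c^{-1}f_i)\,c^{\alpha_i^\vee}$. For nonzero parameters put $$V_1(x)=Y_4(x_{44})Y_3(x_{33})Y_4(x_{43})Y_2(x_{22})Y_3(x_{32})Y_4(x_{42})Y_1(x_{11})Y_2(x_{21})Y_3(x_{31})Y_4(x_{41})(1,2,3,4),$$ $$V_2(y)=Y_0(y_{04})Y_1(y_{13})Y_0(y_{03})Y_2(y_{22})Y_1(y_{12})Y_0(y_{02})Y_3(y_{31})Y_2(y_{21})Y_1(y_{11})Y_0(y_{01})(\bar4,\bar3,\bar2,\bar1),$$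 where $(\bar4,\bar3,\bar2,\bar1)=\bar4\wedge\bar3\wedge\bar2\wedge\bar1$; the parameters, in this order, are the coordinates on the 10-parameter varieties $V_1(x)$ and $V_2(y)$. Put $p=y_{31}y_{02}y_{12}+y_{21}y_{22}y_{02}+y_{11}y_{12}y_{22}$, $q=y_{31}y_{03}y_{22}+y_{31}y_{12}y_{13}+y_{21}y_{22}y_{13}$, $r=y_{21}y_{22}y_{02}y_{03}+y_{11}y_{12}y_{22}y_{03}+y_{11}y_{12}^2y_{13}$, and let $x=\bar\sigma^{-1}(y)$ be given by $$x_{41}=\tfrac1{y_{04}},\quad x_{42}=\tfrac1{y_{03}},\quad x_{43}=\tfrac1{y_{02}},\quad x_{44}=\tfrac1{y_{01}},\quad x_{33}=\tfrac{p}{y_{12}y_{22}y_{01}y_{02}},\quad x_{32}=\tfrac{q\,y_{12}}{y_{03}y_{13}p},\quad x_{31}=\tfrac{y_{31}y_{22}y_{13}}{y_{04}q},$$ $$x_{22}=\tfrac{r}{y_{12}y_{13}y_{01}y_{02}y_{03}},\quad x_{21}=\tfrac{y_{21}y_{22}y_{12}y_{13}}{y_{04}r},\quad x_{11}=\tfrac{y_{11}y_{12}y_{13}}{y_{01}y_{02}y_{03}y_{04}}.$$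 Let $y=\bar\sigma(x)$ be given by the same formulas after the exchange of letters $x_{44}\leftrightarrow y_{04}$, $x_{33}\leftrightarrow y_{13}$, $x_{43}\leftrightarrow y_{03}$, $x_{22}\leftrightarrow y_{22}$, $x_{32}\leftrightarrow y_{12}$, $x_{42}\leftrightarrow y_{02}$, $x_{11}\leftrightarrow y_{31}$, $x_{21}\leftrightarrow y_{21}$, $x_{31}\leftrightarrow y_{11}$, $x_{41}\leftrightarrow y_{01}$. **Theorem.** 1. $W(\varpi_4)$ is not multiplicity-free: some weight space has dimension at least $2$. The vectors $V_1(x)$ and $V_2(y)$ lie in $W(\varpi_4)$. 2. For $x,y\in(\mathbb C^\times)^{10}$ one has $V_2(y)=a\,V_1(x)$ for some scalar $a$ if and only if $y=\bar\sigma(x)$, and if and only if $x=\bar\sigma^{-1}(y)$. The rational maps $\bar\sigma$ and $\bar\sigma^{-1}$ are mutually inverse; in particular $\bar\sigma$ is birational. 3. On $\mathcal V_1=\{V_1(x)\}$, identified with $(\mathbb C^\times)^{10}$ by the coordinates $x$, let $e_i^c,\varepsilon_i,\gamma_i$ for $i=1,\dots,4$ be given by the Schubert-cell formulas for the word $(4,3,4,2,3,4,1,2,3,4)$,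 and put $e_0^c=\bar\sigma^{-1}\circ\overline{e_0}^{\,c}\circ\bar\sigma$, $\varepsilon_0=\overline{\varepsilon_0}\circ\bar\sigma$, $\gamma_0=\overline{\gamma_0}\circ\bar\sigma$, where $\overline{e_0}^{\,c},\overline{\varepsilon_0},\overline{\gamma_0}$ are given in the coordinates $y$ of $V_2(y)$ by the Schubert-cell formulas for the word $(0,1,0,2,1,0,3,2,1,0)$. Then $(\mathcal V_1,\{e_i\},\{\gamma_i\},\{\varepsilon_i\})_{0\le i\le4}$ is a positive geometric crystal for $C_4^{(1)}$. -/

import Mathlib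

open scoped NNReal

noncomputable section

namespace GeomCrystal

/-! ### Rational functions and rational maps over `ℂ` -/

/-- Rational functions over `ℂ` in variables indexed by `σ`: the function field of the
torus `(ℂˣ)^σ`. -/
abbrev RatFun (σ : Type) : Type := FractionRing (MvPolynomial σ ℂ)

/-- The coordinate function with index `s`. -/
def coord {σ : Type} (s : σ) : RatFun σ :=
  algebraMap (MvPolynomial σ ℂ) (RatFun σ) (MvPolynomial.X s)

/-- `IsValue f p v`: the rational function `f` is defined at the point `p` (with coordinates in a
field extension `L` of `ℂ`) and its value there is `v`.  For `L` a function field and `p` a tuple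
of rational functions, this says that the composite `f ∘ p` of rational maps is defined and equals
`v`. -/
def IsValue {σ L : Type} [Field L] [Algebra ℂ L] (f : RatFun σ) (p : σ → L) (v : L) : Prop :=
  ∃ P Q : MvPolynomial σ ℂ, MvPolynomial.aeval p Q ≠ 0 ∧
    f = algebraMap (MvPolynomial σ ℂ) (RatFun σ) P / algebraMap (MvPolynomial σ ℂ) (RatFun σ) Q ∧
    v = MvPolynomial.aeval p P / MvPolynomial.aeval p Q

/-- A positive rational function: a quotient of two nonzero polynomials all of whose coefficients
are nonnegative real numbers. -/
def IsPositive {σ : Type} (f : RatFun σ) : Prop :=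
  ∃ P Q : MvPolynomial σ ℝ≥0, P ≠ 0 ∧ Q ≠ 0 ∧
    f = algebraMap (MvPolynomial σ ℂ) (RatFun σ) (P.map (algebraMap ℝ≥0 ℂ)) /
      algebraMap (MvPolynomial σ ℂ) (RatFun σ) (Q.map (algebraMap ℝ≥0 ℂ))

/-! ### Geometric crystals on a torus -/

/-- The data `(e_i, γ_i, ε_i)_{i ∈ I}` on the variety `X = (ℂˣ)^d`.  The rational map
`e_i : ℂˣ × X ⇢ X` is given by its components, which are rational functions of the parameter `c`
(the variable `none`) and of the coordinates of `X` (the variables `some k`). -/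
structure CrystalData (I d : Type) where
  e : I → d → RatFun (Option d)
  γ : I → RatFun d
  ε : I → RatFun d

variable {I d : Type}

/-- `V.Acts i c x x'`: the map `e_i` is defined at `(c, x)` as a map to the torus `X`, and
`e_i^c(x) = x'`. -/
def CrystalData.Acts (V : CrystalData I d) {L : Type} [Field L] [Algebra ℂ L]
    (i : I) (c : L) (x x' : d → L) : Prop :=
  ∀ k, IsValue (V.e i k) (fun o : Option d => o.elim c x) (x' k) ∧ x' k ≠ 0

/-- `V.Path [(i₁, c₁), …, (i_m, c_m)] x y`: the composite `e_{i₁}^{c₁} ⋯ e_{i_m}^{c_m}` (the last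
factor is applied first) is defined at `x` and its value there is `y`. -/
def CrystalData.Path (V : CrystalData I d) {L : Type} [Field L] [Algebra ℂ L] :
    List (I × L) → (d → L) → (d → L) → Prop
  | [], x, y => x = y
  | (i, c) :: l, x, y => ∃ z, V.Path l x z ∧ V.Acts i c z y

/-- The function field of `ℂˣ × ℂˣ × X`. -/
abbrev Field2 (d : Type) : Type := RatFun (Fin 2 ⊕ d)

/-- The rational maps `(c₁, c₂, x) ↦ (l₁ c₁ c₂)(x)` and `(c₁, c₂, x) ↦ (l₂ c₁ c₂)(x)`, where `l₁`
and `l₂` are words in the `e_i`, are both defined and are equal.  They are evaluated at the generic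
point of `ℂˣ × ℂˣ × X`. -/
def CrystalData.Rel (V : CrystalData I d)
    (l₁ l₂ : Field2 d → Field2 d → List (I × Field2 d)) : Prop :=
  ∃ y : d → Field2 d,
    V.Path (l₁ (coord (Sum.inl 0)) (coord (Sum.inl 1))) (fun k => coord (Sum.inr k)) y ∧
    V.Path (l₂ (coord (Sum.inl 0)) (coord (Sum.inl 1))) (fun k => coord (Sum.inr k)) y

/-- The rational functions `f(e_i^c(x))` and `c^n f(x)` of `(c, x)` are both defined and equal. -/
def CrystalData.Scales (V : CrystalData I d) (f : RatFun d) (i : I) (n : ℤ) : Prop :=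
  ∃ (y : d → RatFun (Option d)) (v : RatFun (Option d)),
    V.Acts i (coord none) (fun k => coord (some k)) y ∧
    IsValue f (fun k => coord (some k)) v ∧ IsValue f y (coord none ^ n * v)

/-- Geometric crystals with (generalized) Cartan matrix `A` on the torus `X = (ℂˣ)^d`. -/
structure CrystalData.IsGeometricCrystal (A : Matrix I I ℤ) (V : CrystalData I d) : Prop where
  /-- `e_i` is defined at the generic point of `{1} × X` (that is, on an open dense subset of
  `{1} × X`), and `e_i^1 = id`. -/
  one_act : ∀ i, V.Acts i 1 (fun k => coord k) (fun k => (coord k : RatFun d))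
  /-- `e_i` is a rational action of `ℂˣ`. -/
  mul_act : ∀ i, V.Rel (fun c₁ c₂ => [(i, c₁), (i, c₂)]) (fun c₁ c₂ => [(i, c₁ * c₂)])
  gamma_e : ∀ i j, V.Scales (V.γ j) i (A i j)
  eps_e_self : ∀ i, V.Scales (V.ε i) i (-1)
  eps_e_of_zero : ∀ i j, A i j = 0 → A j i = 0 → V.Scales (V.ε i) j 0
  braid_zero : ∀ i j, A i j = 0 → A j i = 0 →
    V.Rel (fun c₁ c₂ => [(i, c₁), (j, c₂)]) (fun c₁ c₂ => [(j, c₂), (i, c₁)])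
  braid_one : ∀ i j, A i j = -1 → A j i = -1 →
    V.Rel (fun c₁ c₂ => [(i, c₁), (j, c₁ * c₂), (i, c₂)])
      (fun c₁ c₂ => [(j, c₂), (i, c₁ * c₂), (j, c₁)])
  braid_two : ∀ i j, A i j = -2 → A j i = -1 →
    V.Rel (fun c₁ c₂ => [(i, c₁), (j, c₁ ^ 2 * c₂), (i, c₁ * c₂), (j, c₂)])
      (fun c₁ c₂ => [(j, c₂), (i, c₁ * c₂), (j, c₁ ^ 2 * c₂), (i, c₁)])
  braid_three : ∀ i j, A i j = -3 → A j i = -1 →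
    V.Rel (fun c₁ c₂ => [(i, c₁), (j, c₁ ^ 3 * c₂), (i, c₁ ^ 2 * c₂), (j, c₁ ^ 3 * c₂ ^ 2),
        (i, c₁ * c₂), (j, c₂)])
      (fun c₁ c₂ => [(j, c₂), (i, c₁ * c₂), (j, c₁ ^ 3 * c₂ ^ 2), (i, c₁ ^ 2 * c₂),
        (j, c₁ ^ 3 * c₂), (i, c₁)])

/-- The data are positive in the coordinates of the torus `X`. -/
structure CrystalData.IsPositiveCrystal (V : CrystalData I d) : Prop where
  e_pos : ∀ i k, IsPositive (V.e i k)
  gamma_pos : ∀ i, IsPositive (V.γ i)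
  eps_pos : ∀ i, IsPositive (V.ε i)

/-! ### The Schubert cell formulas, over an arbitrary field -/

section Schubert

variable {F : Type} [Field F] {l : ℕ} [DecidableEq I]

/-- `1 / (x_1^{a_{i_1,i}} ⋯ x_{m-1}^{a_{i_{m-1},i}} x_m)` for the word `w = (i_1, …, i_l)`. -/
def schubertTerm (A : Matrix I I ℤ) (w : Fin l → I) (i : I) (x : Fin l → F) (m : Fin l) : F :=
  1 / ((∏ k ∈ Finset.univ.filter (fun k => k < m), x k ^ A (w k) i) * x m)

/-- The action `e_i^c` on `B_w^-` in the coordinates `x`. -/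
def schubertE (A : Matrix I I ℤ) (w : Fin l → I) (i : I) (c : F) (x : Fin l → F) (j : Fin l) : F :=
  x j *
    ((∑ m ∈ Finset.univ.filter (fun m => w m = i),
        if m ≤ j then c * schubertTerm A w i x m else schubertTerm A w i x m) /
      (∑ m ∈ Finset.univ.filter (fun m => w m = i),
        if m < j then c * schubertTerm A w i x m else schubertTerm A w i x m))

/-- The function `ε_i` on `B_w^-`. -/
def schubertEps (A : Matrix I I ℤ) (w : Fin l → I) (i : I) (x : Fin l → F) : F :=
  ∑ m ∈ Finset.univ.filter (fun m => w m = i), schubertTerm A w i x m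

/-- The function `γ_i` on `B_w^-`. -/
def schubertGamma (A : Matrix I I ℤ) (w : Fin l → I) (i : I) (x : Fin l → F) : F :=
  ∏ k, x k ^ A (w k) i

end Schubert

/-! ### The data of type `C_4^{(1)}` -/

/-- The Cartan matrix of `C_4^{(1)}`, with rows and columns `0, …, 4`. -/
def cartanC4 : Matrix (Fin 5) (Fin 5) ℤ :=
  !![ 2, -1,  0,  0,  0;
     -2,  2, -1,  0,  0;
      0, -1,  2, -1,  0;
      0,  0, -1,  2, -2;
      0,  0,  0, -1,  2]

/-- The word of `V_1(x)`.  Its coordinates are, in this order,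
`(x₄₄, x₃₃, x₄₃, x₂₂, x₃₂, x₄₂, x₁₁, x₂₁, x₃₁, x₄₁)`. -/
def word1 : Fin 10 → Fin 5 := ![4, 3, 4, 2, 3, 4, 1, 2, 3, 4]

/-- The word of `V_2(y)`.  Its coordinates are, in this order,
`(y₀₄, y₁₃, y₀₃, y₂₂, y₁₂, y₀₂, y₃₁, y₂₁, y₁₁, y₀₁)`. -/
def word2 : Fin 10 → Fin 5 := ![0, 1, 0, 2, 1, 0, 3, 2, 1, 0]

section Sigma

variable {F : Type} [Field F]

/-- The map `σ̄⁻¹`, `y ↦ x`. -/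
def sigmaInv (y : Fin 10 → F) : Fin 10 → F :=
  let y04 := y 0
  let y13 := y 1
  let y03 := y 2
  let y22 := y 3
  let y12 := y 4
  let y02 := y 5
  let y31 := y 6
  let y21 := y 7
  let y11 := y 8
  let y01 := y 9
  let x44 := 1 / y01
  let x33 := (y31 * y02 * y12 + y21 * y22 * y02 + y11 * y12 * y22) / (y12 * y22 * y01 * y02)
  let x43 := 1 / y02
  let x22 := (y21 * y22 * y02 * y03 + y11 * y12 * y22 * y03 + y11 * y12 ^ 2 * y13) /
    (y12 * y13 * y01 * y02 * y03)
  let x32 := ((y31 * y03 * y22 + y31 * y12 * y13 + y21 * y22 * y13) * y12) /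
    (y03 * y13 * (y31 * y02 * y12 + y21 * y22 * y02 + y11 * y12 * y22))
  let x42 := 1 / y03
  let x11 := (y11 * y12 * y13) / (y01 * y02 * y03 * y04)
  let x21 := (y21 * y22 * y12 * y13) /
    (y04 * (y21 * y22 * y02 * y03 + y11 * y12 * y22 * y03 + y11 * y12 ^ 2 * y13))
  let x31 := (y31 * y22 * y13) / (y04 * (y31 * y03 * y22 + y31 * y12 * y13 + y21 * y22 * y13))
  let x41 := 1 / y04
  ![x44, x33, x43, x22, x32, x42, x11, x21, x31, x41]

/-- The map `σ̄`, `x ↦ y`. -/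
def sigma (x : Fin 10 → F) : Fin 10 → F :=
  let x44 := x 0
  let x33 := x 1
  let x43 := x 2
  let x22 := x 3
  let x32 := x 4
  let x42 := x 5
  let x11 := x 6
  let x21 := x 7
  let x31 := x 8
  let x41 := x 9
  let y04 := 1 / x41
  let y13 := (x11 * x42 * x32 + x21 * x22 * x42 + x31 * x32 * x22) / (x32 * x22 * x41 * x42)
  let y03 := 1 / x42
  let y22 := (x21 * x22 * x42 * x43 + x31 * x32 * x22 * x43 + x31 * x32 ^ 2 * x33) /
    (x32 * x33 * x41 * x42 * x43)
  let y12 := ((x11 * x43 * x22 + x11 * x32 * x33 + x21 * x22 * x33) * x32) /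
    (x43 * x33 * (x11 * x42 * x32 + x21 * x22 * x42 + x31 * x32 * x22))
  let y02 := 1 / x43
  let y31 := (x31 * x32 * x33) / (x41 * x42 * x43 * x44)
  let y21 := (x21 * x22 * x32 * x33) /
    (x44 * (x21 * x22 * x42 * x43 + x31 * x32 * x22 * x43 + x31 * x32 ^ 2 * x33))
  let y11 := (x11 * x22 * x33) / (x44 * (x11 * x43 * x22 + x11 * x32 * x33 + x21 * x22 * x33))
  let y01 := 1 / x44
  ![y04, y13, y03, y22, y12, y02, y31, y21, y11, y01]

end Sigma

/-- The data `(e_i^c, γ_i, ε_i)`, `i = 0, …, 4`, on `𝒱_1`.  For `i ≠ 0` they are given by the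
Schubert cell formulas for the word of `V_1(x)`; for `i = 0` they are obtained from the Schubert
cell formulas for the word of `V_2(y)` by transport along `σ̄`.  Everything is evaluated at the
generic point `(c, x)`, respectively `x`. -/
def crystalV1 : CrystalData (Fin 5) (Fin 10) where
  e i :=
    let c : RatFun (Option (Fin 10)) := coord none
    let x : Fin 10 → RatFun (Option (Fin 10)) := fun k => coord (some k)
    if i = 0 then sigmaInv (schubertE cartanC4 word2 0 c (sigma x))
    else schubertE cartanC4 word1 i c x
  γ i :=
    let x : Fin 10 → RatFun (Fin 10) := fun k => coord k
    if i = 0 then schubertGamma cartanC4 word2 0 (sigma x) else schubertGamma cartanC4 word1 i x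
  ε i :=
    let x : Fin 10 → RatFun (Fin 10) := fun k => coord k
    if i = 0 then schubertEps cartanC4 word2 0 (sigma x) else schubertEps cartanC4 word1 i x

/-! ### The module `W(ϖ_4)` and the vectors `V_1(x)`, `V_2(y)`

The vector representation of `C_4^{(1)}` has the basis `1, 2, 3, 4, 4̄, 3̄, 2̄, 1̄`, indexed here by
`0, …, 7`.  The Chevalley generators `e_0, f_0` act through an evaluation homomorphism to `𝔰𝔭_8`. -/

/-- The matrices of the Chevalley generators `f_0, …, f_4` in the vector representation:
`f_0 : 1̄ ↦ -1`, `f_4 : 4 ↦ 4̄`, and `f_k : k ↦ k+1`, `(k+1)‾ ↦ k̄` for `k = 1, 2, 3`. -/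
def chevF : Fin 5 → Matrix (Fin 8) (Fin 8) ℂ :=
  ![-Matrix.single 0 7 1,
    Matrix.single 1 0 1 + Matrix.single 7 6 1,
    Matrix.single 2 1 1 + Matrix.single 6 5 1,
    Matrix.single 3 2 1 + Matrix.single 5 4 1,
    Matrix.single 4 3 1]

/-- The matrices of the Chevalley generators `e_0, …, e_4`. -/
def chevE (i : Fin 5) : Matrix (Fin 8) (Fin 8) ℂ := (chevF i).transpose

/-- `x_i(t) = exp(t e_i)`; the square of `e_i` is zero in the vector representation. -/
def xOne (i : Fin 5) (t : ℂ) : Matrix (Fin 8) (Fin 8) ℂ := 1 + t • chevE i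

/-- `y_i(t) = exp(t f_i)`; the square of `f_i` is zero in the vector representation. -/
def yOne (i : Fin 5) (t : ℂ) : Matrix (Fin 8) (Fin 8) ℂ := 1 + t • chevF i

theorem chevF_mul_self (i : Fin 5) : chevF i * chevF i = 0 := by
  fin_cases i <;> simp [chevF, add_mul, mul_add]

theorem chevE_mul_self (i : Fin 5) : chevE i * chevE i = 0 := by
  rw [chevE, ← Matrix.transpose_mul, chevF_mul_self, Matrix.transpose_zero]

/-- The diagonal entries of the coroots `α_i^∨ = [e_i, f_i]` (diagonal matrices). -/
def corootDiag : Fin 5 → Fin 8 → ℤ :=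
  ![![-1, 0, 0, 0, 0, 0, 0, 1],
    ![1, -1, 0, 0, 0, 0, 1, -1],
    ![0, 1, -1, 0, 0, 1, -1, 0],
    ![0, 0, 1, -1, 1, -1, 0, 0],
    ![0, 0, 0, 1, -1, 0, 0, 0]]

/-- `α_i^∨(c)`. -/
def coroot (i : Fin 5) (c : ℂ) : Matrix (Fin 8) (Fin 8) ℂ :=
  Matrix.diagonal (fun k => c ^ corootDiag i k)

/-- `Y_i(c) = y_i(1/c) α_i^∨(c)`. -/
def bigY (i : Fin 5) (c : ℂ) : Matrix (Fin 8) (Fin 8) ℂ := yOne i (1 / c) * coroot i c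

/-- The fourth exterior power of the vector representation. -/
abbrev Ext4 : Type := ⋀[ℂ]^4 (Fin 8 → ℂ)

/-- The action of a matrix on the fourth exterior power. -/
def extAct (g : Matrix (Fin 8) (Fin 8) ℂ) : Ext4 →ₗ[ℂ] Ext4 := exteriorPower.map 4 g.toLin'

/-- The vector `(1, 2, 3, 4)`. -/
def highVec : Ext4 :=
  exteriorPower.ιMulti ℂ 4 (fun k : Fin 4 => (Pi.single (Fin.castAdd 4 k) 1 : Fin 8 → ℂ))

/-- The vector `(4̄, 3̄, 2̄, 1̄)`. -/
def lowVec : Ext4 :=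
  exteriorPower.ιMulti ℂ 4 (fun k : Fin 4 => (Pi.single (Fin.natAdd 4 k) 1 : Fin 8 → ℂ))

/-- The fundamental representation `W(ϖ_4)`: the submodule generated by the vector `(1, 2, 3, 4)`
of the fourth exterior power.  As a module over `𝔤_0 = C_4` it is `V(Λ_4)`. -/
def W4 : Submodule ℂ Ext4 :=
  sInf {S | highVec ∈ S ∧ ∀ (i : Fin 5) (t : ℂ), ∀ v ∈ S,
    extAct (xOne i t) v ∈ S ∧ extAct (yOne i t) v ∈ S}

/-- The space of vectors of weight `∑ μ_i Λ_i` in `W(ϖ_4)`. -/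
def weightSpace (μ : Fin 5 → ℤ) : Submodule ℂ Ext4 :=
  W4 ⊓ ⨅ (i : Fin 5) (c : ℂˣ), LinearMap.ker (extAct (coroot i c) - ((c : ℂ) ^ μ i) • LinearMap.id)

/-- `W(ϖ_4)` is multiplicity-free if all its weight spaces have dimension at most one. -/
def IsMultiplicityFreeW4 : Prop := ∀ μ : Fin 5 → ℤ, Module.finrank ℂ (weightSpace μ) ≤ 1

/-- `V_1(x) = Y_4(x₄₄) Y_3(x₃₃) ⋯ Y_3(x₃₁) Y_4(x₄₁) (1, 2, 3, 4)`. -/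
def vecV1 (x : Fin 10 → ℂ) : Ext4 :=
  extAct (List.ofFn (fun k => bigY (word1 k) (x k))).prod highVec

/-- `V_2(y) = Y_0(y₀₄) Y_1(y₁₃) ⋯ Y_1(y₁₁) Y_0(y₀₁) (4̄, 3̄, 2̄, 1̄)`. -/
def vecV2 (y : Fin 10 → ℂ) : Ext4 :=
  extAct (List.ofFn (fun k => bigY (word2 k) (y k))).prod lowVec

end GeomCrystal

end

/-!
The proof replaces the ten-dimensional torus by symmetric `4 × 4` matrices. A complement in `ℂ⁸`
of the span of `4̄, 3̄, 2̄, 1̄` is the graph of a matrix `N`, and it is Lagrangian for the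
invariant symplectic form when `N = -K S E` with `S` symmetric, for a fixed permutation matrix `K`
and a fixed sign matrix `E`. For `i ≠ 0` the operator `Y_i(z)` maps the graph belonging to `S` to
the one belonging to `A S Aᵀ + B`, with `A` and `B` depending on `i` and `z`
(`letter_graphMatrix`). Hence `V_1(x)` is a multiple of the decomposable vector of the graph
belonging to an explicit matrix `S(x) = L D Lᵀ` (`point_word1`, `exists_vecV1_eq`). The diagram
automorphism `i ↦ 4 - i` turns the word of `V_1` into the word of `V_2`, so `V_2(y)` is given by
the same matrix `S(y)` in the opposite cell (`exists_vecV2_eq`).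

The two subspaces agree if and only if `S(y) W S(x) = W` for an antidiagonal sign matrix `W`
(`exists_smul_vecV1_eq_iff`). This equation determines `S(y)` from `S(x)`; in the coordinates of
the decomposition `L D Lᵀ` the solution is the involution `LDL.dual`, and `chart_sigma` identifies
it with `σ̄`. As `σ̄` and `σ̄⁻¹` are given by the same formulas in the chosen order of the
coordinates, `σ̄` is itself an involution.

The Schubert cell formula for `e_j^c` says that the one-parameter element `x_j((c - 1) / ε_j)` is
moved through the product of the `Y_i(z)` from left to right (`unipRel_point`). On `S` the
operators `e_1, e_2, e_3` are therefore row-and-column operations (`chart_crystalE`), `e_4`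
subtracts a multiple of a rank one matrix (`sym_crystalE_four`), and `e_0` adds a multiple of the
matrix unit `E_00` (`sym_crystalE_zero`). The functions `ε_i` are ratios of entries or minors of
`S`, or an entry. Since `σ̄` intertwines `e_i` with `e_{4-i}` (`crystalE_sigma`), half of the
axioms follow from the other half. The commutation relations are visible on matrices, and the
braid relations become identities between the parameters of the operations (`braid_one_scalars`,
`braid_two_scalars`). All identities are proved at points whose coordinates are positive rational
functions. All formulas are subtraction-free, so at such points they are defined and nonzero
(`IsSubtractionFree`); this takes care of the domains of the rational maps and of positivity at
once.

Finally, `W(ϖ_4)` contains `f_1 f_3 (1 ∧ 3 ∧ 4̄ ∧ 2̄)`, a vector of weight zero, and its image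
under a lift of the simple reflection `s_2`; two minors show that these are linearly independent
(`not_isMultiplicityFreeW4`).
-/

namespace GeomCrystal

/-! ### Symmetric matrices and the map `σ̄` -/

section Model

variable {F : Type} [Field F]

/-- Coordinates on symmetric `4 × 4` matrices of the form `L D Lᵀ`: the diagonal entries of `D`
and the entries below the diagonal of the lower unitriangular matrix `L`. -/
@[ext] structure LDL (F : Type) where
  d0 : F
  d1 : F
  d2 : F
  d3 : F
  l10 : F
  l20 : F
  l30 : F
  l21 : F
  l31 : F
  l32 : F

/-- The symmetric matrix `L D Lᵀ`. -/
def LDL.sym (m : LDL F) : Matrix (Fin 4) (Fin 4) F :=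
  !![m.d0, m.d0 * m.l10, m.d0 * m.l20, m.d0 * m.l30;
    m.d0 * m.l10, m.d0 * m.l10 ^ 2 + m.d1, m.d0 * m.l10 * m.l20 + m.d1 * m.l21,
      m.d0 * m.l10 * m.l30 + m.d1 * m.l31;
    m.d0 * m.l20, m.d0 * m.l10 * m.l20 + m.d1 * m.l21,
      m.d0 * m.l20 ^ 2 + m.d1 * m.l21 ^ 2 + m.d2,
      m.d0 * m.l20 * m.l30 + m.d1 * m.l21 * m.l31 + m.d2 * m.l32;
    m.d0 * m.l30, m.d0 * m.l10 * m.l30 + m.d1 * m.l31,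
      m.d0 * m.l20 * m.l30 + m.d1 * m.l21 * m.l31 + m.d2 * m.l32,
      m.d0 * m.l30 ^ 2 + m.d1 * m.l31 ^ 2 + m.d2 * m.l32 ^ 2 + m.d3]

/-- The coordinates of the matrix `S'` determined by `S' W S = W`, where `W` is `signedRev` and
`S` has the given coordinates (see `LDL.dual_sym_mul`). -/
def LDL.dual (m : LDL F) : LDL F where
  d0 := 1 / m.d3
  d1 := 1 / m.d2
  d2 := 1 / m.d1
  d3 := 1 / m.d0
  l10 := m.l32
  l20 := m.l21 * m.l32 - m.l31
  l30 := m.l10 * m.l21 * m.l32 - m.l10 * m.l31 - m.l20 * m.l32 + m.l30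
  l21 := m.l21
  l31 := m.l10 * m.l21 - m.l20
  l32 := m.l10

theorem LDL.dual_dual (m : LDL F) : m.dual.dual = m := by
  ext <;> simp [LDL.dual] <;> ring

/-- The decomposition `L D Lᵀ` is unique as soon as the first three diagonal entries of `D` are
nonzero. -/
theorem LDL.sym_injective {m n : LDL F} (h0 : m.d0 ≠ 0) (h1 : m.d1 ≠ 0) (h2 : m.d2 ≠ 0)
    (h : m.sym = n.sym) : m = n := by
  have e (i j : Fin 4) : m.sym i j = n.sym i j := by rw [h]
  have a00 := e 0 0
  have a01 := e 0 1
  have a02 := e 0 2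
  have a03 := e 0 3
  have a11 := e 1 1
  have a12 := e 1 2
  have a13 := e 1 3
  have a22 := e 2 2
  have a23 := e 2 3
  have a33 := e 3 3
  clear e h
  obtain ⟨d0, d1, d2, d3, l10, l20, l30, l21, l31, l32⟩ := m
  obtain ⟨d0', d1', d2', d3', l10', l20', l30', l21', l31', l32'⟩ := n
  simp [LDL.sym] at *
  subst a00
  simp [h0] at a01 a02 a03
  subst a01 a02 a03
  simp at a11
  subst a11
  simp [h1] at a12 a13
  subst a12 a13
  simp at a22
  subst a22
  simp [h2] at a23
  subst a23
  simpa using a33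

/-- The polynomial `p` after the exchange of letters, in the order of coordinates `(x₄₄, x₃₃, x₄₃,
x₂₂, x₃₂, x₄₂, x₁₁, x₂₁, x₃₁, x₄₁)`. -/
def polP (x : Fin 10 → F) : F := x 6 * x 5 * x 4 + x 7 * x 3 * x 5 + x 8 * x 4 * x 3

/-- The polynomial `q` after the exchange of letters. -/
def polQ (x : Fin 10 → F) : F := x 6 * x 2 * x 3 + x 6 * x 4 * x 1 + x 7 * x 3 * x 1

/-- The polynomial `r` after the exchange of letters. -/
def polR (x : Fin 10 → F) : F :=
  x 7 * x 3 * x 5 * x 2 + x 8 * x 4 * x 3 * x 2 + x 8 * x 4 ^ 2 * x 1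

theorem sigma_eq (x : Fin 10 → F) : sigma x =
    ![1 / x 9, polP x / (x 4 * x 3 * x 9 * x 5), 1 / x 5,
      polR x / (x 4 * x 1 * x 9 * x 5 * x 2), (polQ x * x 4) / (x 2 * x 1 * polP x), 1 / x 2,
      (x 8 * x 4 * x 1) / (x 9 * x 5 * x 2 * x 0), (x 7 * x 3 * x 4 * x 1) / (x 0 * polR x),
      (x 6 * x 3 * x 1) / (x 0 * polQ x), 1 / x 0] := rfl

/-- With the coordinates of `V_1` and `V_2` listed in the order of the two words, the exchange of
letters keeps positions, so that `σ̄` and `σ̄⁻¹` are given by the same formulas. -/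
theorem sigmaInv_eq_sigma : (sigmaInv : (Fin 10 → F) → Fin 10 → F) = sigma := rfl

/-- The symmetric matrix, in the form `L D Lᵀ`, attached to the point `x` of the torus. -/
def chart (x : Fin 10 → F) : LDL F where
  d0 := 1 / x 9
  d1 := 1 / x 5
  d2 := 1 / x 2
  d3 := 1 / x 0
  l10 := x 6 / x 3 + x 7 / x 4 + x 8 / x 5
  l20 := x 3 * (x 7 / x 4 + x 8 / x 5) / x 1 + x 4 * x 8 / (x 5 * x 2)
  l30 := x 8 * x 4 * x 1 / (x 5 * x 2 * x 0)
  l21 := x 3 / x 1 + x 4 / x 2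
  l31 := x 4 * x 1 / (x 2 * x 0)
  l32 := x 1 / x 0

/-- Under `chart`, the map `σ̄` is the explicit involution `LDL.dual`. -/
theorem chart_sigma {x : Fin 10 → F} (hx : ∀ k, x k ≠ 0) (hp : polP x ≠ 0) (hq : polQ x ≠ 0)
    (hr : polR x ≠ 0) : chart (sigma x) = (chart x).dual := by
  have h0 := hx 0
  have h1 := hx 1
  have h2 := hx 2
  have h3 := hx 3
  have h4 := hx 4
  have h5 := hx 5
  have h6 := hx 6
  have h7 := hx 7
  have h8 := hx 8
  have h9 := hx 9
  rw [sigma_eq]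
  ext <;> simp [chart, LDL.dual] <;> (try field_simp) <;> (try simp only [polP, polQ, polR]) <;>
    ring

/-- The point `x` is recovered from its matrix: in a suitable order, each entry of `D` and `L`
involves one coordinate that does not occur in the previous ones. -/
theorem eq_of_chart_eq {x y : Fin 10 → F} (hy : ∀ k, y k ≠ 0)
    (h : chart x = chart y) : x = y := by
  have a0 := congrArg LDL.d0 h
  have a1 := congrArg LDL.d1 h
  have a2 := congrArg LDL.d2 h
  have a3 := congrArg LDL.d3 h
  have b10 := congrArg LDL.l10 h
  have b20 := congrArg LDL.l20 h
  have b30 := congrArg LDL.l30 h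
  have b21 := congrArg LDL.l21 h
  have b31 := congrArg LDL.l31 h
  have b32 := congrArg LDL.l32 h
  clear h
  simp only [chart, one_div, inv_inj] at *
  simp only [a1, a2, a3] at b10 b20 b30 b21 b31 b32
  have e1 : x 1 = y 1 := by simpa [hy] using b32
  have e4 : x 4 = y 4 := by simpa [hy, e1, div_left_inj'] using b31
  have e3 : x 3 = y 3 := by simpa [hy, e1, e4, div_left_inj'] using b21
  have e8 : x 8 = y 8 := by simpa [hy, e1, e4, div_left_inj'] using b30
  have e7 : x 7 = y 7 := by simpa [hy, e1, e4, e3, e8, div_left_inj'] using b20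
  have e6 : x 6 = y 6 := by simpa [hy, e3, e4, e7, e8, div_left_inj'] using b10
  funext k
  fin_cases k <;> assumption

theorem chart_l10 {x : Fin 10 → F} (hx : ∀ k, x k ≠ 0) :
    (chart x).l10 = polP x / (x 3 * x 4 * x 5) := by
  have h3 := hx 3
  have h4 := hx 4
  have h5 := hx 5
  simp only [chart, polP]
  field_simp

theorem chart_l20 {x : Fin 10 → F} (hx : ∀ k, x k ≠ 0) :
    (chart x).l20 = polR x / (x 1 * x 2 * x 4 * x 5) := by
  have h1 := hx 1
  have h2 := hx 2
  have h4 := hx 4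
  have h5 := hx 5
  simp only [chart, polR]
  field_simp

theorem chart_dual_l31 {x : Fin 10 → F} (hx : ∀ k, x k ≠ 0) :
    (chart x).dual.l31 = polQ x / (x 1 * x 2 * x 3) := by
  have h1 := hx 1
  have h2 := hx 2
  have h3 := hx 3
  have h4 := hx 4
  have h5 := hx 5
  simp only [chart, LDL.dual, polQ]
  field_simp
  ring

/-- The antidiagonal matrix `W` with alternating signs, `W_{l,3-l} = (-1)^l`. -/
def signedRev : Matrix (Fin 4) (Fin 4) F :=
  !![0, 0, 0, 1; 0, 0, -1, 0; 0, 1, 0, 0; -1, 0, 0, 0]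

theorem signedRev_mul_self : (signedRev : Matrix (Fin 4) (Fin 4) F) * signedRev = -1 := by
  ext i j
  fin_cases i <;> fin_cases j <;> simp [signedRev, Matrix.mul_apply, Fin.sum_univ_succ]

theorem LDL.dual_sym_mul {m : LDL F} (h0 : m.d0 ≠ 0) (h1 : m.d1 ≠ 0) (h2 : m.d2 ≠ 0)
    (h3 : m.d3 ≠ 0) : m.dual.sym * signedRev * m.sym = signedRev := by
  ext i j
  fin_cases i <;> fin_cases j <;>
    simp [signedRev, Matrix.mul_apply, Fin.sum_univ_succ, LDL.sym, LDL.dual] <;> field_simp <;> ring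

theorem LDL.eq_dual_of_sym_mul {m n : LDL F} (h0 : m.d0 ≠ 0) (h1 : m.d1 ≠ 0) (h2 : m.d2 ≠ 0)
    (h3 : m.d3 ≠ 0) (h : n.sym * signedRev * m.sym = signedRev) : n = m.dual := by
  have h' : m.sym * signedRev * m.dual.sym = signedRev := by
    have := LDL.dual_sym_mul (m := m.dual) (by simpa [LDL.dual]) (by simpa [LDL.dual])
      (by simpa [LDL.dual]) (by simpa [LDL.dual])
    rwa [LDL.dual_dual] at this
  symm
  refine LDL.sym_injective (by simpa [LDL.dual]) (by simpa [LDL.dual]) (by simpa [LDL.dual]) ?_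
  have e : n.sym * signedRev * (m.sym * signedRev * m.dual.sym) =
      n.sym * signedRev * m.sym * (signedRev * m.dual.sym) := by
    simp only [Matrix.mul_assoc]
  rw [h', h, ← Matrix.mul_assoc, Matrix.mul_assoc, signedRev_mul_self] at e
  simpa using e.symm

/-- The map `σ̄` takes values in the torus exactly where `p`, `q` and `r` do not vanish. -/
theorem sigma_ne_zero_iff {x : Fin 10 → F} (hx : ∀ k, x k ≠ 0) :
    (∀ k, sigma x k ≠ 0) ↔ polP x ≠ 0 ∧ polQ x ≠ 0 ∧ polR x ≠ 0 := by
  rw [sigma_eq]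
  constructor
  · intro h
    have h1 := h 1
    have h3 := h 3
    have h4 := h 4
    simp_all
  · rintro ⟨hp, hq, hr⟩ k
    fin_cases k <;> simp [hx, hp, hq, hr]

/-- If `S(y) W S(x) = W` for points of the torus, then `y = σ̄(x)`. That `p`, `q`, `r` do not
vanish at `x` is part of the conclusion: up to units they are entries of `L` or of its dual, and
`y` lies in the torus. -/
theorem eq_sigma_of_sym_mul {x y : Fin 10 → F} (hx : ∀ k, x k ≠ 0) (hy : ∀ k, y k ≠ 0)
    (h : (chart y).sym * signedRev * (chart x).sym = signedRev) :
    (polP x ≠ 0 ∧ polQ x ≠ 0 ∧ polR x ≠ 0) ∧ y = sigma x := by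
  have e : chart y = (chart x).dual :=
    LDL.eq_dual_of_sym_mul (by simp [chart, hx]) (by simp [chart, hx]) (by simp [chart, hx])
      (by simp [chart, hx]) h
  have e' : (chart y).dual = chart x := by rw [e, LDL.dual_dual]
  have hp : polP x ≠ 0 := by
    intro h0
    have := chart_l10 hx
    rw [h0, ← e'] at this
    simp [LDL.dual, chart, hy] at this
  have hr : polR x ≠ 0 := by
    intro h0
    have := chart_l20 hx
    rw [h0, ← e'] at this
    -- the `l20` entry of the dual of `chart y` is a single monomial in `y`
    have h0 := hy 0
    have h1 := hy 1
    have h2 := hy 2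
    have h3 := hy 3
    simp only [LDL.dual, chart] at this
    field_simp at this
    simp [hy] at this
  have hq : polQ x ≠ 0 := by
    intro h0
    have := chart_dual_l31 hx
    rw [h0, ← e] at this
    simp [chart, hy] at this
  refine ⟨⟨hp, hq, hr⟩, ?_⟩
  have hs := chart_sigma hx hp hq hr
  have hsx := (sigma_ne_zero_iff hx).2 ⟨hp, hq, hr⟩
  exact eq_of_chart_eq hsx (e.trans hs.symm)

theorem sym_mul_sigma {x : Fin 10 → F} (hx : ∀ k, x k ≠ 0) (hs : ∀ k, sigma x k ≠ 0) :
    (chart (sigma x)).sym * signedRev * (chart x).sym = signedRev := by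
  obtain ⟨hp, hq, hr⟩ := (sigma_ne_zero_iff hx).1 hs
  rw [chart_sigma hx hp hq hr]
  exact LDL.dual_sym_mul (by simp [chart, hx]) (by simp [chart, hx]) (by simp [chart, hx])
      (by simp [chart, hx])

theorem sigma_sigma {x : Fin 10 → F} (hx : ∀ k, x k ≠ 0) (hs : ∀ k, sigma x k ≠ 0) :
    sigma (sigma x) = x := by
  have h : (chart x).sym * signedRev * (chart (sigma x)).sym = signedRev := by
    obtain ⟨hp, hq, hr⟩ := (sigma_ne_zero_iff hx).1 hs
    have := LDL.dual_sym_mul (m := (chart x).dual) (by simp [chart, LDL.dual, hx])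
      (by simp [chart, LDL.dual, hx]) (by simp [chart, LDL.dual, hx])
      (by simp [chart, LDL.dual, hx])
    rwa [LDL.dual_dual, ← chart_sigma hx hp hq hr] at this
  exact (eq_sigma_of_sym_mul hs hx h).2.symm

end Model

/-! ### The factors `Y_i(z)` acting on symmetric matrices -/

section Letters

variable {F : Type} [Field F]

open Matrix

/-- The matrix `A` in the action `S ↦ A S Aᵀ + B` of `Y_i(z)`, `i ≠ 0`, on symmetric matrices. The
value at `i = 0` is irrelevant. -/
def letterA (i : Fin 5) (z : F) : Matrix (Fin 4) (Fin 4) F :=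
  ![1, !![1 / z, 1, 0, 0; 0, z, 0, 0; 0, 0, 1, 0; 0, 0, 0, 1],
    !![1, 0, 0, 0; 0, 1 / z, 1, 0; 0, 0, z, 0; 0, 0, 0, 1],
    !![1, 0, 0, 0; 0, 1, 0, 0; 0, 0, 1 / z, 1; 0, 0, 0, z],
    !![1, 0, 0, 0; 0, 1, 0, 0; 0, 0, 1, 0; 0, 0, 0, 1 / z]] i

/-- The matrix `B` in the action `S ↦ A S Aᵀ + B` of `Y_i(z)` on symmetric matrices. -/
def letterB (i : Fin 5) (z : F) : Matrix (Fin 4) (Fin 4) F :=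
  if i = 4 then !![0, 0, 0, 0; 0, 0, 0, 0; 0, 0, 0, 0; 0, 0, 0, 1 / z] else 0

/-- The action `S ↦ A S Aᵀ + B` of `Y_i(z)`, `i ≠ 0`, on symmetric matrices. -/
def letter (i : Fin 5) (z : F) (S : Matrix (Fin 4) (Fin 4) F) : Matrix (Fin 4) (Fin 4) F :=
  letterA i z * S * (letterA i z)ᵀ + letterB i z

/-- The elementary matrix that adds `a` times row `j - 1` to row `j`, for `j = 1, 2, 3`. The
values at `j = 0` and `j = 4` are irrelevant. -/
def rowOp (j : Fin 5) (a : F) : Matrix (Fin 4) (Fin 4) F :=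
  ![1, !![1, 0, 0, 0; a, 1, 0, 0; 0, 0, 1, 0; 0, 0, 0, 1],
    !![1, 0, 0, 0; 0, 1, 0, 0; 0, a, 1, 0; 0, 0, 0, 1],
    !![1, 0, 0, 0; 0, 1, 0, 0; 0, 0, 1, 0; 0, 0, a, 1], 1] j

/-- `UnipRel j a S S'`: the element `x_j(a)`, `j ≠ 0`, maps the graph belonging to `S` to the
graph belonging to `S'`. For `j = 4` this reads `S' = S (1 + a E_33 S)⁻¹`, which is stated without
the inverse. -/
def UnipRel (j : Fin 5) (a : F) (S S' : Matrix (Fin 4) (Fin 4) F) : Prop :=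
  if j = 4 then S' + S' * Matrix.single 3 3 a * S = S else S' = rowOp j a * S * (rowOp j a)ᵀ

theorem eq_of_ne_zero_fin5 : ∀ {i : Fin 5}, i ≠ 0 → i = 1 ∨ i = 2 ∨ i = 3 ∨ i = 4 := by
  decide

theorem rowOp_mul_letterA {i j : Fin 5} (hi : i ≠ 0) (hj : j ≠ 0) (hij : i ≠ j) (a : F) {z : F}
    (hz : z ≠ 0) :
    rowOp j a * letterA i z = letterA i z * rowOp j (a * z ^ (-cartanC4 i j)) := by
  obtain rfl | rfl | rfl | rfl := eq_of_ne_zero_fin5 hi <;>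
    obtain rfl | rfl | rfl | rfl := eq_of_ne_zero_fin5 hj <;>
    simp only [ne_eq, not_true_eq_false] at hij
  all_goals
    rw [← Matrix.ext_iff]
    simp [Fin.forall_fin_succ, rowOp, letterA, cartanC4, Matrix.mul_apply, Fin.sum_univ_succ]
  all_goals try field_simp

theorem rowOp_mul_letterA_self {j : Fin 5} (a : F) {z : F} (hz : z ≠ 0) (hza : z + a ≠ 0)
    (hj : j ≠ 0) (hj4 : j ≠ 4) :
    rowOp j a * letterA j z = letterA j (z + a) * rowOp j (a / (z * (z + a))) := by
  obtain rfl | rfl | rfl | rfl := eq_of_ne_zero_fin5 hj <;>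
    simp only [ne_eq, not_true_eq_false] at hj4
  all_goals
    rw [← Matrix.ext_iff]
    simp [Fin.forall_fin_succ, rowOp, letterA, Matrix.mul_apply, Fin.sum_univ_succ]
    field_simp
  all_goals simp [add_comm]

theorem rowOp_mul_letterB {i j : Fin 5} (hj : j ≠ 0) (a z : F) :
    rowOp j a * letterB i z * (rowOp j a)ᵀ = letterB i z := by
  unfold letterB
  split_ifs
  · obtain rfl | rfl | rfl | rfl := eq_of_ne_zero_fin5 hj <;>
    · rw [← Matrix.ext_iff]
      simp [Fin.forall_fin_succ, rowOp, Matrix.mul_apply, Fin.sum_univ_succ]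
  · simp

theorem letterA_transpose_mul_single {i : Fin 5} (hi : i ≠ 0) (hi' : i ≠ 4) (a : F) (z : F) :
    (letterA i z)ᵀ * Matrix.single 3 3 a * letterA i z =
      Matrix.single 3 3 (a * z ^ (-cartanC4 i 4)) := by
  obtain rfl | rfl | rfl | rfl := eq_of_ne_zero_fin5 hi <;>
    simp only [ne_eq, not_true_eq_false] at hi'
  all_goals
    rw [← Matrix.ext_iff]
    simp [Fin.forall_fin_succ, letterA, cartanC4, Matrix.mul_apply, Fin.sum_univ_succ,
      Matrix.single_apply]
  all_goals try ring

/-- The commutation rule `x_j(a) Y_i(z) = Y_i(z) x_j(a z^{-a_ij})` for `i ≠ j`, on symmetric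
matrices. -/
theorem UnipRel.letter_ne {i j : Fin 5} (hi : i ≠ 0) (hj0 : j ≠ 0) (hij : i ≠ j) {a z : F}
    (hz : z ≠ 0) {S S' : Matrix (Fin 4) (Fin 4) F} (h : UnipRel j (a * z ^ (-cartanC4 i j)) S S') :
    UnipRel j a (letter i z S) (letter i z S') := by
  unfold UnipRel at h ⊢
  split_ifs at h ⊢ with hj
  · subst hj
    have hB : (letterB i z : Matrix (Fin 4) (Fin 4) F) = 0 := by simp [letterB, hij]
    have e := letterA_transpose_mul_single hi hij a z
    simp only [letter, hB, add_zero]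
    rw [← e] at h
    conv_rhs => rw [← h]
    simp only [Matrix.mul_add, Matrix.add_mul, Matrix.mul_assoc]
  · subst h
    have e := rowOp_mul_letterA hi hj0 hij a hz
    have eB := rowOp_mul_letterB (i := i) hj0 a z
    simp only [letter, Matrix.mul_add, Matrix.add_mul, eB]
    have : rowOp j a * (letterA i z * S * (letterA i z)ᵀ) * (rowOp j a)ᵀ =
      (rowOp j a * letterA i z) * S * (rowOp j a * letterA i z)ᵀ := by
      simp only [Matrix.transpose_mul, Matrix.mul_assoc]
    rw [this, e]
    simp only [Matrix.transpose_mul, Matrix.mul_assoc]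

set_option maxHeartbeats 1000000 in
/-- The commutation rule `x_j(a) Y_j(z) = Y_j(z + a) x_j(a / (z (z + a)))`, on symmetric
matrices. -/
theorem UnipRel.letter_self {j : Fin 5} (hj0 : j ≠ 0) {a z : F} (hz : z ≠ 0) (hza : z + a ≠ 0)
    {S S' : Matrix (Fin 4) (Fin 4) F} (h : UnipRel j (a / (z * (z + a))) S S') :
    UnipRel j a (letter j z S) (letter j (z + a) S') := by
  unfold UnipRel at h ⊢
  split_ifs at h ⊢ with hj
  · subst hj
    ext r s
    have hrs := congrFun (congrFun h r) s
    revert hrs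
    set z' := z + a with hz'
    have ha : a = z' - z := by rw [hz']; ring
    clear_value z'
    subst ha
    clear h
    fin_cases r <;> fin_cases s <;>
      simp only [letter, Matrix.mul_apply, Fin.sum_univ_four, Matrix.transpose_apply,
        Matrix.add_apply] <;>
      simp [letterA, letterB] <;> intro hrs
    -- entrywise, each identity is a multiple of the hypothesis, by a monomial in `z⁻¹`, `z'⁻¹`
    all_goals first
      | linear_combination (norm := (field_simp; ring1)) hrs
      | linear_combination (norm := (field_simp; ring1)) z⁻¹ * hrs
      | linear_combination (norm := (field_simp; ring1)) z'⁻¹ * hrs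
      | linear_combination (norm := (field_simp; ring1)) z⁻¹ * z'⁻¹ * hrs
  · subst h
    have e := rowOp_mul_letterA_self a hz hza hj0 hj
    have hB : ∀ z, (letterB j z : Matrix (Fin 4) (Fin 4) F) = 0 := by simp [letterB, hj]
    simp only [letter, hB, add_zero]
    have : rowOp j a * (letterA j z * S * (letterA j z)ᵀ) * (rowOp j a)ᵀ =
      (rowOp j a * letterA j z) * S * (rowOp j a * letterA j z)ᵀ := by
      simp only [Matrix.transpose_mul, Matrix.mul_assoc]
    rw [this, e]
    simp only [Matrix.transpose_mul, Matrix.mul_assoc]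

end Letters

/-! ### The Schubert cell formulas as telescoping products -/

section Threading

variable {F I : Type} [Field F] {l : ℕ}

/-- The product `z_1^{a_{i_1,i}} ⋯ z_k^{a_{i_k,i}}` of the first `k` factors, which precedes
position `k` (counted from `0`). -/
def schubertPre (A : Matrix I I ℤ) (w : Fin l → I) (i : I) (z : Fin l → F) (k : ℕ) : F :=
  ∏ m ∈ Finset.univ.filter (fun m : Fin l => m.val < k), z m ^ A (w m) i

variable (A : Matrix I I ℤ) (w : Fin l → I) (i : I) (c : F) (z : Fin l → F)

theorem schubertPre_succ (k : Fin l) :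
    schubertPre A w i z (k + 1) = schubertPre A w i z k * z k ^ A (w k) i := by
  have : Finset.univ.filter (fun m : Fin l => m.val < k + 1) =
      insert k (Finset.univ.filter (fun m : Fin l => m.val < k)) := by
    ext m
    simp only [Finset.mem_filter, Finset.mem_univ, true_and, Finset.mem_insert, Fin.ext_iff]
    omega
  rw [schubertPre, this, Finset.prod_insert (by simp), mul_comm, schubertPre]

variable [DecidableEq I]

/-- The denominator at position `k` (counted from `0`) in the formula for `e_i^c`: the sum of the
`T_m`, those with `m < k` multiplied by `c`. The numerator at position `k` is the denominator at
position `k + 1`. -/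
def schubertDen (k : ℕ) : F :=
  ∑ m ∈ Finset.univ.filter (fun m => w m = i),
    if m.val < k then c * schubertTerm A w i z m else schubertTerm A w i z m

theorem schubertE_eq (k : Fin l) :
    schubertE A w i c z k =
      z k * (schubertDen A w i c z (k + 1) / schubertDen A w i c z k) := by
  simp only [schubertE, schubertDen, Fin.le_def, Fin.lt_def, Nat.lt_succ_iff]

theorem schubertDen_succ_of_ne {k : Fin l} (hk : w k ≠ i) :
    schubertDen A w i c z (k + 1) = schubertDen A w i c z k := by
  refine Finset.sum_congr rfl fun m hm => ?_
  have hm' : w m = i := by simpa using hm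
  have : m ≠ k := by rintro rfl; exact hk hm'
  have : m.val ≠ k.val := fun h => this (Fin.ext h)
  simp only [show m.val < k.val + 1 ↔ m.val < k.val by omega]

theorem schubertDen_succ_self {k : Fin l} (hk : w k = i) :
    schubertDen A w i c z (k + 1) =
      schubertDen A w i c z k + (c - 1) * schubertTerm A w i z k := by
  have hmem : k ∈ Finset.univ.filter (fun m => w m = i) := by simp [hk]
  rw [schubertDen, schubertDen, ← Finset.add_sum_erase _ _ hmem, ← Finset.add_sum_erase _ _ hmem]
  have : ∀ m ∈ (Finset.univ.filter (fun m => w m = i)).erase k,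
      (if m.val < k.val + 1 then c * schubertTerm A w i z m else schubertTerm A w i z m) =
      if m.val < k.val then c * schubertTerm A w i z m else schubertTerm A w i z m := by
    intro m hm
    have : m.val ≠ k.val := fun h => Finset.ne_of_mem_erase hm (Fin.ext h)
    simp only [show m.val < k.val + 1 ↔ m.val < k.val by omega]
  rw [Finset.sum_congr rfl this]
  simp
  ring

theorem schubertDen_zero : schubertDen A w i c z 0 = schubertEps A w i z := by
  simp [schubertDen, schubertEps]

theorem schubertDen_length : schubertDen A w i c z l = c * schubertEps A w i z := by
  simp [schubertDen, schubertEps, Finset.mul_sum]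

/-- The factors by which `e_i^c` multiplies the coordinates with letter `i` telescope to `c`, and
the other coordinates are unchanged. -/
theorem schubertGamma_schubertE (i' : I)
    (hD : ∀ k ≤ l, schubertDen A w i c z k ≠ 0) :
    schubertGamma A w i' (schubertE A w i c z) = c ^ A i i' * schubertGamma A w i' z := by
  have h0 : schubertEps A w i z ≠ 0 := by
    rw [← schubertDen_zero A w i c z]
    exact hD 0 (Nat.zero_le _)
  -- if the letter at `k` is not `i`, the ratio is `1` and the exponent may be replaced
  have hk (k : Fin l) : schubertE A w i c z k ^ A (w k) i' = z k ^ A (w k) i' *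
      (schubertDen A w i c z (k + 1) / schubertDen A w i c z k) ^ A i i' := by
    rw [schubertE_eq, mul_zpow]
    by_cases h : w k = i
    · rw [h]
    · rw [schubertDen_succ_of_ne A w i c z h, div_self (hD k k.2.le), one_zpow, one_zpow]
  have key : ∀ n ≤ l, ∏ k ∈ Finset.range n,
      (schubertDen A w i c z (k + 1) / schubertDen A w i c z k) =
        schubertDen A w i c z n / schubertDen A w i c z 0 := by
    intro n hn
    induction n with
    | zero => simp [div_self (hD 0 hn)]
    | succ n ih =>
      rw [Finset.prod_range_succ, ih (by omega)]
      have := hD n (by omega)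
      field_simp
  rw [schubertGamma, Finset.prod_congr rfl fun k _ => hk k, Finset.prod_mul_distrib,
    Finset.prod_zpow, Fin.prod_univ_eq_prod_range
      (fun k => schubertDen A w i c z (k + 1) / schubertDen A w i c z k) l, key l le_rfl,
    schubertDen_length, schubertDen_zero, mul_div_assoc, div_self h0, mul_one, mul_comm,
    schubertGamma]

end Threading

/-! ### The symmetric matrix of a word -/

section Point

variable {F : Type} [Field F] {l : ℕ}

/-- The matrix obtained from `0` by applying the letters of a list, the last one first. -/
def pointList (L : List (Fin 5 × F)) : Matrix (Fin 4) (Fin 4) F :=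
  L.foldr (fun p S => letter p.1 p.2 S) 0

/-- The matrix obtained from `0` by the letters `Y_{i_1}(z_1), …, Y_{i_l}(z_l)` of a word. -/
def point (w : Fin l → Fin 5) (z : Fin l → F) : Matrix (Fin 4) (Fin 4) F :=
  pointList (List.ofFn fun k => (w k, z k))

/-- The graph of zero, spanned by `1, 2, 3, 4`, is fixed by `x_j(a)`. -/
theorem UnipRel.zero (j : Fin 5) (a : F) : UnipRel j a 0 0 := by
  unfold UnipRel
  split_ifs <;> simp

/-- The Schubert cell formula for `e_j^c` describes multiplication by `x_j((c - 1) / ε_j)` from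
the left. Moving this element to the right through the letters, its parameter in front of position
`k` is `(c - 1) / (P_k D_k)` with `P_k = schubertPre` and `D_k = schubertDen`, and after the last
letter it acts trivially on the base point. -/
theorem unipRel_point {w : Fin l → Fin 5} (hw : ∀ k, w k ≠ 0) {j : Fin 5} (hj : j ≠ 0) (c : F)
    {z : Fin l → F} (hz : ∀ k, z k ≠ 0)
    (hD : ∀ k ≤ l, schubertDen cartanC4 w j c z k ≠ 0) :
    UnipRel j ((c - 1) / schubertEps cartanC4 w j z) (point w z)
      (point w (schubertE cartanC4 w j c z)) := by
  set z' := schubertE cartanC4 w j c z with hz'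
  have hpre (k : ℕ) : schubertPre cartanC4 w j z k ≠ 0 :=
    Finset.prod_ne_zero_iff.2 fun m _ => zpow_ne_zero _ (hz m)
  have key : ∀ k ≤ l,
      UnipRel j ((c - 1) / (schubertPre cartanC4 w j z k * schubertDen cartanC4 w j c z k))
        (pointList ((List.ofFn fun k => (w k, z k)).drop k))
        (pointList ((List.ofFn fun k => (w k, z' k)).drop k)) := by
    intro k hk
    induction hk using Nat.decreasingInduction with
    | self =>
      rw [List.drop_eq_nil_of_le (by simp), List.drop_eq_nil_of_le (by simp)]
      exact UnipRel.zero _ _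
    | of_succ k hk ih =>
      rw [List.drop_eq_getElem_cons (by simpa using hk),
        List.drop_eq_getElem_cons (l := List.ofFn fun k => (w k, z' k)) (by simpa using hk)]
      simp only [pointList, List.foldr_cons, List.getElem_ofFn]
      change UnipRel j _ (letter _ _ (pointList _)) (letter _ _ (pointList _))
      set m : Fin l := ⟨k, hk⟩
      have hp : schubertPre cartanC4 w j z (k + 1) =
        schubertPre cartanC4 w j z k * z m ^ cartanC4 (w m) j :=
        schubertPre_succ cartanC4 w j z m
      have hpk := hpre k
      have hDk := hD k hk.le
      have hDk' := hD (k + 1) hk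
      have hzm := hz m
      have hz'm : z' m =
          z m * (schubertDen cartanC4 w j c z (k + 1) / schubertDen cartanC4 w j c z k) :=
        schubertE_eq cartanC4 w j c z m
      by_cases hm : w m = j
      · have hs : schubertDen cartanC4 w j c z (k + 1) = schubertDen cartanC4 w j c z k +
            (c - 1) * schubertTerm cartanC4 w j z m :=
          schubertDen_succ_self cartanC4 w j c z hm
        have hT : schubertTerm cartanC4 w j z m = 1 / (schubertPre cartanC4 w j z k * z m) :=
          rfl
        -- the new coordinate is `z + a` with `a` the parameter in front of position `k`
        have ha : z' m = z m +
            (c - 1) / (schubertPre cartanC4 w j z k * schubertDen cartanC4 w j c z k) := by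
          rw [hz'm, hs, hT]
          field_simp
        have hA : cartanC4 j j = 2 := by fin_cases j <;> rfl
        rw [ha, hm]
        refine UnipRel.letter_self hj hzm ?_ ?_
        · rw [← ha, hz'm]
          exact mul_ne_zero hzm (div_ne_zero hDk' hDk)
        · convert ih using 1
          rw [← ha, hz'm, hp, hm, hA]
          field_simp
      · have hs : schubertDen cartanC4 w j c z (k + 1) = schubertDen cartanC4 w j c z k :=
          schubertDen_succ_of_ne cartanC4 w j c z hm
        have ha : z' m = z m := by rw [hz'm, hs, div_self hDk, mul_one]
        rw [ha]
        refine UnipRel.letter_ne (hw m) hj hm hzm ?_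
        convert ih using 1
        rw [hp, hs, zpow_neg]
        field_simp
  have := key 0 (Nat.zero_le _)
  rw [schubertDen_zero] at this
  simpa [schubertPre, point] using this

theorem letter_one {z : F} (hz : z ≠ 0) (s00 s01 s02 s03 s11 s12 s13 s22 s23 s33 : F) :
    letter 1 z !![s00, s01, s02, s03; s01, s11, s12, s13; s02, s12, s22, s23;
        s03, s13, s23, s33] =
      !![s00 / z ^ 2 + 2 * s01 / z + s11, s01 + z * s11, s02 / z + s12, s03 / z + s13;
        s01 + z * s11, z ^ 2 * s11, z * s12, z * s13;
        s02 / z + s12, z * s12, s22, s23;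
        s03 / z + s13, z * s13, s23, s33] := by
  rw [← Matrix.ext_iff]
  simp [Fin.forall_fin_succ, letter, letterA, letterB, Matrix.vecMul,
    dotProduct, Fin.sum_univ_succ]
  repeat' apply And.intro
  all_goals field_simp
  all_goals ring

theorem letter_two {z : F} (hz : z ≠ 0) (s00 s01 s02 s03 s11 s12 s13 s22 s23 s33 : F) :
    letter 2 z !![s00, s01, s02, s03; s01, s11, s12, s13; s02, s12, s22, s23;
        s03, s13, s23, s33] =
      !![s00, s01 / z + s02, z * s02, s03;
        s01 / z + s02, s11 / z ^ 2 + 2 * s12 / z + s22, s12 + z * s22, s13 / z + s23;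
        z * s02, s12 + z * s22, z ^ 2 * s22, z * s23;
        s03, s13 / z + s23, z * s23, s33] := by
  rw [← Matrix.ext_iff]
  simp [Fin.forall_fin_succ, letter, letterA, letterB, Matrix.vecMul,
    dotProduct, Fin.sum_univ_succ]
  repeat' apply And.intro
  all_goals field_simp
  all_goals ring

theorem letter_three {z : F} (hz : z ≠ 0) (s00 s01 s02 s03 s11 s12 s13 s22 s23 s33 : F) :
    letter 3 z !![s00, s01, s02, s03; s01, s11, s12, s13; s02, s12, s22, s23;
        s03, s13, s23, s33] =
      !![s00, s01, s02 / z + s03, z * s03;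
        s01, s11, s12 / z + s13, z * s13;
        s02 / z + s03, s12 / z + s13, s22 / z ^ 2 + 2 * s23 / z + s33, s23 + z * s33;
        z * s03, z * s13, s23 + z * s33, z ^ 2 * s33] := by
  rw [← Matrix.ext_iff]
  simp [Fin.forall_fin_succ, letter, letterA, letterB, Matrix.vecMul,
    dotProduct, Fin.sum_univ_succ]
  repeat' apply And.intro
  all_goals field_simp
  all_goals ring

theorem letter_four (z s00 s01 s02 s03 s11 s12 s13 s22 s23 s33 : F) :
    letter 4 z !![s00, s01, s02, s03; s01, s11, s12, s13; s02, s12, s22, s23;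
        s03, s13, s23, s33] =
      !![s00, s01, s02, s03 / z;
        s01, s11, s12, s13 / z;
        s02, s12, s22, s23 / z;
        s03 / z, s13 / z, s23 / z, s33 / z ^ 2 + 1 / z] := by
  rw [← Matrix.ext_iff]
  simp [Fin.forall_fin_succ, letter, letterA, letterB, Matrix.vecMul,
    dotProduct, Fin.sum_univ_succ]
  repeat' apply And.intro
  all_goals ring

/-- The ten letters of `V_1(x)` produce the matrix `chart x`. -/
theorem point_word1 {x : Fin 10 → F} (hx : ∀ k, x k ≠ 0) :
    point word1 x = (chart x).sym := by
  have h0 := hx 0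
  have h1 := hx 1
  have h2 := hx 2
  have h3 := hx 3
  have h4 := hx 4
  have h5 := hx 5
  have h6 := hx 6
  have h7 := hx 7
  have h8 := hx 8
  have h9 := hx 9
  have hl : (List.ofFn fun k => (word1 k, x k)) = [(4, x 0), (3, x 1), (4, x 2), (2, x 3),
      (3, x 4), (4, x 5), (1, x 6), (2, x 7), (3, x 8), (4, x 9)] := by
    simp [List.ofFn_succ, word1]
  have hz : (0 : Matrix (Fin 4) (Fin 4) F) =
      !![0, 0, 0, 0; 0, 0, 0, 0; 0, 0, 0, 0; 0, 0, 0, 0] := by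
    rw [← Matrix.ext_iff]
    simp [Fin.forall_fin_succ]
  simp only [point, hl, pointList, List.foldr_cons, List.foldr_nil, hz, letter_four,
    letter_three h1, letter_three h4, letter_three h8, letter_two h3, letter_two h7,
    letter_one h6]
  rw [← Matrix.ext_iff]
  simp [Fin.forall_fin_succ, LDL.sym, chart]
  field_simp
  repeat' apply And.intro
  all_goals first | trivial | ring

end Point

/-! ### Subtraction-free formulas -/

section SubtractionFree

/-- A relation between two fields that contains `(1, 1)` and is stable under addition,
multiplication and division. It is then preserved by every formula that is a composition of these
operations. No condition of nonvanishing is imposed in `div`; it is to be built into `R`. -/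
structure IsSubtractionFree {F G : Type} [Field F] [Field G] (R : F → G → Prop) : Prop where
  one : R 1 1
  add {a a' : F} {b b' : G} : R a b → R a' b' → R (a + a') (b + b')
  mul {a a' : F} {b b' : G} : R a b → R a' b' → R (a * a') (b * b')
  div {a a' : F} {b b' : G} : R a b → R a' b' → R (a / a') (b / b')

namespace IsSubtractionFree

variable {F G : Type} [Field F] [Field G] {R : F → G → Prop}

theorem inv (hR : IsSubtractionFree R) {a : F} {b : G} (h : R a b) : R a⁻¹ b⁻¹ := by
  simpa using hR.div hR.one h

theorem pow (hR : IsSubtractionFree R) {a : F} {b : G} (h : R a b) (n : ℕ) :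
    R (a ^ n) (b ^ n) := by
  induction n with
  | zero => simpa using hR.one
  | succ n ih => simpa [pow_succ] using hR.mul ih h

theorem zpow (hR : IsSubtractionFree R) {a : F} {b : G} (h : R a b) (n : ℤ) :
    R (a ^ n) (b ^ n) := by
  cases n with
  | ofNat n => simpa using hR.pow h n
  | negSucc n => simpa [zpow_negSucc] using hR.inv (hR.pow h (n + 1))

theorem prod (hR : IsSubtractionFree R) {ι : Type} {s : Finset ι} {f : ι → F}
    {g : ι → G} (h : ∀ k ∈ s, R (f k) (g k)) : R (∏ k ∈ s, f k) (∏ k ∈ s, g k) := by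
  classical
  induction s using Finset.induction_on with
  | empty => simpa using hR.one
  | insert a s ha ih =>
    rw [Finset.prod_insert ha, Finset.prod_insert ha]
    exact hR.mul (h _ (Finset.mem_insert_self _ _))
      (ih fun k hk => h k (Finset.mem_insert_of_mem hk))

theorem sum (hR : IsSubtractionFree R) {ι : Type} {s : Finset ι} (hs : s.Nonempty) {f : ι → F}
    {g : ι → G} (h : ∀ k ∈ s, R (f k) (g k)) : R (∑ k ∈ s, f k) (∑ k ∈ s, g k) := by
  classical
  induction hs using Finset.Nonempty.cons_induction with
  | singleton a => simpa using h
  | cons a s ha hs ih =>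
    rw [Finset.sum_cons, Finset.sum_cons]
    exact hR.add (h _ (Finset.mem_cons_self _ _))
      (ih fun k hk => h k (Finset.mem_cons_of_mem hk))

variable {I : Type} {l : ℕ} (A : Matrix I I ℤ) {w : Fin l → I} {i : I}
  {z : Fin l → F} {z' : Fin l → G} {c : F} {c' : G}

theorem schubertTerm (hR : IsSubtractionFree R) (hz : ∀ k, R (z k) (z' k)) (m : Fin l) :
    R (schubertTerm A w i z m) (schubertTerm A w i z' m) :=
  hR.div hR.one (hR.mul (hR.prod fun k _ => hR.zpow (hz k) _) (hz m))

theorem schubertDen [DecidableEq I] (hR : IsSubtractionFree R) (hw : ∃ m, w m = i) (hc : R c c')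
    (hz : ∀ k, R (z k) (z' k)) (k : ℕ) :
    R (schubertDen A w i c z k) (schubertDen A w i c' z' k) := by
  obtain ⟨m, hm⟩ := hw
  refine hR.sum ⟨m, by simpa using hm⟩ fun m _ => ?_
  split_ifs
  · exact hR.mul hc (hR.schubertTerm A hz m)
  · exact hR.schubertTerm A hz m

theorem schubertE [DecidableEq I] (hR : IsSubtractionFree R) (hw : ∃ m, w m = i) (hc : R c c')
    (hz : ∀ k, R (z k) (z' k)) (k : Fin l) :
    R (schubertE A w i c z k) (schubertE A w i c' z' k) := by
  rw [schubertE_eq, schubertE_eq]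
  exact hR.mul (hz k) (hR.div (hR.schubertDen A hw hc hz _) (hR.schubertDen A hw hc hz _))

theorem schubertEps [DecidableEq I] (hR : IsSubtractionFree R) (hw : ∃ m, w m = i)
    (hz : ∀ k, R (z k) (z' k)) : R (schubertEps A w i z) (schubertEps A w i z') := by
  obtain ⟨m, hm⟩ := hw
  exact hR.sum ⟨m, by simpa using hm⟩ fun m _ => hR.schubertTerm A hz m

theorem schubertGamma (hR : IsSubtractionFree R) (hz : ∀ k, R (z k) (z' k)) :
    R (schubertGamma A w i z) (schubertGamma A w i z') :=
  hR.prod fun k _ => hR.zpow (hz k) _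

theorem sigma (hR : IsSubtractionFree R) {x : Fin 10 → F} {x' : Fin 10 → G}
    (hx : ∀ k, R (x k) (x' k)) (k : Fin 10) : R (sigma x k) (sigma x' k) := by
  have hp : R (polP x) (polP x') := by
    refine hR.add (hR.add ?_ ?_) ?_ <;> exact hR.mul (hR.mul (hx _) (hx _)) (hx _)
  have hq : R (polQ x) (polQ x') := by
    refine hR.add (hR.add ?_ ?_) ?_ <;> exact hR.mul (hR.mul (hx _) (hx _)) (hx _)
  have hr : R (polR x) (polR x') := by
    refine hR.add (hR.add ?_ ?_) (hR.mul (hR.mul (hx _) (hR.pow (hx _) _)) (hx _)) <;>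
      exact hR.mul (hR.mul (hR.mul (hx _) (hx _)) (hx _)) (hx _)
  -- the ten coordinates of `σ̄(x)` in turn
  rw [sigma_eq, sigma_eq]
  revert k
  have h2 (a b : Fin 10) := hR.mul (hx a) (hx b)
  have h3 (a b c : Fin 10) := hR.mul (h2 a b) (hx c)
  have h4 (a b c d : Fin 10) := hR.mul (h3 a b c) (hx d)
  rw [Fin.forall_fin_succ]
  refine ⟨hR.div hR.one (hx _), ?_⟩
  rw [Fin.forall_fin_succ]
  refine ⟨hR.div hp (h4 _ _ _ _), ?_⟩
  rw [Fin.forall_fin_succ]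
  refine ⟨hR.div hR.one (hx _), ?_⟩
  rw [Fin.forall_fin_succ]
  refine ⟨hR.div hr (hR.mul (h4 _ _ _ _) (hx _)), ?_⟩
  rw [Fin.forall_fin_succ]
  refine ⟨hR.div (hR.mul hq (hx _)) (hR.mul (h2 _ _) hp), ?_⟩
  rw [Fin.forall_fin_succ]
  refine ⟨hR.div hR.one (hx _), ?_⟩
  rw [Fin.forall_fin_succ]
  refine ⟨hR.div (h3 _ _ _) (h4 _ _ _ _), ?_⟩
  rw [Fin.forall_fin_succ]
  refine ⟨hR.div (h4 _ _ _ _) (hR.mul (hx _) hr), ?_⟩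
  rw [Fin.forall_fin_succ]
  refine ⟨hR.div (h3 _ _ _) (hR.mul (hx _) hq), ?_⟩
  rw [Fin.forall_fin_one]
  exact hR.div hR.one (hx _)

end IsSubtractionFree

end SubtractionFree

/-! ### Positive rational functions and values of rational functions -/

section Positive

variable {σ : Type}

theorem algebraMap_map_ne_zero {P : MvPolynomial σ ℝ≥0} (hP : P ≠ 0) :
    algebraMap (MvPolynomial σ ℂ) (RatFun σ) (P.map (algebraMap ℝ≥0 ℂ)) ≠ 0 := by
  have hinj : Function.Injective (algebraMap ℝ≥0 ℂ) := fun a b h =>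
    NNReal.coe_injective (Complex.ofReal_injective h)
  rw [Ne, FaithfulSMul.algebraMap_eq_zero_iff,
    map_eq_zero_iff _ (MvPolynomial.map_injective _ hinj)]
  exact hP

theorem IsPositive.ne_zero {f : RatFun σ} (hf : IsPositive f) : f ≠ 0 := by
  obtain ⟨P, Q, hP, hQ, rfl⟩ := hf
  exact div_ne_zero (algebraMap_map_ne_zero hP) (algebraMap_map_ne_zero hQ)

theorem isPositive_one : IsPositive (1 : RatFun σ) :=
  ⟨1, 1, one_ne_zero, one_ne_zero, by simp⟩

theorem isPositive_coord (s : σ) : IsPositive (coord s) :=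
  ⟨MvPolynomial.X s, 1, MvPolynomial.X_ne_zero s, one_ne_zero, by simp [coord]⟩

theorem IsPositive.mul {f g : RatFun σ} (hf : IsPositive f) (hg : IsPositive g) :
    IsPositive (f * g) := by
  obtain ⟨P, Q, hP, hQ, rfl⟩ := hf
  obtain ⟨P', Q', hP', hQ', rfl⟩ := hg
  exact ⟨P * P', Q * Q', mul_ne_zero hP hP', mul_ne_zero hQ hQ', by
    simp only [map_mul, div_mul_div_comm]⟩

theorem IsPositive.div {f g : RatFun σ} (hf : IsPositive f) (hg : IsPositive g) :
    IsPositive (f / g) := by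
  obtain ⟨P, Q, hP, hQ, rfl⟩ := hf
  obtain ⟨P', Q', hP', hQ', rfl⟩ := hg
  exact ⟨P * Q', Q * P', mul_ne_zero hP hQ', mul_ne_zero hQ hP', by
    simp only [map_mul, div_div_div_eq]⟩

theorem IsPositive.add {f g : RatFun σ} (hf : IsPositive f) (hg : IsPositive g) :
    IsPositive (f + g) := by
  obtain ⟨P, Q, hP, hQ, rfl⟩ := hf
  obtain ⟨P', Q', hP', hQ', rfl⟩ := hg
  refine ⟨P * Q' + Q * P', Q * Q', fun h => mul_ne_zero hP hQ' ?_, mul_ne_zero hQ hQ', ?_⟩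
  -- over `ℝ≥0` a sum vanishes only if both summands do
  · ext m
    have := congrArg (MvPolynomial.coeff m) h
    simp only [MvPolynomial.coeff_add, MvPolynomial.coeff_zero, add_eq_zero] at this
    rw [this.1, MvPolynomial.coeff_zero]
  · have h := algebraMap_map_ne_zero hQ
    have h' := algebraMap_map_ne_zero hQ'
    simp only [map_mul, map_add, div_add_div _ _ h h']

/-- Positivity, regarded as a relation by means of an idle first argument. -/
theorem isSubtractionFree_isPositive :
    IsSubtractionFree (fun (_ : RatFun σ) (f : RatFun σ) => IsPositive f) where
  one := isPositive_one
  add := IsPositive.add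
  mul := IsPositive.mul
  div := IsPositive.div

section Value

variable {L : Type} [Field L] [Algebra ℂ L] {p : σ → L} {f g : RatFun σ} {v w : L}

theorem isValue_coord (p : σ → L) (s : σ) : IsValue (coord s) p (p s) :=
  ⟨MvPolynomial.X s, 1, by simp, by simp [coord], by simp⟩

theorem isValue_one (p : σ → L) : IsValue 1 p 1 := ⟨1, 1, by simp, by simp, by simp⟩

/-- A polynomial that does not vanish at some point is nonzero in the function field. -/
theorem algebraMap_ne_zero_of_aeval {Q : MvPolynomial σ ℂ} (h : MvPolynomial.aeval p Q ≠ 0) :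
    algebraMap (MvPolynomial σ ℂ) (RatFun σ) Q ≠ 0 := by
  rw [Ne, FaithfulSMul.algebraMap_eq_zero_iff]
  rintro rfl
  simp at h

theorem IsValue.mul (hf : IsValue f p v) (hg : IsValue g p w) : IsValue (f * g) p (v * w) := by
  obtain ⟨P, Q, hQ, rfl, rfl⟩ := hf
  obtain ⟨P', Q', hQ', rfl, rfl⟩ := hg
  refine ⟨P * P', Q * Q', ?_, ?_, ?_⟩
  · rw [map_mul]
    exact mul_ne_zero hQ hQ'
  all_goals simp only [map_mul, div_mul_div_comm]

theorem IsValue.div (hf : IsValue f p v) (hg : IsValue g p w) (hw : w ≠ 0) :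
    IsValue (f / g) p (v / w) := by
  obtain ⟨P, Q, hQ, rfl, rfl⟩ := hf
  obtain ⟨P', Q', hQ', rfl, rfl⟩ := hg
  refine ⟨P * Q', Q * P', ?_, ?_, ?_⟩
  · rw [map_mul]
    exact mul_ne_zero hQ fun h => hw (by rw [h, zero_div])
  all_goals simp only [map_mul, div_div_div_eq]

theorem IsValue.add (hf : IsValue f p v) (hg : IsValue g p w) : IsValue (f + g) p (v + w) := by
  obtain ⟨P, Q, hQ, rfl, rfl⟩ := hf
  obtain ⟨P', Q', hQ', rfl, rfl⟩ := hg
  refine ⟨P * Q' + Q * P', Q * Q', ?_, ?_, ?_⟩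
  · rw [map_mul]
    exact mul_ne_zero hQ hQ'
  · simp only [map_mul, map_add, div_add_div _ _ (algebraMap_ne_zero_of_aeval hQ)
      (algebraMap_ne_zero_of_aeval hQ')]
  · simp only [map_mul, map_add, div_add_div _ _ hQ hQ']

end Value

/-- At a point `p`, a rational function given by a subtraction-free formula in functions with
positive values is defined, with the value given by the same formula: positive elements are
nonzero, so no denominator vanishes. -/
theorem isSubtractionFree_isValue {τ : Type} (p : σ → RatFun τ) :
    IsSubtractionFree (fun f v => IsValue f p v ∧ IsPositive v) where
  one := ⟨isValue_one p, isPositive_one⟩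
  add h h' := ⟨h.1.add h'.1, h.2.add h'.2⟩
  mul h h' := ⟨h.1.mul h'.1, h.2.mul h'.2⟩
  div h h' := ⟨h.1.div h'.1 h'.2.ne_zero, h.2.div h'.2⟩

end Positive

/-! ### The crystal formulas at arbitrary points -/

section Crystal

/-- The operator `e_i^c` on points of the torus over an arbitrary field. -/
def crystalE {F : Type} [Field F] (i : Fin 5) (c : F) (x : Fin 10 → F) : Fin 10 → F :=
  if i = 0 then sigma (schubertE cartanC4 word2 0 c (sigma x)) else schubertE cartanC4 word1 i c x

/-- The function `ε_i` on points of the torus over an arbitrary field. -/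
def crystalEps {F : Type} [Field F] (i : Fin 5) (x : Fin 10 → F) : F :=
  if i = 0 then schubertEps cartanC4 word2 0 (sigma x) else schubertEps cartanC4 word1 i x

/-- The function `γ_i` on points of the torus over an arbitrary field. -/
def crystalGamma {F : Type} [Field F] (i : Fin 5) (x : Fin 10 → F) : F :=
  if i = 0 then schubertGamma cartanC4 word2 0 (sigma x) else schubertGamma cartanC4 word1 i x

theorem mem_word1 : ∀ {i : Fin 5}, i ≠ 0 → ∃ m, word1 m = i := by decide

variable {F G : Type} [Field F] [Field G] {R : F → G → Prop}

theorem IsSubtractionFree.crystalE (hR : IsSubtractionFree R) (i : Fin 5) {c : F} {c' : G}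
    (hc : R c c') {x : Fin 10 → F} {x' : Fin 10 → G} (hx : ∀ k, R (x k) (x' k)) (k : Fin 10) :
    R (crystalE i c x k) (crystalE i c' x' k) := by
  unfold GeomCrystal.crystalE
  split_ifs with hi
  · exact hR.sigma (hR.schubertE _ ⟨0, rfl⟩ hc (hR.sigma hx)) k
  · exact hR.schubertE _ (mem_word1 hi) hc hx k

theorem IsSubtractionFree.crystalEps (hR : IsSubtractionFree R) (i : Fin 5)
    {x : Fin 10 → F} {x' : Fin 10 → G} (hx : ∀ k, R (x k) (x' k)) :
    R (crystalEps i x) (crystalEps i x') := by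
  unfold GeomCrystal.crystalEps
  split_ifs with hi
  · exact hR.schubertEps _ ⟨0, rfl⟩ (hR.sigma hx)
  · exact hR.schubertEps _ (mem_word1 hi) hx

theorem IsSubtractionFree.crystalGamma (hR : IsSubtractionFree R) (i : Fin 5)
    {x : Fin 10 → F} {x' : Fin 10 → G} (hx : ∀ k, R (x k) (x' k)) :
    R (crystalGamma i x) (crystalGamma i x') := by
  unfold GeomCrystal.crystalGamma
  split_ifs with hi
  · exact hR.schubertGamma _ (hR.sigma hx)
  · exact hR.schubertGamma _ hx

theorem crystalV1_e (i : Fin 5) (k : Fin 10) : crystalV1.e i k =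
    crystalE i (coord none) (fun k => coord (some k)) k := by
  unfold crystalV1 crystalE
  split_ifs with hi
  · simp only [hi, if_true, sigmaInv_eq_sigma]
  · simp only [hi, if_false]

theorem crystalV1_isPositiveCrystal : crystalV1.IsPositiveCrystal where
  e_pos i k := by
    rw [crystalV1_e]
    exact isSubtractionFree_isPositive.crystalE (c := (1 : RatFun (Option (Fin 10)))) (x := 1) i
      (isPositive_coord _) (fun k => isPositive_coord _) k
  gamma_pos i :=
    isSubtractionFree_isPositive.crystalGamma (x := 1) i fun k => isPositive_coord _
  eps_pos i :=
    isSubtractionFree_isPositive.crystalEps (x := 1) i fun k => isPositive_coord _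

variable {τ : Type} {c : RatFun τ} {x : Fin 10 → RatFun τ}

theorem isPositive_crystalE (i : Fin 5) (hc : IsPositive c) (hx : ∀ k, IsPositive (x k))
    (k : Fin 10) : IsPositive (crystalE i c x k) :=
  isSubtractionFree_isPositive.crystalE (c := c) (x := x) i hc hx k

theorem isPositive_crystalEps (i : Fin 5) (hx : ∀ k, IsPositive (x k)) :
    IsPositive (crystalEps i x) :=
  isSubtractionFree_isPositive.crystalEps (x := x) i hx

theorem isPositive_sigma (hx : ∀ k, IsPositive (x k)) (k : Fin 10) : IsPositive (sigma x k) :=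
  isSubtractionFree_isPositive.sigma (x := x) hx k

/-- At positive points the rational map `e_i^c` is defined and is given by its formula. -/
theorem crystalV1_acts (i : Fin 5) (hc : IsPositive c) (hx : ∀ k, IsPositive (x k)) :
    crystalV1.Acts i c x (crystalE i c x) := by
  intro k
  have h := (isSubtractionFree_isValue (fun o : Option (Fin 10) => o.elim c x)).crystalE i
    (c := coord none) (c' := c) ⟨isValue_coord _ _, hc⟩ (x := fun k => coord (some k)) (x' := x)
    (fun k => ⟨isValue_coord _ _, hx k⟩) k
  rw [crystalV1_e]
  exact ⟨h.1, h.2.ne_zero⟩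

theorem isValue_crystalEps (i : Fin 5) (hx : ∀ k, IsPositive (x k)) :
    IsValue (crystalV1.ε i) x (crystalEps i x) :=
  ((isSubtractionFree_isValue x).crystalEps i (x := fun k => coord k)
    (fun k => ⟨isValue_coord _ _, hx k⟩)).1

theorem isValue_crystalGamma (i : Fin 5) (hx : ∀ k, IsPositive (x k)) :
    IsValue (crystalV1.γ i) x (crystalGamma i x) :=
  ((isSubtractionFree_isValue x).crystalGamma i (x := fun k => coord k)
    (fun k => ⟨isValue_coord _ _, hx k⟩)).1

end Crystal

/-! ### The diagram automorphism `i ↦ 4 - i` -/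

section Flip

variable {F : Type} [Field F]

/-- The automorphism `i ↦ 4 - i` of the diagram maps the word of `V_1` to the word of `V_2`. -/
theorem cartanC4_word2 : ∀ (k : Fin 10) (i : Fin 5),
    cartanC4 (word2 k) i = cartanC4 (word1 k) i.rev := by decide

theorem word2_eq_iff : ∀ (k : Fin 10) (i : Fin 5), word2 k = i ↔ word1 k = i.rev := by decide

theorem schubertTerm_word2 (i : Fin 5) (x : Fin 10 → F) (m : Fin 10) :
    schubertTerm cartanC4 word2 i x m = schubertTerm cartanC4 word1 i.rev x m := by
  simp only [schubertTerm, cartanC4_word2]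

theorem schubertE_word2 (i : Fin 5) (c : F) (x : Fin 10 → F) :
    schubertE cartanC4 word2 i c x = schubertE cartanC4 word1 i.rev c x := by
  funext j
  simp only [schubertE, schubertTerm_word2, word2_eq_iff]

theorem schubertEps_word2 (i : Fin 5) (x : Fin 10 → F) :
    schubertEps cartanC4 word2 i x = schubertEps cartanC4 word1 i.rev x := by
  simp only [schubertEps, schubertTerm_word2, word2_eq_iff]

/-- Under the diagram automorphism the Schubert cell formula for `0` and the second word is the
formula for `4` and the first word. -/
theorem crystalE_zero (c : F) (x : Fin 10 → F) :
    crystalE 0 c x = sigma (crystalE 4 c (sigma x)) := by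
  simp only [crystalE, if_true, schubertE_word2, Fin.reduceEq, if_false]
  rfl

theorem crystalEps_zero (x : Fin 10 → F) : crystalEps 0 x = crystalEps 4 (sigma x) := by
  simp only [crystalEps, if_true, schubertEps_word2, Fin.reduceEq, if_false]
  rfl

end Flip

/-! ### The functions `ε_i` and `γ_i` in matrix coordinates -/

section Eps

variable {F : Type} [Field F] {x : Fin 10 → F}

theorem crystalEps_four (hx : ∀ k, x k ≠ 0) : crystalEps 4 x = (chart x).sym 3 3 := by
  have h0 := hx 0
  have h1 := hx 1
  have h2 := hx 2
  have h4 := hx 4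
  have h5 := hx 5
  have h8 := hx 8
  have h9 := hx 9
  have hs : Finset.univ.filter (fun m => word1 m = 4) = {0, 2, 5, 9} := by decide
  simp [crystalEps, schubertEps, hs]
  simp [schubertTerm, Finset.prod_filter, Fin.prod_univ_succ, word1, cartanC4, LDL.sym, chart]
  field_simp
  ring

theorem crystalEps_three (hx : ∀ k, x k ≠ 0) :
    crystalEps 3 x = (chart x).l20 / (chart x).l30 := by
  have h0 := hx 0
  have h1 := hx 1
  have h2 := hx 2
  have h3 := hx 3
  have h4 := hx 4
  have h5 := hx 5
  have h7 := hx 7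
  have h8 := hx 8
  have hs : Finset.univ.filter (fun m => word1 m = 3) = {1, 4, 8} := by decide
  simp [crystalEps, schubertEps, hs]
  simp [schubertTerm, Finset.prod_filter, Fin.prod_univ_succ, word1, cartanC4, chart]
  field_simp
  ring

/-- Numerator and denominator are `2 × 2` minors of `L` in its first two columns. -/
theorem crystalEps_two (hx : ∀ k, x k ≠ 0) :
    crystalEps 2 x = ((chart x).l10 * (chart x).l31 - (chart x).l30) /
      ((chart x).l20 * (chart x).l31 - (chart x).l30 * (chart x).l21) := by
  have h0 := hx 0
  have h1 := hx 1
  have h2 := hx 2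
  have h3 := hx 3
  have h4 := hx 4
  have h5 := hx 5
  have h6 := hx 6
  have h7 := hx 7
  have h8 := hx 8
  have hd : (chart x).l20 * (chart x).l31 - (chart x).l30 * (chart x).l21 =
      x 3 * x 7 / (x 2 * x 0) := by
    simp only [chart]
    field_simp
    ring
  have hn : (chart x).l10 * (chart x).l31 - (chart x).l30 =
      (x 6 / x 3 + x 7 / x 4) * (x 4 * x 1 / (x 2 * x 0)) := by
    simp only [chart]
    field_simp
    ring
  rw [hd, hn]
  have hs : Finset.univ.filter (fun m => word1 m = 2) = {3, 7} := by decide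
  simp [crystalEps, schubertEps, hs]
  simp [schubertTerm, Finset.prod_filter, Fin.prod_univ_succ, word1, cartanC4]
  field_simp
  ring

/-- The formula for `ε_3`, read off from the dual matrix. -/
theorem crystalEps_one (hx : ∀ k, x k ≠ 0) :
    crystalEps 1 x = (chart x).dual.l20 / (chart x).dual.l30 := by
  have h0 := hx 0
  have h1 := hx 1
  have h2 := hx 2
  have h3 := hx 3
  have h4 := hx 4
  have h5 := hx 5
  have h6 := hx 6
  have hd : (chart x).dual.l20 = x 3 / x 0 := by
    simp only [chart, LDL.dual]
    field_simp
    ring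
  have hn : (chart x).dual.l30 = x 6 / x 0 := by
    simp only [chart, LDL.dual]
    field_simp
    ring
  rw [hd, hn]
  have hs : Finset.univ.filter (fun m => word1 m = 1) = {6} := by decide
  simp [crystalEps, schubertEps, hs]
  simp [schubertTerm, Finset.prod_filter, Fin.prod_univ_succ, word1, cartanC4]
  field_simp

/-- The Schubert cell formulas for the two words give the same functions `γ_i`, also for `i =
0`. -/
theorem schubertGamma_word2_sigma (hx : ∀ k, x k ≠ 0) (hs : ∀ k, sigma x k ≠ 0) (i : Fin 5) :
    schubertGamma cartanC4 word2 i (sigma x) = schubertGamma cartanC4 word1 i x := by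
  obtain ⟨hp, hq, hr⟩ := (sigma_ne_zero_iff hx).1 hs
  have h0 := hx 0
  have h1 := hx 1
  have h2 := hx 2
  have h3 := hx 3
  have h4 := hx 4
  have h5 := hx 5
  have h6 := hx 6
  have h7 := hx 7
  have h8 := hx 8
  have h9 := hx 9
  fin_cases i <;>
    simp [schubertGamma, Fin.prod_univ_succ, word1, word2, cartanC4, sigma_eq] <;> field_simp

end Eps

/-! ### Row operations in the coordinates of `L D Lᵀ` -/

section RowAdd

variable {F : Type} [Field F]

/-- The effect on `L` of adding `a` times row `i - 1` to row `i`, for `i = 1, 2, 3`; `D` is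
unchanged. -/
def LDL.rowAdd (i : Fin 5) (a : F) (m : LDL F) : LDL F :=
  ![m, { m with l10 := m.l10 + a },
    { m with l20 := m.l20 + a * m.l10, l21 := m.l21 + a },
    { m with l30 := m.l30 + a * m.l20, l31 := m.l31 + a * m.l21, l32 := m.l32 + a }, m] i

theorem eq_of_middle : ∀ {i : Fin 5}, i ≠ 0 → i ≠ 4 → i = 1 ∨ i = 2 ∨ i = 3 := by decide

theorem LDL.rowAdd_sym {i : Fin 5} (h0 : i ≠ 0) (h4 : i ≠ 4) (a : F) (m : LDL F) :
    (m.rowAdd i a).sym = rowOp i a * m.sym * (rowOp i a).transpose := by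
  obtain rfl | rfl | rfl := eq_of_middle h0 h4
  all_goals
    rw [← Matrix.ext_iff]
    simp [Fin.forall_fin_succ, rowAdd, sym, rowOp, Matrix.vecMul, dotProduct, Fin.sum_univ_succ]
    repeat' apply And.intro
  all_goals ring

/-- Passing to the dual matrix exchanges the row operations `i` and `4 - i`. -/
theorem LDL.dual_rowAdd {i : Fin 5} (h0 : i ≠ 0) (h4 : i ≠ 4) (a : F) (m : LDL F) :
    (m.rowAdd i a).dual = m.dual.rowAdd i.rev a := by
  obtain rfl | rfl | rfl := eq_of_middle h0 h4
  · change _ = m.dual.rowAdd 3 a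
    ext <;> simp [rowAdd, dual] <;> ring
  · change _ = m.dual.rowAdd 2 a
    ext <;> simp [rowAdd, dual] <;> ring
  · change _ = m.dual.rowAdd 1 a
    ext <;> simp [rowAdd, dual] <;> ring

theorem LDL.rowAdd_rowAdd (i : Fin 5) (a b : F) (m : LDL F) :
    (m.rowAdd i b).rowAdd i a = m.rowAdd i (a + b) := by
  fin_cases i <;> ext <;> simp [rowAdd] <;> ring

theorem LDL.rowAdd_zero (i : Fin 5) (m : LDL F) : m.rowAdd i 0 = m := by
  fin_cases i <;> simp [rowAdd]

end RowAdd

/-! ### The operators `e_i^c` on symmetric matrices -/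

section PositivePoints

variable {τ : Type} {x y : Fin 10 → RatFun τ} {c c₁ c₂ : RatFun τ}

theorem ne_zero_of_pos (hx : ∀ k, IsPositive (x k)) (k : Fin 10) : x k ≠ 0 := (hx k).ne_zero

theorem sigma_ne_zero_of_pos (hx : ∀ k, IsPositive (x k)) (k : Fin 10) : sigma x k ≠ 0 :=
  (isPositive_sigma hx k).ne_zero

theorem sigma_sigma_of_pos (hx : ∀ k, IsPositive (x k)) : sigma (sigma x) = x :=
  sigma_sigma (ne_zero_of_pos hx) (sigma_ne_zero_of_pos hx)

theorem chart_sigma_of_pos (hx : ∀ k, IsPositive (x k)) : chart (sigma x) = (chart x).dual := by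
  obtain ⟨hp, hq, hr⟩ := (sigma_ne_zero_iff (ne_zero_of_pos hx)).1 (sigma_ne_zero_of_pos hx)
  exact chart_sigma (ne_zero_of_pos hx) hp hq hr

theorem eq_of_sym_eq (hx : ∀ k, IsPositive (x k)) (hy : ∀ k, IsPositive (y k))
    (h : (chart x).sym = (chart y).sym) : x = y :=
  eq_of_chart_eq (ne_zero_of_pos hy) <| LDL.sym_injective
    (by simp [chart, ne_zero_of_pos hx]) (by simp [chart, ne_zero_of_pos hx])
    (by simp [chart, ne_zero_of_pos hx]) h

theorem schubertDen_ne_zero {i : Fin 5} (hi : i ≠ 0) (hc : IsPositive c)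
    (hx : ∀ k, IsPositive (x k)) (k : ℕ) : schubertDen cartanC4 word1 i c x k ≠ 0 :=
  (isSubtractionFree_isPositive.schubertDen cartanC4 (mem_word1 hi) (c := c) (z := x)
    hc hx k).ne_zero

/-- For `i ≠ 0`, the operator `e_i^c` acts on the matrix of `x` as `x_i((c - 1) / ε_i(x))`. -/
theorem unipRel_crystalE {i : Fin 5} (hi : i ≠ 0) (hc : IsPositive c)
    (hx : ∀ k, IsPositive (x k)) :
    UnipRel i ((c - 1) / crystalEps i x) (chart x).sym (chart (crystalE i c x)).sym := by
  have h := unipRel_point (w := word1) (by decide) hi c (ne_zero_of_pos hx)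
    (fun k _ => schubertDen_ne_zero hi hc hx k)
  have h' := isPositive_crystalE i hc hx
  rw [point_word1 (ne_zero_of_pos hx)] at h
  simp only [crystalE, crystalEps, hi, if_false] at h' ⊢
  rwa [point_word1 (ne_zero_of_pos h')] at h

theorem chart_crystalE {i : Fin 5} (h0 : i ≠ 0) (h4 : i ≠ 4) (hc : IsPositive c)
    (hx : ∀ k, IsPositive (x k)) :
    chart (crystalE i c x) = (chart x).rowAdd i ((c - 1) / crystalEps i x) := by
  have h := unipRel_crystalE h0 hc hx
  rw [UnipRel, if_neg h4, ← LDL.rowAdd_sym h0 h4] at h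
  have h' := ne_zero_of_pos (isPositive_crystalE i hc hx)
  exact LDL.sym_injective (by simp [chart, h']) (by simp [chart, h']) (by simp [chart, h']) h

/-- The involution `σ̄` exchanges `ε_i` and `ε_{4-i}`. -/
theorem crystalEps_sigma (hx : ∀ k, IsPositive (x k)) (i : Fin 5) :
    crystalEps i.rev (sigma x) = crystalEps i x := by
  have hs := sigma_ne_zero_of_pos hx
  have hx' := ne_zero_of_pos hx
  have h1 : ∀ {x : Fin 10 → RatFun τ}, (∀ k, IsPositive (x k)) →
      crystalEps 3 (sigma x) = crystalEps 1 x := by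
    intro x hx
    rw [crystalEps_one (ne_zero_of_pos hx), crystalEps_three (sigma_ne_zero_of_pos hx),
      chart_sigma_of_pos hx]
  fin_cases i
  · exact (crystalEps_zero x).symm
  · exact h1 hx
  · change crystalEps 2 (sigma x) = crystalEps 2 x
    rw [crystalEps_two hx', crystalEps_two hs, chart_sigma_of_pos hx]
    congr 1 <;> simp only [LDL.dual] <;> ring
  · change crystalEps 1 (sigma x) = crystalEps 3 x
    rw [← h1 (isPositive_sigma hx), sigma_sigma_of_pos hx]
  · change crystalEps 0 (sigma x) = crystalEps 4 x
    rw [crystalEps_zero, sigma_sigma_of_pos hx]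

/-- The involution `σ̄` intertwines `e_i^c` and `e_{4-i}^c`. For `i = 0, 4` this is the definition
of `e_0`; for the other `i` it expresses that the `e_i` defined through the two words agree. -/
theorem crystalE_sigma (hc : IsPositive c) (hx : ∀ k, IsPositive (x k)) (i : Fin 5) :
    crystalE i.rev c (sigma x) = sigma (crystalE i c x) := by
  by_cases h0 : i = 0
  · subst h0
    rw [crystalE_zero, sigma_sigma_of_pos (isPositive_crystalE _ hc (isPositive_sigma hx))]
    rfl
  by_cases h4 : i = 4
  · subst h4
    change crystalE 0 c (sigma x) = _
    rw [crystalE_zero, sigma_sigma_of_pos hx]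
  · have hr : i.rev ≠ 0 ∧ i.rev ≠ 4 := by
      obtain rfl | rfl | rfl := eq_of_middle h0 h4 <;> decide
    refine eq_of_chart_eq (ne_zero_of_pos (isPositive_sigma (isPositive_crystalE i hc hx))) ?_
    rw [chart_crystalE hr.1 hr.2 hc (isPositive_sigma hx),
      chart_sigma_of_pos (isPositive_crystalE i hc hx), chart_crystalE h0 h4 hc hx,
      LDL.dual_rowAdd h0 h4, crystalEps_sigma hx, chart_sigma_of_pos hx]

theorem sym_mul_of_pos (hx : ∀ k, IsPositive (x k)) :
    (chart (sigma x)).sym * signedRev * (chart x).sym = signedRev :=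
  sym_mul_sigma (ne_zero_of_pos hx) (sigma_ne_zero_of_pos hx)

theorem sym_mul_of_pos' (hx : ∀ k, IsPositive (x k)) :
    (chart x).sym * signedRev * (chart (sigma x)).sym = signedRev := by
  have := sym_mul_of_pos (isPositive_sigma hx)
  rwa [sigma_sigma_of_pos hx] at this

/-- The operator `e_4^c` subtracts a multiple of the rank one matrix formed from the last column
of `S`. -/
theorem sym_crystalE_four (hc : IsPositive c) (hx : ∀ k, IsPositive (x k)) (j k : Fin 4) :
    (chart (crystalE 4 c x)).sym j k = (chart x).sym j k -
      (1 - 1 / c) * ((chart x).sym j 3 * (chart x).sym 3 k) / (chart x).sym 3 3 := by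
  have h := unipRel_crystalE (i := 4) (by decide) hc hx
  rw [UnipRel, if_pos rfl, crystalEps_four (ne_zero_of_pos hx)] at h
  have h33 : (chart x).sym 3 3 ≠ 0 := by
    rw [← crystalEps_four (ne_zero_of_pos hx)]
    exact (isPositive_crystalEps 4 hx).ne_zero
  have hc := hc.ne_zero
  have e (j k : Fin 4) := congrFun (congrFun h j) k
  generalize (chart x).sym = S at *
  generalize (chart (crystalE 4 c x)).sym = S' at *
  have e' (j k : Fin 4) : S' j k + S' j 3 * ((c - 1) / S 3 3) * S 3 k = S j k := by
    have := e j k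
    simpa [Matrix.mul_apply, Matrix.single_apply, Fin.sum_univ_four] using this
  have e3 : S' j 3 = S j 3 / c := by
    have := e' j 3
    field_simp at this ⊢
    linear_combination this
  have := e' j k
  rw [e3] at this
  field_simp at this ⊢
  linear_combination this

/-- The operator `e_0^c` adds a multiple of the matrix unit `E_00`: on the dual matrix it is
`e_4`, and inversion turns the quotient `S (1 + a E_33 S)⁻¹` into a sum. -/
theorem sym_crystalE_zero (hc : IsPositive c) (hx : ∀ k, IsPositive (x k)) :
    (chart (crystalE 0 c x)).sym =
      (chart x).sym + Matrix.single 0 0 ((c - 1) / crystalEps 0 x) := by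
  have h := unipRel_crystalE (i := 4) (by decide) hc (isPositive_sigma hx)
  rw [UnipRel, if_pos rfl, ← crystalEps_zero] at h
  have h1 := sym_mul_of_pos' hx
  have h1' := sym_mul_of_pos hx
  have h2 := sym_mul_of_pos (isPositive_crystalE 4 hc (isPositive_sigma hx))
  rw [← crystalE_zero] at h2
  generalize (chart (crystalE 0 c x)).sym = S' at *
  generalize (chart (crystalE 4 c (sigma x))).sym = U' at *
  generalize (chart x).sym = S at *
  generalize (chart (sigma x)).sym = U at *
  generalize (c - 1) / crystalEps 0 x = a at *
  have hW : signedRev * Matrix.single 3 3 a * signedRev =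
      -(Matrix.single 0 0 a : Matrix (Fin 4) (Fin 4) (RatFun τ)) := by
    rw [← Matrix.ext_iff]
    simp [Fin.forall_fin_succ, signedRev, Matrix.vecMul, dotProduct, Fin.sum_univ_succ,
      Matrix.single_apply]
  -- multiply `U' + a U' E_33 U = U` by `S' W` and `W S`, where `S' W U' = W` and `U W S = W`
  have e := congrArg (fun M => S' * signedRev * M * (signedRev * S)) h
  simp only [Matrix.mul_add, Matrix.add_mul] at e
  rw [h2] at e
  have e1 : S' * signedRev * (U' * Matrix.single 3 3 a * U) * (signedRev * S) =
      (S' * signedRev * U') * Matrix.single 3 3 a * (U * signedRev * S) := by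
    simp only [Matrix.mul_assoc]
  have e2 : S' * signedRev * U * (signedRev * S) = S' * signedRev * (U * signedRev * S) := by
    simp only [Matrix.mul_assoc]
  rw [e1, e2, h2, h1', hW, ← Matrix.mul_assoc, Matrix.mul_assoc S', signedRev_mul_self] at e
  simp only [Matrix.neg_mul, Matrix.mul_neg, Matrix.one_mul, Matrix.mul_one] at e
  rw [← neg_inj, ← e, neg_add]

end PositivePoints

/-! ### Weights, actions and commuting operators -/

section Axioms

variable {τ : Type} {x : Fin 10 → RatFun τ} {c c₁ c₂ : RatFun τ}

theorem crystalE_rev (hc : IsPositive c) (hx : ∀ k, IsPositive (x k)) (i : Fin 5) :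
    crystalE i.rev c x = sigma (crystalE i c (sigma x)) := by
  rw [← crystalE_sigma hc (isPositive_sigma hx), sigma_sigma_of_pos hx]

theorem crystalEps_rev (hx : ∀ k, IsPositive (x k)) (i : Fin 5) :
    crystalEps i.rev x = crystalEps i (sigma x) := by
  rw [← crystalEps_sigma (isPositive_sigma hx), sigma_sigma_of_pos hx]

theorem crystalEps_crystalE_self (hc : IsPositive c) (hx : ∀ k, IsPositive (x k)) (i : Fin 5) :
    crystalEps i (crystalE i c x) = crystalEps i x / c := by
  have h4 : ∀ {x : Fin 10 → RatFun τ}, (∀ k, IsPositive (x k)) →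
      crystalEps 4 (crystalE 4 c x) = crystalEps 4 x / c := by
    intro x hx
    have h := (isPositive_crystalEps 4 hx).ne_zero
    have hc0 := hc.ne_zero
    rw [crystalEps_four (ne_zero_of_pos hx)] at h ⊢
    rw [crystalEps_four (ne_zero_of_pos (isPositive_crystalE 4 hc hx)), sym_crystalE_four hc hx]
    field_simp
    ring
  have h3 : ∀ {x : Fin 10 → RatFun τ}, (∀ k, IsPositive (x k)) →
      crystalEps 3 (crystalE 3 c x) = crystalEps 3 x / c := by
    intro x hx
    have h := (isPositive_crystalEps 3 hx).ne_zero
    have hc0 := hc.ne_zero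
    have e := crystalEps_three (ne_zero_of_pos hx)
    rw [crystalEps_three (ne_zero_of_pos (isPositive_crystalE 3 hc hx)),
      chart_crystalE (by decide) (by decide) hc hx]
    rw [e] at h ⊢
    obtain ⟨h1, h2⟩ := div_ne_zero_iff.1 h
    have hd : (chart x).l30 + (c - 1) / ((chart x).l20 / (chart x).l30) * (chart x).l20 =
        c * (chart x).l30 := by
      field_simp
      ring
    simp only [LDL.rowAdd, Matrix.cons_val]
    rw [hd]
    field_simp
  have h2 : ∀ {x : Fin 10 → RatFun τ}, (∀ k, IsPositive (x k)) →
      crystalEps 2 (crystalE 2 c x) = crystalEps 2 x / c := by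
    intro x hx
    have h := (isPositive_crystalEps 2 hx).ne_zero
    have hc0 := hc.ne_zero
    have e := crystalEps_two (ne_zero_of_pos hx)
    rw [crystalEps_two (ne_zero_of_pos (isPositive_crystalE 2 hc hx)),
      chart_crystalE (by decide) (by decide) hc hx]
    rw [e] at h ⊢
    obtain ⟨h1, h2⟩ := div_ne_zero_iff.1 h
    simp only [LDL.rowAdd, Matrix.cons_val]
    generalize (chart x).l10 = l10, (chart x).l20 = l20, (chart x).l30 = l30,
      (chart x).l21 = l21, (chart x).l31 = l31 at h1 h2 ⊢
    have hd : (l20 + (c - 1) / ((l10 * l31 - l30) / (l20 * l31 - l30 * l21)) * l10) * l31 -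
        l30 * (l21 + (c - 1) / ((l10 * l31 - l30) / (l20 * l31 - l30 * l21))) =
        c * (l20 * l31 - l30 * l21) := by
      field_simp
      ring
    rw [hd]
    field_simp
  -- transport along the diagram automorphism
  have hr : ∀ i : Fin 5, (∀ {x : Fin 10 → RatFun τ}, (∀ k, IsPositive (x k)) →
      crystalEps i (crystalE i c x) = crystalEps i x / c) →
      crystalEps i.rev (crystalE i.rev c x) = crystalEps i.rev x / c := by
    intro i h
    have hs := isPositive_sigma hx
    rw [crystalE_rev hc hx, crystalEps_sigma (isPositive_crystalE i hc hs), h hs,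
      crystalEps_rev hx]
  fin_cases i
  · exact hr 4 h4
  · exact hr 3 h3
  · exact h2 hx
  · exact h3 hx
  · exact h4 hx

/-- The function `ε_3` as a ratio of entries of `S`. -/
theorem crystalEps_three_eq_sym (hx : ∀ k, IsPositive (x k)) :
    crystalEps 3 x = (chart x).sym 0 2 / (chart x).sym 0 3 := by
  rw [crystalEps_three (ne_zero_of_pos hx)]
  have h : (chart x).d0 ≠ 0 := by simp [chart, ne_zero_of_pos hx]
  simp [LDL.sym, mul_div_mul_left _ _ h]

/-- The function `ε_2` as a ratio of minors of `S` that do not involve the entry `S_00`. -/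
theorem crystalEps_two_eq_sym (hx : ∀ k, IsPositive (x k)) :
    crystalEps 2 x =
      ((chart x).sym 1 0 * (chart x).sym 3 1 - (chart x).sym 3 0 * (chart x).sym 1 1) /
      ((chart x).sym 2 0 * (chart x).sym 3 1 - (chart x).sym 3 0 * (chart x).sym 2 1) := by
  rw [crystalEps_two (ne_zero_of_pos hx)]
  have h0 : (chart x).d0 ≠ 0 := by simp [chart, ne_zero_of_pos hx]
  have h1 : (chart x).d1 ≠ 0 := by simp [chart, ne_zero_of_pos hx]
  rw [← mul_div_mul_left _ _ (mul_ne_zero h0 h1)]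
  congr 1 <;> simp [LDL.sym] <;> ring

/-- The ordered pairs of distinct vertices that are not joined in the diagram. The second six
arise from the first six by `i ↦ 4 - i`. -/
theorem eq_of_cartanC4_eq_zero {i j : Fin 5} (h : cartanC4 i j = 0) :
    (i = 4 ∧ j = 0) ∨ (i = 4 ∧ j = 1) ∨ (i = 4 ∧ j = 2) ∨ (i = 3 ∧ j = 0) ∨ (i = 3 ∧ j = 1) ∨
      (i = 2 ∧ j = 0) ∨ (i = 0 ∧ j = 4) ∨ (i = 0 ∧ j = 3) ∨ (i = 0 ∧ j = 2) ∨ (i = 1 ∧ j = 4) ∨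
      (i = 1 ∧ j = 3) ∨ (i = 2 ∧ j = 4) := by
  fin_cases i <;> fin_cases j <;> simp [cartanC4] at h ⊢

theorem crystalEps_crystalE_of_commute (hc : IsPositive c) (hx : ∀ k, IsPositive (x k))
    {i j : Fin 5} (hij : cartanC4 i j = 0) : crystalEps i (crystalE j c x) = crystalEps i x := by
  -- transport along the diagram automorphism
  have hr : ∀ i j : Fin 5, (∀ {x : Fin 10 → RatFun τ}, (∀ k, IsPositive (x k)) →
      crystalEps i (crystalE j c x) = crystalEps i x) →
      crystalEps i.rev (crystalE j.rev c x) = crystalEps i.rev x := by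
    intro i j h
    have hs := isPositive_sigma hx
    rw [crystalE_rev hc hx, crystalEps_sigma (isPositive_crystalE j hc hs), h hs,
      crystalEps_rev hx]
  have h40 : ∀ {x : Fin 10 → RatFun τ}, (∀ k, IsPositive (x k)) →
      crystalEps 4 (crystalE 0 c x) = crystalEps 4 x := by
    intro x hx
    rw [crystalEps_four (ne_zero_of_pos (isPositive_crystalE 0 hc hx)),
      crystalEps_four (ne_zero_of_pos hx), sym_crystalE_zero hc hx]
    simp
  have h30 : ∀ {x : Fin 10 → RatFun τ}, (∀ k, IsPositive (x k)) →
      crystalEps 3 (crystalE 0 c x) = crystalEps 3 x := by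
    intro x hx
    rw [crystalEps_three_eq_sym (isPositive_crystalE 0 hc hx),
      crystalEps_three_eq_sym hx, sym_crystalE_zero hc hx]
    simp
  have h20 : ∀ {x : Fin 10 → RatFun τ}, (∀ k, IsPositive (x k)) →
      crystalEps 2 (crystalE 0 c x) = crystalEps 2 x := by
    intro x hx
    rw [crystalEps_two_eq_sym (isPositive_crystalE 0 hc hx),
      crystalEps_two_eq_sym hx, sym_crystalE_zero hc hx]
    simp
  have h41 : ∀ {x : Fin 10 → RatFun τ}, (∀ k, IsPositive (x k)) →
      crystalEps 4 (crystalE 1 c x) = crystalEps 4 x := by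
    intro x hx
    rw [crystalEps_four (ne_zero_of_pos (isPositive_crystalE 1 hc hx)),
      crystalEps_four (ne_zero_of_pos hx), chart_crystalE (by decide) (by decide) hc hx]
    simp [LDL.rowAdd, LDL.sym]
  have h42 : ∀ {x : Fin 10 → RatFun τ}, (∀ k, IsPositive (x k)) →
      crystalEps 4 (crystalE 2 c x) = crystalEps 4 x := by
    intro x hx
    rw [crystalEps_four (ne_zero_of_pos (isPositive_crystalE 2 hc hx)),
      crystalEps_four (ne_zero_of_pos hx), chart_crystalE (by decide) (by decide) hc hx]
    simp [LDL.rowAdd, LDL.sym]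
  have h31 : ∀ {x : Fin 10 → RatFun τ}, (∀ k, IsPositive (x k)) →
      crystalEps 3 (crystalE 1 c x) = crystalEps 3 x := by
    intro x hx
    rw [crystalEps_three (ne_zero_of_pos (isPositive_crystalE 1 hc hx)),
      crystalEps_three (ne_zero_of_pos hx), chart_crystalE (by decide) (by decide) hc hx]
    simp [LDL.rowAdd]
  obtain ⟨rfl, rfl⟩ | ⟨rfl, rfl⟩ | ⟨rfl, rfl⟩ | ⟨rfl, rfl⟩ | ⟨rfl, rfl⟩ | ⟨rfl, rfl⟩ |
    ⟨rfl, rfl⟩ | ⟨rfl, rfl⟩ | ⟨rfl, rfl⟩ | ⟨rfl, rfl⟩ | ⟨rfl, rfl⟩ | ⟨rfl, rfl⟩ :=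
    eq_of_cartanC4_eq_zero hij
  · exact h40 hx
  · exact h41 hx
  · exact h42 hx
  · exact h30 hx
  · exact h31 hx
  · exact h20 hx
  · exact hr 4 0 h40
  · exact hr 4 1 h41
  · exact hr 4 2 h42
  · exact hr 3 0 h30
  · exact hr 3 1 h31
  · exact hr 2 0 h20

theorem crystalE_one (hx : ∀ k, IsPositive (x k)) (i : Fin 5) : crystalE i 1 x = x := by
  have h1 : IsPositive (1 : RatFun τ) := isPositive_one
  have h0 : ∀ {x : Fin 10 → RatFun τ}, (∀ k, IsPositive (x k)) → crystalE 0 1 x = x := by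
    intro x hx
    refine eq_of_sym_eq (isPositive_crystalE 0 h1 hx) hx ?_
    rw [sym_crystalE_zero h1 hx]
    simp
  by_cases hi : i = 0
  · subst hi
    exact h0 hx
  by_cases h4 : i = 4
  · subst h4
    change crystalE (Fin.rev 0) 1 x = x
    rw [crystalE_rev h1 hx, h0 (isPositive_sigma hx), sigma_sigma_of_pos hx]
  · refine eq_of_chart_eq (ne_zero_of_pos hx) ?_
    rw [chart_crystalE hi h4 h1 hx, sub_self, zero_div, LDL.rowAdd_zero]

theorem crystalE_mul (h₁ : IsPositive c₁) (h₂ : IsPositive c₂) (hx : ∀ k, IsPositive (x k))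
    (i : Fin 5) : crystalE i c₁ (crystalE i c₂ x) = crystalE i (c₁ * c₂) x := by
  have h₁₂ := h₁.mul h₂
  -- the parameters of the two successive operations add up to the parameter of `e_i^{c₁ c₂}`
  have ha : ∀ {x : Fin 10 → RatFun τ}, (∀ k, IsPositive (x k)) → ∀ i,
      (c₁ - 1) / crystalEps i (crystalE i c₂ x) + (c₂ - 1) / crystalEps i x =
        (c₁ * c₂ - 1) / crystalEps i x := by
    intro x hx i
    have h := (isPositive_crystalEps i hx).ne_zero
    have := h₂.ne_zero
    rw [crystalEps_crystalE_self h₂ hx]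
    field_simp
    ring
  have h0 : ∀ {x : Fin 10 → RatFun τ}, (∀ k, IsPositive (x k)) →
      crystalE 0 c₁ (crystalE 0 c₂ x) = crystalE 0 (c₁ * c₂) x := by
    intro x hx
    have hx' := isPositive_crystalE 0 h₂ hx
    refine eq_of_sym_eq (isPositive_crystalE 0 h₁ hx') (isPositive_crystalE 0 h₁₂ hx) ?_
    rw [sym_crystalE_zero h₁ hx', sym_crystalE_zero h₂ hx, sym_crystalE_zero h₁₂ hx, add_assoc,
      ← Matrix.single_add, ← ha hx, add_comm ((c₁ - 1) / _)]
  have hx' := isPositive_crystalE i h₂ hx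
  by_cases hi : i = 0
  · subst hi
    exact h0 hx
  by_cases h4 : i = 4
  · subst h4
    have hs := isPositive_sigma hx
    change crystalE (Fin.rev 0) _ (crystalE (Fin.rev 0) _ _) = crystalE (Fin.rev 0) _ _
    rw [crystalE_rev h₂ hx, crystalE_sigma h₁ (isPositive_crystalE 0 h₂ hs),
      crystalE_rev h₁₂ hx, h0 hs]
  · refine eq_of_chart_eq (ne_zero_of_pos (isPositive_crystalE i h₁₂ hx)) ?_
    rw [chart_crystalE hi h4 h₁ hx', chart_crystalE hi h4 h₂ hx, chart_crystalE hi h4 h₁₂ hx,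
      LDL.rowAdd_rowAdd, ha hx]

theorem crystalGamma_eq (hx : ∀ k, IsPositive (x k)) (i : Fin 5) :
    crystalGamma i x = schubertGamma cartanC4 word1 i x := by
  unfold crystalGamma
  split_ifs with h
  · subst h
    exact schubertGamma_word2_sigma (ne_zero_of_pos hx) (sigma_ne_zero_of_pos hx) 0
  · rfl

theorem crystalGamma_sigma (hx : ∀ k, IsPositive (x k)) (i : Fin 5) :
    crystalGamma i (sigma x) = crystalGamma i.rev x := by
  rw [crystalGamma_eq (isPositive_sigma hx), crystalGamma_eq hx,
    ← schubertGamma_word2_sigma (ne_zero_of_pos hx) (sigma_ne_zero_of_pos hx)]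
  simp only [schubertGamma, cartanC4_word2, Fin.rev_rev]

theorem crystalGamma_crystalE (hc : IsPositive c) (hx : ∀ k, IsPositive (x k)) (i j : Fin 5) :
    crystalGamma j (crystalE i c x) = c ^ cartanC4 i j * crystalGamma j x := by
  have h : ∀ {x : Fin 10 → RatFun τ}, (∀ k, IsPositive (x k)) → ∀ i j : Fin 5, i ≠ 0 →
      crystalGamma j (crystalE i c x) = c ^ cartanC4 i j * crystalGamma j x := by
    intro x hx i j hi
    rw [crystalGamma_eq (isPositive_crystalE i hc hx), crystalGamma_eq hx, crystalE, if_neg hi]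
    exact schubertGamma_schubertE cartanC4 word1 i c x j
      fun k _ => schubertDen_ne_zero hi hc hx k
  by_cases hi : i = 0
  · subst hi
    have hA : ∀ j : Fin 5, cartanC4 4 j.rev = cartanC4 0 j := by decide
    have hs := isPositive_sigma hx
    rw [crystalE_zero, crystalGamma_sigma (isPositive_crystalE 4 hc hs),
      h hs 4 j.rev (by decide), crystalGamma_sigma hx, Fin.rev_rev, hA]
  · exact h hx i j hi

theorem crystalE_comm (h₁ : IsPositive c₁) (h₂ : IsPositive c₂) (hx : ∀ k, IsPositive (x k))
    {i j : Fin 5} (hij : cartanC4 i j = 0) :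
    crystalE i c₁ (crystalE j c₂ x) = crystalE j c₂ (crystalE i c₁ x) := by
  -- transport along the diagram automorphism
  have hr : ∀ i j : Fin 5, (∀ {x : Fin 10 → RatFun τ}, (∀ k, IsPositive (x k)) →
      crystalE i c₁ (crystalE j c₂ x) = crystalE j c₂ (crystalE i c₁ x)) →
      crystalE i.rev c₁ (crystalE j.rev c₂ x) = crystalE j.rev c₂ (crystalE i.rev c₁ x) := by
    intro i j h
    have hs := isPositive_sigma hx
    rw [crystalE_rev h₂ hx, crystalE_sigma h₁ (isPositive_crystalE j h₂ hs), h hs,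
      crystalE_rev h₁ hx, crystalE_sigma h₂ (isPositive_crystalE i h₁ hs)]
  have h0 : ∀ {c₁ c₂ : RatFun τ}, IsPositive c₁ → IsPositive c₂ → ∀ j : Fin 5, j = 2 ∨ j = 3 →
      ∀ {x : Fin 10 → RatFun τ}, (∀ k, IsPositive (x k)) →
      crystalE 0 c₁ (crystalE j c₂ x) = crystalE j c₂ (crystalE 0 c₁ x) := by
    intro c₁ c₂ h₁ h₂ j hj x hx
    have hx' := isPositive_crystalE j h₂ hx
    have hx'' := isPositive_crystalE 0 h₁ hx
    have hj0 : j ≠ 0 := by obtain rfl | rfl := hj <;> decide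
    have hj4 : j ≠ 4 := by obtain rfl | rfl := hj <;> decide
    have hA : cartanC4 0 j = 0 ∧ cartanC4 j 0 = 0 := by obtain rfl | rfl := hj <;> decide
    refine eq_of_sym_eq (isPositive_crystalE 0 h₁ hx') (isPositive_crystalE j h₂ hx'') ?_
    rw [sym_crystalE_zero h₁ hx', chart_crystalE hj0 hj4 h₂ hx, chart_crystalE hj0 hj4 h₂ hx'',
      LDL.rowAdd_sym hj0 hj4, LDL.rowAdd_sym hj0 hj4, sym_crystalE_zero h₁ hx,
      crystalEps_crystalE_of_commute h₂ hx hA.1, crystalEps_crystalE_of_commute h₁ hx hA.2,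
      Matrix.mul_add, Matrix.add_mul, add_right_inj]
    rw [← Matrix.ext_iff]
    obtain rfl | rfl := hj <;>
      simp [Fin.forall_fin_succ, rowOp, Matrix.vecMul, dotProduct, Fin.sum_univ_succ,
        Matrix.single_apply]
  have h04 : ∀ {c₁ c₂ : RatFun τ}, IsPositive c₁ → IsPositive c₂ →
      ∀ {x : Fin 10 → RatFun τ}, (∀ k, IsPositive (x k)) →
      crystalE 0 c₁ (crystalE 4 c₂ x) = crystalE 4 c₂ (crystalE 0 c₁ x) := by
    intro c₁ c₂ h₁ h₂ x hx
    have hx' := isPositive_crystalE 4 h₂ hx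
    have hx'' := isPositive_crystalE 0 h₁ hx
    refine eq_of_sym_eq (isPositive_crystalE 0 h₁ hx') (isPositive_crystalE 4 h₂ hx'') ?_
    ext j k
    rw [sym_crystalE_four h₂ hx'', sym_crystalE_zero h₁ hx', sym_crystalE_zero h₁ hx,
      crystalEps_crystalE_of_commute h₂ hx (by decide), Matrix.add_apply, sym_crystalE_four h₂ hx]
    simp [Matrix.single_apply]
    ring
  have h13 : ∀ {c₁ c₂ : RatFun τ}, IsPositive c₁ → IsPositive c₂ →
      ∀ {x : Fin 10 → RatFun τ}, (∀ k, IsPositive (x k)) →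
      crystalE 1 c₁ (crystalE 3 c₂ x) = crystalE 3 c₂ (crystalE 1 c₁ x) := by
    intro c₁ c₂ h₁ h₂ x hx
    have hx' := isPositive_crystalE 3 h₂ hx
    have hx'' := isPositive_crystalE 1 h₁ hx
    refine eq_of_chart_eq (ne_zero_of_pos (isPositive_crystalE 3 h₂ hx'')) ?_
    rw [chart_crystalE (by decide) (by decide) h₁ hx', chart_crystalE (by decide) (by decide) h₂ hx,
      chart_crystalE (by decide) (by decide) h₂ hx'', chart_crystalE (by decide) (by decide) h₁ hx,
      crystalEps_crystalE_of_commute h₂ hx (by decide),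
      crystalEps_crystalE_of_commute h₁ hx (by decide)]
    simp [LDL.rowAdd]
  obtain ⟨rfl, rfl⟩ | ⟨rfl, rfl⟩ | ⟨rfl, rfl⟩ | ⟨rfl, rfl⟩ | ⟨rfl, rfl⟩ | ⟨rfl, rfl⟩ |
    ⟨rfl, rfl⟩ | ⟨rfl, rfl⟩ | ⟨rfl, rfl⟩ | ⟨rfl, rfl⟩ | ⟨rfl, rfl⟩ | ⟨rfl, rfl⟩ :=
    eq_of_cartanC4_eq_zero hij
  · exact (h04 h₂ h₁ hx).symm
  · exact hr 0 3 (h0 h₁ h₂ 3 (by decide))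
  · exact hr 0 2 (h0 h₁ h₂ 2 (by decide))
  · exact (h0 h₂ h₁ 3 (by decide) hx).symm
  · exact (h13 h₂ h₁ hx).symm
  · exact (h0 h₂ h₁ 2 (by decide) hx).symm
  · exact h04 h₁ h₂ hx
  · exact h0 h₁ h₂ 3 (by decide) hx
  · exact h0 h₁ h₂ 2 (by decide) hx
  · exact hr 3 0 fun hx => (h0 h₂ h₁ 3 (by decide) hx).symm
  · exact h13 h₁ h₂ hx
  · exact hr 2 0 fun hx => (h0 h₂ h₁ 2 (by decide) hx).symm

end Axioms

/-! ### Parameter identities behind the braid relations -/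

section Scalars

variable {F : Type} [Field F]

/-- The relation `x_2(a₁) x_3(a₂) x_2(a₃) = x_3(b₁) x_2(b₂) x_3(b₃)` in the unitriangular
group. -/
theorem LDL.rowAdd_braid {a₁ a₂ a₃ b₁ b₂ b₃ : F} (h1 : a₁ + a₃ = b₂) (h2 : a₂ = b₁ + b₃)
    (h3 : a₂ * a₃ = b₁ * b₂) (m : LDL F) :
    ((m.rowAdd 2 a₃).rowAdd 3 a₂).rowAdd 2 a₁ = ((m.rowAdd 3 b₃).rowAdd 2 b₂).rowAdd 3 b₁ := by
  subst h1 h2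
  ext <;> simp [rowAdd] <;> first | ring1 | skip
  · linear_combination m.l10 * h3
  · linear_combination h3

/-- The parameters in the two sides of the braid relation of length three satisfy the hypotheses
of `LDL.rowAdd_braid`. Here `v / u` and `t / s` are the values of `ε_2` and `ε_3` at the starting
point; `n` and `w` describe how `t` and `v` change under the other operation. -/
theorem braid_one_scalars {c₁ c₂ n t s u v w a₁ a₂ a₃ b₁ b₂ b₃ : F} (hrel : n * u = t * v - s * w)
    (hc₁ : c₁ ≠ 0) (hc₂ : c₂ ≠ 0) (hs : s ≠ 0) (ht : t ≠ 0) (hu : u ≠ 0) (hv : v ≠ 0)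
    (ht' : t + a₃ * n ≠ 0) (hv' : v + b₃ * w ≠ 0)
    (ha₃ : a₃ = (c₂ - 1) / (v / u)) (ha₂ : a₂ = (c₁ * c₂ - 1) / ((t + a₃ * n) / s))
    (ha₁ : a₁ = (c₁ - 1) / ((v + a₂ * w) / (c₂ * u)))
    (hb₃ : b₃ = (c₁ - 1) / (t / s)) (hb₂ : b₂ = (c₁ * c₂ - 1) / ((v + b₃ * w) / u))
    (hb₁ : b₁ = (c₂ - 1) / ((t + b₂ * n) / (c₁ * s))) :
    a₁ + a₃ = b₂ ∧ a₂ = b₁ + b₃ ∧ a₂ * a₃ = b₁ * b₂ := by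
  -- the values of `ε_2` and `ε_3` along both sides factor through the two polynomials `T` and `K`
  obtain ⟨T, hT⟩ : ∃ T, T = t * v + (c₂ - 1) * u * n := ⟨_, rfl⟩
  obtain ⟨K, hK⟩ : ∃ K, K = c₁ * t * v - (c₁ - 1) * n * u := ⟨_, rfl⟩
  have et : t + a₃ * n = T / v := by
    rw [ha₃, hT]
    field_simp
  have ev : v + b₃ * w = K / t := by
    rw [hb₃, hK]
    field_simp
    linear_combination (c₁ - 1) * hrel
  rw [et] at ha₂ ht'
  rw [ev] at hb₂ hv'
  obtain ⟨hT0, -⟩ := div_ne_zero_iff.1 ht'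
  obtain ⟨hK0, -⟩ := div_ne_zero_iff.1 hv'
  have ev' : v + a₂ * w = c₂ * v * K / T := by
    rw [ha₂]
    field_simp
    rw [hT, hK]
    linear_combination (c₁ * c₂ - 1) * hrel
  have et' : t + b₂ * n = t * c₁ * T / K := by
    rw [hb₂]
    field_simp
    rw [hT, hK]
    ring
  rw [ev'] at ha₁
  rw [et'] at hb₁
  subst ha₁ ha₂ ha₃ hb₁ hb₂ hb₃
  refine ⟨?_, ?_, ?_⟩ <;> field_simp <;> rw [hT, hK] <;> ring

/-- The parameters in the two sides of the braid relation of length four satisfy the hypotheses of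
`rowOp_braid`. At the starting point `E = ε_3`, `m = ε_4 = S_33`, `κ = S_23 / S_33`, and `δ` is
the Schur complement of `S_33` in the lower right `2 × 2` block. An operator `e_4^c` replaces `E`
by `c E - (c - 1) κ` and `m` by `m / c`, and fixes `κ` and `δ`. An operator `e_3^c` replaces `E`
by `E / c` and changes `m`, `κ`, `δ` as a row-and-column operation with parameter `(c - 1) / E`
does. The letters `E₁, m₂, E₃` stand for the values needed along the left side, and `m', E₂', m₃'`
for those needed along the right side. -/
theorem braid_two_scalars {c₁ c₂ E m κ δ E₁ E₃ E₂' m₂ m' m₃' a₁ a₂ a₃ a₄ b₁ b₂ b₃ b₄ : F}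
    (hc₁ : c₁ ≠ 0) (hc₂ : c₂ ≠ 0) (hE : E ≠ 0) (hm : m ≠ 0) (hE₁ : E₁ ≠ 0) (hm₂ : m₂ ≠ 0)
    (hm' : m' ≠ 0) (hE₃ : E₃ ≠ 0)
    (ha₄ : a₄ = (c₂ - 1) / m) (e₁ : E₁ = c₂ * E - (c₂ - 1) * κ) (ha₃ : a₃ = (c₁ * c₂ - 1) / E₁)
    (e₂ : m₂ = m / c₂ * (1 + a₃ * κ) ^ 2 + a₃ ^ 2 * δ) (ha₂ : a₂ = (c₁ ^ 2 * c₂ - 1) / m₂)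
    (e₃ : E₃ = c₁ ^ 2 * c₂ * (E₁ / (c₁ * c₂)) -
      (c₁ ^ 2 * c₂ - 1) * ((m / c₂ * κ * (1 + a₃ * κ) + a₃ * δ) / m₂))
    (ha₁ : a₁ = (c₁ - 1) / E₃)
    (hb₄ : b₄ = (c₁ - 1) / E) (e₁' : m' = m * (1 + b₄ * κ) ^ 2 + b₄ ^ 2 * δ)
    (hb₃ : b₃ = (c₁ ^ 2 * c₂ - 1) / m')
    (e₂' : E₂' = c₁ ^ 2 * c₂ * (E / c₁) -
      (c₁ ^ 2 * c₂ - 1) * ((m * κ * (1 + b₄ * κ) + b₄ * δ) / m'))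
    (hb₂ : b₂ = (c₁ * c₂ - 1) / E₂')
    (e₃' : m₃' = m' / (c₁ ^ 2 * c₂) * (1 + b₂ * ((m * κ * (1 + b₄ * κ) + b₄ * δ) / m')) ^ 2 +
      b₂ ^ 2 * (δ * m / m'))
    (hb₁ : b₁ = (c₂ - 1) / m₃') :
    a₁ + a₃ = b₂ + b₄ ∧ a₂ + a₄ = b₁ + b₃ ∧ a₄ * (a₁ + a₃) + a₂ * a₁ = b₃ * b₂ ∧
      a₄ * (a₁ + a₃) ^ 2 + a₂ * a₁ ^ 2 = b₃ * b₂ ^ 2 := by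
  -- all values along both sides factor through the polynomials `Q`, `B`, `B'` and `N`
  obtain ⟨Q, hQ⟩ : ∃ Q, Q = E + (c₁ - 1) * κ := ⟨_, rfl⟩
  obtain ⟨B, hB⟩ : ∃ B, B = m * c₂ * Q ^ 2 + (c₁ * c₂ - 1) ^ 2 * δ := ⟨_, rfl⟩
  obtain ⟨B', hB'⟩ : ∃ B', B' = m * Q ^ 2 + (c₁ - 1) ^ 2 * δ := ⟨_, rfl⟩
  obtain ⟨N, hN⟩ : ∃ N, N = m * Q * (c₁ * c₂ * E - (c₁ * c₂ - 1) * κ) -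
    (c₁ - 1) * (c₁ * c₂ - 1) * δ := ⟨_, rfl⟩
  have q₁ : 1 + a₃ * κ = c₂ * Q / E₁ := by
    rw [ha₃]
    field_simp
    rw [e₁, hQ]
    ring
  have q₁' : 1 + b₄ * κ = Q / E := by
    rw [hb₄]
    field_simp
    rw [hQ]
  rw [q₁] at e₂ e₃
  rw [q₁'] at e₁' e₂' e₃'
  have f₂ : m₂ = B / E₁ ^ 2 := by
    rw [e₂, ha₃, hB]
    field_simp
  have f₁' : m' = B' / E ^ 2 := by
    rw [e₁', hb₄, hB']
    field_simp
  have hB0 : B ≠ 0 := by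
    rintro rfl
    simp [f₂] at hm₂
  have hB'0 : B' ≠ 0 := by
    rintro rfl
    simp [f₁'] at hm'
  have f₃ : E₃ = E₁ * N / B := by
    rw [e₃, f₂, ha₃]
    field_simp
    rw [hN, hB, hQ]
    ring
  have hN0 : N ≠ 0 := by
    rintro rfl
    simp [f₃] at hE₃
  have f₂' : E₂' = E * N / B' := by
    rw [e₂', f₁', hb₄]
    field_simp
    rw [hN, hB', hQ]
    ring
  have q₂' : 1 + b₂ * ((m * κ * (Q / E) + b₄ * δ) / m') = c₁ * c₂ * m * Q * E / N := by
    rw [hb₂, f₂', f₁', hb₄]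
    field_simp
    rw [hN]
    ring
  have f₃' : m₃' = B' * m * B / N ^ 2 := by
    rw [e₃', q₂', f₁', hb₂, f₂']
    field_simp
    rw [hB]
    ring
  rw [f₂] at ha₂
  rw [f₃] at ha₁
  rw [f₁'] at hb₃
  rw [f₂'] at hb₂
  rw [f₃'] at hb₁
  clear e₂ e₃ e₁' e₂' e₃' q₁ q₁' q₂' f₂ f₁' f₃ f₂' f₃'
  subst ha₁ ha₂ ha₃ ha₄ hb₁ hb₂ hb₃ hb₄
  refine ⟨?_, ?_, ?_, ?_⟩ <;> field_simp <;> simp only [hN, hB, hB', hQ, e₁] <;> ring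

end Scalars

/-! ### The braid relation of length three -/

section Braid

variable {τ : Type} {x : Fin 10 → RatFun τ} {c c₁ c₂ : RatFun τ}

theorem crystalE_braid_two_three (h₁ : IsPositive c₁) (h₂ : IsPositive c₂)
    (hx : ∀ k, IsPositive (x k)) :
    crystalE 2 c₁ (crystalE 3 (c₁ * c₂) (crystalE 2 c₂ x)) =
      crystalE 3 c₂ (crystalE 2 (c₁ * c₂) (crystalE 3 c₁ x)) := by
  have h₁₂ := h₁.mul h₂
  have p₁ := isPositive_crystalE 2 h₂ hx
  have p₂ := isPositive_crystalE 3 h₁₂ p₁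
  have q₁ := isPositive_crystalE 3 h₁ hx
  have q₂ := isPositive_crystalE 2 h₁₂ q₁
  have q₃ := isPositive_crystalE 3 h₂ q₂
  have E (i : Fin 5) {y : Fin 10 → RatFun τ} (hy : ∀ k, IsPositive (y k)) :=
    (isPositive_crystalEps i hy).ne_zero
  have n₃ := E 3 hx
  have n₂ := E 2 hx
  have n₃' := E 3 p₁
  have n₂' := E 2 q₁
  refine eq_of_chart_eq (ne_zero_of_pos q₃) ?_
  have e₁ := chart_crystalE (i := 2) (by decide) (by decide) h₂ hx
  have e₂ := chart_crystalE (i := 3) (by decide) (by decide) h₁₂ p₁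
  have f₁ := chart_crystalE (i := 3) (by decide) (by decide) h₁ hx
  have f₂ := chart_crystalE (i := 2) (by decide) (by decide) h₁₂ q₁
  rw [chart_crystalE (by decide) (by decide) h₁ p₂, chart_crystalE (by decide) (by decide) h₂ q₂,
    e₂, f₂, e₁, f₁]
  have ha₃ := crystalEps_two (ne_zero_of_pos hx)
  have ha₂ := crystalEps_three (ne_zero_of_pos p₁)
  have ha₁ := crystalEps_two (ne_zero_of_pos p₂)
  have hb₃ := crystalEps_three (ne_zero_of_pos hx)
  have hb₂ := crystalEps_two (ne_zero_of_pos q₁)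
  have hb₁ := crystalEps_three (ne_zero_of_pos q₂)
  rw [e₁] at ha₂
  rw [e₂, e₁] at ha₁
  rw [f₁] at hb₂
  rw [f₂, f₁] at hb₁
  have hc₁ := h₁.ne_zero
  have hc₂ := h₂.ne_zero
  -- the parameters `a₁, a₂, a₃` and `b₁, b₂, b₃` of the operations on the two sides
  obtain ⟨a₃, ea₃⟩ : ∃ a, a = (c₂ - 1) / crystalEps 2 x := ⟨_, rfl⟩
  obtain ⟨a₂, ea₂⟩ : ∃ a, a = (c₁ * c₂ - 1) / crystalEps 3 (crystalE 2 c₂ x) := ⟨_, rfl⟩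
  obtain ⟨a₁, ea₁⟩ : ∃ a, a = (c₁ - 1) / crystalEps 2 (crystalE 3 (c₁ * c₂) (crystalE 2 c₂ x)) :=
    ⟨_, rfl⟩
  obtain ⟨b₃, eb₃⟩ : ∃ a, a = (c₁ - 1) / crystalEps 3 x := ⟨_, rfl⟩
  obtain ⟨b₂, eb₂⟩ : ∃ a, a = (c₁ * c₂ - 1) / crystalEps 2 (crystalE 3 c₁ x) := ⟨_, rfl⟩
  obtain ⟨b₁, eb₁⟩ : ∃ a, a = (c₂ - 1) / crystalEps 3 (crystalE 2 (c₁ * c₂) (crystalE 3 c₁ x)) :=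
    ⟨_, rfl⟩
  rw [← ea₃] at ha₂
  rw [← ea₂, ← ea₃] at ha₁
  rw [← eb₃] at hb₂
  rw [← eb₂, ← eb₃] at hb₁
  rw [← ea₁, ← ea₂, ← ea₃, ← eb₁, ← eb₂, ← eb₃]
  generalize chart x = m at *
  generalize crystalEps 2 x = E₂ at *
  generalize crystalEps 3 x = E₃ at *
  generalize crystalEps 3 (crystalE 2 c₂ x) = E₃' at *
  generalize crystalEps 2 (crystalE 3 c₁ x) = E₂' at *
  generalize crystalEps 2 (crystalE 3 (c₁ * c₂) (crystalE 2 c₂ x)) = E₂'' at *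
  generalize crystalEps 3 (crystalE 2 (c₁ * c₂) (crystalE 3 c₁ x)) = E₃'' at *
  clear e₁ e₂ f₁ f₂
  simp only [LDL.rowAdd, Matrix.cons_val] at ha₁ ha₂ ha₃ hb₁ hb₂ hb₃
  rw [ha₃] at n₂ ea₃
  rw [hb₃] at n₃ eb₃
  rw [ha₂] at n₃' ea₂
  rw [hb₂] at n₂' eb₂
  rw [ha₁] at ea₁
  rw [hb₁] at eb₁
  obtain ⟨hv, hu⟩ := div_ne_zero_iff.1 n₂
  obtain ⟨ht, hs⟩ := div_ne_zero_iff.1 n₃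
  obtain ⟨ht', -⟩ := div_ne_zero_iff.1 n₃'
  obtain ⟨hv', -⟩ := div_ne_zero_iff.1 n₂'
  -- the numerators and denominators of `ε_2` and `ε_3` after the operations
  have k₁ : (m.l20 + a₃ * m.l10) * (m.l31 + a₂ * (m.l21 + a₃)) -
      (m.l30 + a₂ * (m.l20 + a₃ * m.l10)) * (m.l21 + a₃) =
      c₂ * (m.l20 * m.l31 - m.l30 * m.l21) := by
    rw [ea₃]
    field_simp
    ring
  have k₂ : m.l30 + b₃ * m.l20 = c₁ * m.l30 := by
    rw [eb₃]
    field_simp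
    ring
  have k₃ : m.l10 * (m.l31 + a₂ * (m.l21 + a₃)) - (m.l30 + a₂ * (m.l20 + a₃ * m.l10)) =
      m.l10 * m.l31 - m.l30 + a₂ * (m.l10 * m.l21 - m.l20) := by ring
  have k₄ : m.l10 * (m.l31 + b₃ * m.l21) - (m.l30 + b₃ * m.l20) =
      m.l10 * m.l31 - m.l30 + b₃ * (m.l10 * m.l21 - m.l20) := by ring
  have k₅ : m.l20 * (m.l31 + b₃ * m.l21) - (m.l30 + b₃ * m.l20) * m.l21 =
      m.l20 * m.l31 - m.l30 * m.l21 := by ring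
  rw [k₁, k₃] at ea₁
  rw [k₂] at eb₁
  rw [k₄, k₅] at eb₂
  rw [k₄] at hv'
  obtain ⟨r₁, r₂, r₃⟩ := braid_one_scalars (n := m.l10) (w := m.l10 * m.l21 - m.l20)
    (by ring) hc₁ hc₂ hs ht hu hv ht' hv' ea₃ ea₂ ea₁ eb₃ eb₂ eb₁
  exact LDL.rowAdd_braid r₁ r₂ r₃ m

theorem crystalE_braid_one (h₁ : IsPositive c₁) (h₂ : IsPositive c₂)
    (hx : ∀ k, IsPositive (x k)) {i j : Fin 5} (hij : cartanC4 i j = -1) (hji : cartanC4 j i = -1) :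
    crystalE i c₁ (crystalE j (c₁ * c₂) (crystalE i c₂ x)) =
      crystalE j c₂ (crystalE i (c₁ * c₂) (crystalE j c₁ x)) := by
  have h : i = 1 ∧ j = 2 ∨ i = 2 ∧ j = 3 ∨ i = 2 ∧ j = 1 ∨ i = 3 ∧ j = 2 := by
    fin_cases i <;> fin_cases j <;> simp [cartanC4] at hij hji ⊢
  have h32 : ∀ {x : Fin 10 → RatFun τ}, (∀ k, IsPositive (x k)) →
      crystalE 3 c₁ (crystalE 2 (c₁ * c₂) (crystalE 3 c₂ x)) =
      crystalE 2 c₂ (crystalE 3 (c₁ * c₂) (crystalE 2 c₁ x)) := by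
    intro x hx
    rw [mul_comm, crystalE_braid_two_three h₂ h₁ hx]
  -- transport along the diagram automorphism
  have hr : ∀ i j : Fin 5, (∀ {x : Fin 10 → RatFun τ}, (∀ k, IsPositive (x k)) →
      crystalE i c₁ (crystalE j (c₁ * c₂) (crystalE i c₂ x)) =
        crystalE j c₂ (crystalE i (c₁ * c₂) (crystalE j c₁ x))) →
      crystalE i.rev c₁ (crystalE j.rev (c₁ * c₂) (crystalE i.rev c₂ x)) =
        crystalE j.rev c₂ (crystalE i.rev (c₁ * c₂) (crystalE j.rev c₁ x)) := by
    intro i j h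
    have hs := isPositive_sigma hx
    have h₁₂ := h₁.mul h₂
    have p₁ := isPositive_crystalE i h₂ hs
    have p₂ := isPositive_crystalE j h₁ hs
    rw [crystalE_rev h₂ hx, crystalE_rev h₁ hx, crystalE_sigma h₁₂ p₁, crystalE_sigma h₁₂ p₂,
      crystalE_sigma h₁ (isPositive_crystalE j h₁₂ p₁),
      crystalE_sigma h₂ (isPositive_crystalE i h₁₂ p₂), h hs]
  obtain ⟨rfl, rfl⟩ | ⟨rfl, rfl⟩ | ⟨rfl, rfl⟩ | ⟨rfl, rfl⟩ := h
  · exact hr 3 2 h32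
  · exact crystalE_braid_two_three h₁ h₂ hx
  · exact hr 2 3 (crystalE_braid_two_three h₁ h₂)
  · exact h32 hx

end Braid

/-! ### The braid relation of length four -/

section BraidTwo

variable {τ : Type} {x y : Fin 10 → RatFun τ} {c c₁ c₂ : RatFun τ}

/-- The ratio `S_23 / S_33`. -/
def slope {F : Type} [Field F] (S : Matrix (Fin 4) (Fin 4) F) : F := S 2 3 / S 3 3

/-- The Schur complement of `S_33` in the lower right `2 × 2` block of a symmetric matrix. -/
def schurComplement {F : Type} [Field F] (S : Matrix (Fin 4) (Fin 4) F) : F :=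
  S 2 2 - S 2 3 ^ 2 / S 3 3

theorem LDL.sym_comm {F : Type} [Field F] (m : LDL F) (j k : Fin 4) : m.sym j k = m.sym k j := by
  revert j k
  simp [Fin.forall_fin_succ, LDL.sym]

theorem crystalEps_three_crystalE_four (hc : IsPositive c) (hy : ∀ k, IsPositive (y k)) :
    crystalEps 3 (crystalE 4 c y) =
      c * crystalEps 3 y - (c - 1) * slope (chart y).sym := by
  have h3 := (isPositive_crystalEps 3 hy).ne_zero
  have h4 := (isPositive_crystalEps 4 hy).ne_zero
  have hc0 := hc.ne_zero
  rw [crystalEps_three_eq_sym (isPositive_crystalE 4 hc hy), crystalEps_three_eq_sym hy,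
    sym_crystalE_four hc hy, sym_crystalE_four hc hy, slope, LDL.sym_comm _ 3 2]
  rw [crystalEps_three_eq_sym hy] at h3
  rw [crystalEps_four (ne_zero_of_pos hy)] at h4
  obtain ⟨h02, h03⟩ := div_ne_zero_iff.1 h3
  have e : (chart y).sym 0 3 - (1 - 1 / c) * ((chart y).sym 0 3 * (chart y).sym 3 3) /
      (chart y).sym 3 3 = (chart y).sym 0 3 / c := by
    field_simp
    ring
  rw [e]
  field_simp

theorem crystalEps_four_crystalE_three (hc : IsPositive c) (hy : ∀ k, IsPositive (y k))
    {a : RatFun τ} (ha : a = (c - 1) / crystalEps 3 y) :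
    crystalEps 4 (crystalE 3 c y) = crystalEps 4 y * (1 + a * slope (chart y).sym) ^ 2 +
      a ^ 2 * schurComplement (chart y).sym ∧
    slope (chart (crystalE 3 c y)).sym =
      (crystalEps 4 y * slope (chart y).sym * (1 + a * slope (chart y).sym) +
        a * schurComplement (chart y).sym) / crystalEps 4 (crystalE 3 c y) ∧
    schurComplement (chart (crystalE 3 c y)).sym =
      schurComplement (chart y).sym * crystalEps 4 y / crystalEps 4 (crystalE 3 c y) := by
  have h4 := (isPositive_crystalEps 4 hy).ne_zero
  have hy' := isPositive_crystalE 3 hc hy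
  have h4' := (isPositive_crystalEps 4 hy').ne_zero
  have e := chart_crystalE (i := 3) (by decide) (by decide) hc hy
  rw [← ha] at e
  have key : (chart (crystalE 3 c y)).sym 3 3 =
        (chart y).sym 3 3 + 2 * a * (chart y).sym 2 3 + a ^ 2 * (chart y).sym 2 2 ∧
      (chart (crystalE 3 c y)).sym 2 3 = (chart y).sym 2 3 + a * (chart y).sym 2 2 ∧
      (chart (crystalE 3 c y)).sym 2 2 = (chart y).sym 2 2 := by
    rw [e]
    refine ⟨?_, ?_, ?_⟩ <;> simp [LDL.rowAdd, LDL.sym] <;> ring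
  rw [crystalEps_four (ne_zero_of_pos hy)] at h4 ⊢
  rw [crystalEps_four (ne_zero_of_pos hy')] at h4' ⊢
  simp only [slope, schurComplement]
  rw [key.2.1, key.2.2]
  have k1 := key.1
  generalize (chart (crystalE 3 c y)).sym 3 3 = m' at *
  refine ⟨?_, ?_, ?_⟩
  · rw [key.1]
    field_simp
    ring
  · field_simp
    ring
  · field_simp
    rw [k1]
    ring

theorem sym_crystalE_four_invariants (hc : IsPositive c) (hy : ∀ k, IsPositive (y k)) :
    slope (chart (crystalE 4 c y)).sym = slope (chart y).sym ∧
    schurComplement (chart (crystalE 4 c y)).sym = schurComplement (chart y).sym := by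
  have hc0 := hc.ne_zero
  have h4 := (isPositive_crystalEps 4 hy).ne_zero
  rw [crystalEps_four (ne_zero_of_pos hy)] at h4
  simp only [slope, schurComplement, sym_crystalE_four hc hy, LDL.sym_comm _ 3 2]
  have e (z : RatFun τ) : z - (1 - 1 / c) * (z * (chart y).sym 3 3) / (chart y).sym 3 3 =
    z / c := by
    field_simp
    ring
  simp only [e]
  constructor
  · field_simp
  · field_simp
    ring

/-- The relation `x_1(a₁) x_0(a₂) x_1(a₃) x_0(a₄) = x_0(b₁) x_1(b₂) x_0(b₃) x_1(b₄)`, where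
`x_0(a)` adds `a E_00` to a symmetric matrix and `x_1(a)` is a row-and-column operation. -/
theorem rowOp_braid {F : Type} [Field F] {a₁ a₂ a₃ a₄ b₁ b₂ b₃ b₄ : F}
    (h1 : a₁ + a₃ = b₂ + b₄) (h2 : a₂ + a₄ = b₁ + b₃)
    (h3 : a₄ * (a₁ + a₃) + a₂ * a₁ = b₃ * b₂)
    (h4 : a₄ * (a₁ + a₃) ^ 2 + a₂ * a₁ ^ 2 = b₃ * b₂ ^ 2) (S : Matrix (Fin 4) (Fin 4) F) :
    rowOp 1 a₁ * (rowOp 1 a₃ * (S + Matrix.single 0 0 a₄) * (rowOp 1 a₃).transpose +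
      Matrix.single 0 0 a₂) * (rowOp 1 a₁).transpose =
    rowOp 1 b₂ * (rowOp 1 b₄ * S * (rowOp 1 b₄).transpose + Matrix.single 0 0 b₃) *
      (rowOp 1 b₂).transpose + Matrix.single 0 0 b₁ := by
  have hm (a b : F) : rowOp 1 a * rowOp 1 b = rowOp 1 (a + b) := by
    simp [rowOp]
  have hs (a b : F) : rowOp 1 a * Matrix.single 0 0 b * (rowOp 1 a).transpose =
      Matrix.single 0 0 b + Matrix.single 0 1 (b * a) + Matrix.single 1 0 (b * a) +
        Matrix.single 1 1 (b * a ^ 2) := by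
    rw [← Matrix.ext_iff]
    simp [Fin.forall_fin_succ, rowOp, Matrix.vecMul, dotProduct, Fin.sum_univ_succ,
      Matrix.single_apply]
    repeat' apply And.intro
    all_goals ring
  have hc (a b : F) (T : Matrix (Fin 4) (Fin 4) F) :
      rowOp 1 a * (rowOp 1 b * T * (rowOp 1 b).transpose) * (rowOp 1 a).transpose =
        rowOp 1 (a + b) * T * (rowOp 1 (a + b)).transpose := by
    rw [← hm, Matrix.transpose_mul]
    simp only [Matrix.mul_assoc]
  simp only [Matrix.mul_add, Matrix.add_mul, hc]
  simp only [hs]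
  rw [h1] at h3 h4 ⊢
  have g2 : a₄ + a₂ = b₃ + b₁ := by linear_combination h2
  have hA : (Matrix.single 0 0 a₄ + Matrix.single 0 0 a₂ : Matrix (Fin 4) (Fin 4) F) =
      Matrix.single 0 0 b₃ + Matrix.single 0 0 b₁ := by
    rw [← Matrix.single_add, ← Matrix.single_add, g2]
  have hB (i j : Fin 4) : (Matrix.single i j (a₄ * (b₂ + b₄)) + Matrix.single i j (a₂ * a₁) :
      Matrix (Fin 4) (Fin 4) F) = Matrix.single i j (b₃ * b₂) := by
    rw [← Matrix.single_add, h3]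
  have hD : (Matrix.single 1 1 (a₄ * (b₂ + b₄) ^ 2) + Matrix.single 1 1 (a₂ * a₁ ^ 2) :
      Matrix (Fin 4) (Fin 4) F) = Matrix.single 1 1 (b₃ * b₂ ^ 2) := by
    rw [← Matrix.single_add, h4]
  calc
    _ = rowOp 1 (b₂ + b₄) * S * (rowOp 1 (b₂ + b₄)).transpose +
        (Matrix.single 0 0 a₄ + Matrix.single 0 0 a₂) +
        (Matrix.single 0 1 (a₄ * (b₂ + b₄)) + Matrix.single 0 1 (a₂ * a₁)) +
        (Matrix.single 1 0 (a₄ * (b₂ + b₄)) + Matrix.single 1 0 (a₂ * a₁)) +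
        (Matrix.single 1 1 (a₄ * (b₂ + b₄) ^ 2) + Matrix.single 1 1 (a₂ * a₁ ^ 2)) := by abel
    _ = _ := by
      rw [hA, hB, hB, hD]
      abel

/-- The relation is checked on the matrices of the points themselves, where `e_0` is additive. The
parameters are computed at the images under `σ̄`, where `e_0` and `e_1` become `e_4` and `e_3`. -/
theorem crystalE_braid_one_zero (h₁ : IsPositive c₁) (h₂ : IsPositive c₂)
    (hx : ∀ k, IsPositive (x k)) :
    crystalE 1 c₁ (crystalE 0 (c₁ ^ 2 * c₂) (crystalE 1 (c₁ * c₂) (crystalE 0 c₂ x))) =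
      crystalE 0 c₂ (crystalE 1 (c₁ * c₂) (crystalE 0 (c₁ ^ 2 * c₂) (crystalE 1 c₁ x))) := by
  have h₁₂ := h₁.mul h₂
  have hC : IsPositive (c₁ ^ 2 * c₂) := by
    rw [sq]
    exact (h₁.mul h₁).mul h₂
  -- with `x = σ̄(y)`, the operators `e_0`, `e_1` at `x` correspond to `e_4`, `e_3` at `y`
  obtain ⟨y, hy, rfl⟩ : ∃ y : Fin 10 → RatFun τ, (∀ k, IsPositive (y k)) ∧ x = sigma y :=
    ⟨sigma x, isPositive_sigma hx, (sigma_sigma_of_pos hx).symm⟩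
  have p₁ := isPositive_crystalE 4 h₂ hy
  have p₂ := isPositive_crystalE 3 h₁₂ p₁
  have p₃ := isPositive_crystalE 4 hC p₂
  have q₁ := isPositive_crystalE 3 h₁ hy
  have q₂ := isPositive_crystalE 4 hC q₁
  have q₃ := isPositive_crystalE 3 h₁₂ q₂
  have s0 {c : RatFun τ} (hc : IsPositive c) {y : Fin 10 → RatFun τ} (hy : ∀ k, IsPositive (y k)) :
      crystalE 0 c (sigma y) = sigma (crystalE 4 c y) := crystalE_sigma hc hy 4
  have s1 {c : RatFun τ} (hc : IsPositive c) {y : Fin 10 → RatFun τ} (hy : ∀ k, IsPositive (y k)) :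
      crystalE 1 c (sigma y) = sigma (crystalE 3 c y) := crystalE_sigma hc hy 3
  have t0 {c : RatFun τ} (hc : IsPositive c) {y : Fin 10 → RatFun τ} (hy : ∀ k, IsPositive (y k)) :
      (chart (sigma (crystalE 4 c y))).sym =
        (chart (sigma y)).sym + Matrix.single 0 0 ((c - 1) / crystalEps 4 y) := by
    have h : crystalEps 0 (sigma y) = crystalEps 4 y := crystalEps_sigma hy 4
    rw [← s0 hc hy, sym_crystalE_zero hc (isPositive_sigma hy), h]
  have t1 {c : RatFun τ} (hc : IsPositive c) {y : Fin 10 → RatFun τ} (hy : ∀ k, IsPositive (y k)) :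
      (chart (sigma (crystalE 3 c y))).sym = rowOp 1 ((c - 1) / crystalEps 3 y) *
        (chart (sigma y)).sym * (rowOp 1 ((c - 1) / crystalEps 3 y)).transpose := by
    have h : crystalEps 1 (sigma y) = crystalEps 3 y := crystalEps_sigma hy 3
    rw [← s1 hc hy, chart_crystalE (by decide) (by decide) hc (isPositive_sigma hy),
      LDL.rowAdd_sym (by decide) (by decide), h]
  rw [s0 h₂ hy, s1 h₁₂ p₁, s0 hC p₂, s1 h₁ p₃, s1 h₁ hy, s0 hC q₁, s1 h₁₂ q₂, s0 h₂ q₃]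
  refine eq_of_sym_eq (isPositive_sigma (isPositive_crystalE 3 h₁ p₃))
    (isPositive_sigma (isPositive_crystalE 4 h₂ q₃)) ?_
  rw [t1 h₁ p₃, t0 hC p₂, t1 h₁₂ p₁, t0 h₂ hy, t0 h₂ q₃, t1 h₁₂ q₂, t0 hC q₁, t1 h₁ hy]
  have E (i : Fin 5) {y : Fin 10 → RatFun τ} (hy : ∀ k, IsPositive (y k)) :=
    (isPositive_crystalEps i hy).ne_zero
  -- the values of `ε_3`, `ε_4`, the slope and the Schur complement along the two sides
  have u₁ := crystalEps_three_crystalE_four h₂ hy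
  obtain ⟨v₁, v₁'⟩ := sym_crystalE_four_invariants h₂ hy
  obtain ⟨u₂, v₂, -⟩ := crystalEps_four_crystalE_three h₁₂ p₁ rfl
  have u₃ := crystalEps_three_crystalE_four hC p₂
  obtain ⟨w₁, z₁, z₁'⟩ := crystalEps_four_crystalE_three h₁ hy rfl
  have w₂ := crystalEps_three_crystalE_four hC q₁
  obtain ⟨z₂, z₂'⟩ := sym_crystalE_four_invariants hC q₁
  obtain ⟨w₃, -, -⟩ := crystalEps_four_crystalE_three h₁₂ q₂ rfl
  rw [v₁, v₁', crystalEps_crystalE_self h₂ hy] at u₂ v₂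
  rw [v₂, crystalEps_crystalE_self h₁₂ p₁] at u₃
  rw [z₁, crystalEps_crystalE_self h₁ hy] at w₂
  rw [z₂, z₂', z₁, z₁', crystalEps_crystalE_self hC q₁] at w₃
  obtain ⟨r₁, r₂, r₃, r₄⟩ := braid_two_scalars h₁.ne_zero h₂.ne_zero (E 3 hy) (E 4 hy) (E 3 p₁)
    (E 4 p₂) (E 4 q₁) (E 3 p₃) rfl u₁ rfl u₂ rfl u₃ rfl rfl w₁ rfl w₂ rfl w₃ rfl
  exact rowOp_braid r₁ r₂ r₃ r₄ _

theorem crystalE_braid_two (h₁ : IsPositive c₁) (h₂ : IsPositive c₂)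
    (hx : ∀ k, IsPositive (x k)) {i j : Fin 5} (hij : cartanC4 i j = -2) (hji : cartanC4 j i = -1) :
    crystalE i c₁ (crystalE j (c₁ ^ 2 * c₂) (crystalE i (c₁ * c₂) (crystalE j c₂ x))) =
      crystalE j c₂ (crystalE i (c₁ * c₂) (crystalE j (c₁ ^ 2 * c₂) (crystalE i c₁ x))) := by
  have h : i = 1 ∧ j = 0 ∨ i = 3 ∧ j = 4 := by
    fin_cases i <;> fin_cases j <;> simp [cartanC4] at hij hji ⊢
  obtain ⟨rfl, rfl⟩ | ⟨rfl, rfl⟩ := h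
  · exact crystalE_braid_one_zero h₁ h₂ hx
  · have h₁₂ := h₁.mul h₂
    have hC : IsPositive (c₁ ^ 2 * c₂) := by
      rw [sq]
      exact (h₁.mul h₁).mul h₂
    have hs := isPositive_sigma hx
    have p₁ := isPositive_crystalE 0 h₂ hs
    have p₂ := isPositive_crystalE 1 h₁₂ p₁
    have p₃ := isPositive_crystalE 0 hC p₂
    have q₁ := isPositive_crystalE 1 h₁ hs
    have q₂ := isPositive_crystalE 0 hC q₁
    have q₃ := isPositive_crystalE 1 h₁₂ q₂
    have s4 {c : RatFun τ} (hc : IsPositive c) {y : Fin 10 → RatFun τ}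
      (hy : ∀ k, IsPositive (y k)) :
        crystalE 4 c (sigma y) = sigma (crystalE 0 c y) := crystalE_sigma hc hy 0
    have s3 {c : RatFun τ} (hc : IsPositive c) {y : Fin 10 → RatFun τ}
      (hy : ∀ k, IsPositive (y k)) :
        crystalE 3 c (sigma y) = sigma (crystalE 1 c y) := crystalE_sigma hc hy 1
    rw [← sigma_sigma_of_pos hx, s4 h₂ hs, s3 h₁₂ p₁, s4 hC p₂, s3 h₁ p₃, s3 h₁ hs, s4 hC q₁,
      s3 h₁₂ q₂, s4 h₂ q₃, crystalE_braid_one_zero h₁ h₂ hs]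

end BraidTwo

/-! ### The geometric crystal -/

section GeometricCrystal

/-- An identity `g(e_i^c(x)) = c^n g(x)` at all positive points holds in particular at the generic
point, where it is an identity of rational functions. -/
theorem crystalV1_scales {f : RatFun (Fin 10)} {g : ∀ {τ : Type}, (Fin 10 → RatFun τ) → RatFun τ}
    (hf : ∀ {τ : Type} {x : Fin 10 → RatFun τ}, (∀ k, IsPositive (x k)) → IsValue f x (g x))
    {i : Fin 5} {n : ℤ}
    (hg : ∀ {τ : Type} {x : Fin 10 → RatFun τ} {c : RatFun τ}, IsPositive c →
      (∀ k, IsPositive (x k)) → g (crystalE i c x) = c ^ n * g x) :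
    crystalV1.Scales f i n := by
  have hx : ∀ k, IsPositive (coord (some k) : RatFun (Option (Fin 10))) :=
    fun k => isPositive_coord _
  have hc : IsPositive (coord none : RatFun (Option (Fin 10))) := isPositive_coord _
  refine ⟨_, _, crystalV1_acts i hc hx, hf hx, ?_⟩
  rw [← hg hc hx]
  exact hf (isPositive_crystalE i hc hx)

theorem crystalV1_isGeometricCrystal : crystalV1.IsGeometricCrystal cartanC4 := by
  have hx : ∀ k, IsPositive (coord (Sum.inr k) : Field2 (Fin 10)) := fun k => isPositive_coord _
  have h₁ : IsPositive (coord (Sum.inl 0) : Field2 (Fin 10)) := isPositive_coord _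
  have h₂ : IsPositive (coord (Sum.inl 1) : Field2 (Fin 10)) := isPositive_coord _
  have h₁₂ := h₁.mul h₂
  have pE (i : Fin 5) {c : Field2 (Fin 10)} {x : Fin 10 → Field2 (Fin 10)} (hc : IsPositive c)
    (hx : ∀ k, IsPositive (x k)) := isPositive_crystalE i hc hx
  have act (i : Fin 5) {c : Field2 (Fin 10)} {x : Fin 10 → Field2 (Fin 10)} (hc : IsPositive c)
    (hx : ∀ k, IsPositive (x k)) := crystalV1_acts i hc hx
  refine ⟨fun i => ?_, fun i => ?_, fun i j => ?_, fun i => ?_, fun i j hij hji => ?_,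
    fun i j hij hji => ?_, fun i j hij hji => ?_, fun i j hij hji => ?_, fun i j hij hji => ?_⟩
  · have hx : ∀ k, IsPositive (coord k : RatFun (Fin 10)) := fun k => isPositive_coord _
    have := crystalV1_acts i isPositive_one hx
    rwa [crystalE_one hx] at this
  · refine ⟨_, ⟨_, ⟨_, rfl, act i h₂ hx⟩, act i h₁ (pE i h₂ hx)⟩, _, rfl, ?_⟩
    rw [crystalE_mul h₁ h₂ hx]
    exact act i h₁₂ hx
  · exact crystalV1_scales (isValue_crystalGamma j) fun hc hx => crystalGamma_crystalE hc hx i j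
  · refine crystalV1_scales (isValue_crystalEps i) fun hc hx => ?_
    rw [crystalEps_crystalE_self hc hx, zpow_neg_one, div_eq_inv_mul]
  · refine crystalV1_scales (isValue_crystalEps i) fun hc hx => ?_
    rw [crystalEps_crystalE_of_commute hc hx hij, zpow_zero, one_mul]
  · refine ⟨_, ⟨_, ⟨_, rfl, act j h₂ hx⟩, act i h₁ (pE j h₂ hx)⟩, _, ⟨_, rfl, act i h₁ hx⟩, ?_⟩
    rw [crystalE_comm h₁ h₂ hx hij]
    exact act j h₂ (pE i h₁ hx)
  · refine ⟨_, ⟨_, ⟨_, ⟨_, rfl, act i h₂ hx⟩, act j h₁₂ (pE i h₂ hx)⟩,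
      act i h₁ (pE j h₁₂ (pE i h₂ hx))⟩,
      _, ⟨_, ⟨_, rfl, act j h₁ hx⟩, act i h₁₂ (pE j h₁ hx)⟩, ?_⟩
    rw [crystalE_braid_one h₁ h₂ hx hij hji]
    exact act j h₂ (pE i h₁₂ (pE j h₁ hx))
  · have hC : IsPositive ((coord (Sum.inl 0) : Field2 (Fin 10)) ^ 2 * coord (Sum.inl 1)) := by
      rw [sq]
      exact (h₁.mul h₁).mul h₂
    refine ⟨_, ⟨_, ⟨_, ⟨_, ⟨_, rfl, act j h₂ hx⟩, act i h₁₂ (pE j h₂ hx)⟩,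
      act j hC (pE i h₁₂ (pE j h₂ hx))⟩, act i h₁ (pE j hC (pE i h₁₂ (pE j h₂ hx)))⟩,
      _, ⟨_, ⟨_, ⟨_, rfl, act i h₁ hx⟩, act j hC (pE i h₁ hx)⟩,
        act i h₁₂ (pE j hC (pE i h₁ hx))⟩, ?_⟩
    rw [crystalE_braid_two h₁ h₂ hx hij hji]
    exact act j h₂ (pE i h₁₂ (pE j hC (pE i h₁ hx)))
  · have : cartanC4 i j ≠ -3 := by
      fin_cases i <;> fin_cases j <;> simp [cartanC4]
    exact absurd hij this

theorem sigma_sigma_coord :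
    sigma (sigma fun k : Fin 10 => (coord k : RatFun (Fin 10))) = fun k => coord k :=
  sigma_sigma_of_pos fun k => isPositive_coord k

end GeometricCrystal

/-! ### The exterior power and its submodule `W(ϖ_4)` -/

section ExteriorPower

theorem extAct_ιMulti (g : Matrix (Fin 8) (Fin 8) ℂ) (v : Fin 4 → Fin 8 → ℂ) :
    extAct g (exteriorPower.ιMulti ℂ 4 v) = exteriorPower.ιMulti ℂ 4 fun k => g.mulVec (v k) := by
  rw [extAct, exteriorPower.map_apply_ιMulti]
  rfl

theorem extAct_mul (g h : Matrix (Fin 8) (Fin 8) ℂ) (v : Ext4) :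
    extAct (g * h) v = extAct g (extAct h v) := by
  rw [extAct, Matrix.toLin'_mul, exteriorPower.map_comp]
  rfl

theorem extAct_one (v : Ext4) : extAct 1 v = v := by
  rw [extAct, Matrix.toLin'_one, exteriorPower.map_id]
  rfl

theorem extAct_xOne_mem_W4 {v : Ext4} (hv : v ∈ W4) (i : Fin 5) (t : ℂ) :
    extAct (xOne i t) v ∈ W4 :=
  Submodule.mem_sInf.2 fun S hS => (hS.2 i t v (Submodule.mem_sInf.1 hv S hS)).1

theorem extAct_yOne_mem_W4 {v : Ext4} (hv : v ∈ W4) (i : Fin 5) (t : ℂ) :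
    extAct (yOne i t) v ∈ W4 :=
  Submodule.mem_sInf.2 fun S hS => (hS.2 i t v (Submodule.mem_sInf.1 hv S hS)).2

theorem highVec_mem_W4 : highVec ∈ W4 := Submodule.mem_sInf.2 fun _ hS => hS.1

theorem bigY_mulVec {i : Fin 5} {z : ℂ} (hz : z ≠ 0) (v : Fin 8 → ℂ) :
    (bigY i z).mulVec v =
      ![![v 0 / z - v 7, v 1, v 2, v 3, v 4, v 5, v 6, z * v 7],
        ![z * v 0, v 0 + v 1 / z, v 2, v 3, v 4, v 5, z * v 6, v 6 + v 7 / z],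
        ![v 0, z * v 1, v 1 + v 2 / z, v 3, v 4, z * v 5, v 5 + v 6 / z, v 7],
        ![v 0, v 1, z * v 2, v 2 + v 3 / z, z * v 4, v 4 + v 5 / z, v 6, v 7],
        ![v 0, v 1, v 2, z * v 3, v 3 + v 4 / z, v 5, v 6, v 7]] i := by
  rw [bigY, ← Matrix.mulVec_mulVec, coroot]
  have hd (d : Fin 8 → ℂ) : (Matrix.diagonal d).mulVec v = fun k => d k * v k := by
    ext k
    exact Matrix.mulVec_diagonal d v k
  rw [hd]
  fin_cases i
  all_goals
    ext k
    fin_cases k <;>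
      simp [yOne, chevF, corootDiag, Matrix.add_mulVec, Matrix.neg_mulVec,
        Matrix.single_mulVec, Function.update] <;> field_simp <;> ring

theorem xOne_mulVec (i : Fin 5) (t : ℂ) (v : Fin 8 → ℂ) :
    (xOne i t).mulVec v =
      ![![v 0, v 1, v 2, v 3, v 4, v 5, v 6, v 7 - t * v 0],
        ![v 0 + t * v 1, v 1, v 2, v 3, v 4, v 5, v 6 + t * v 7, v 7],
        ![v 0, v 1 + t * v 2, v 2, v 3, v 4, v 5 + t * v 6, v 6, v 7],
        ![v 0, v 1, v 2 + t * v 3, v 3, v 4 + t * v 5, v 5, v 6, v 7],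
        ![v 0, v 1, v 2, v 3 + t * v 4, v 4, v 5, v 6, v 7]] i := by
  fin_cases i
  all_goals
    ext k
    fin_cases k <;>
      simp [xOne, chevE, chevF, Matrix.add_mulVec, Matrix.neg_mulVec,
        Matrix.single_mulVec, Function.update, sub_eq_add_neg]

theorem yOne_mulVec (i : Fin 5) (t : ℂ) (v : Fin 8 → ℂ) :
    (yOne i t).mulVec v =
      ![![v 0 - t * v 7, v 1, v 2, v 3, v 4, v 5, v 6, v 7],
        ![v 0, v 1 + t * v 0, v 2, v 3, v 4, v 5, v 6, v 7 + t * v 6],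
        ![v 0, v 1, v 2 + t * v 1, v 3, v 4, v 5, v 6 + t * v 5, v 7],
        ![v 0, v 1, v 2, v 3 + t * v 2, v 4, v 5 + t * v 4, v 6, v 7],
        ![v 0, v 1, v 2, v 3, v 4 + t * v 3, v 5, v 6, v 7]] i := by
  fin_cases i
  all_goals
    ext k
    fin_cases k <;>
      simp [yOne, chevF, Matrix.add_mulVec, Matrix.neg_mulVec,
        Matrix.single_mulVec, Function.update, sub_eq_add_neg]

/-- Although the torus is not among the generators of the action on `W(ϖ_4)`, `Y_i(z)` is a
product of elements `x_i(t)` and `y_i(t)`. -/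
theorem bigY_eq {i : Fin 5} {z : ℂ} (hz : z ≠ 0) :
    bigY i z = xOne i (z - 1) * yOne i 1 * xOne i (1 / z - 1) := by
  refine Matrix.mulVec_injective (funext fun v => ?_)
  rw [bigY_mulVec hz, ← Matrix.mulVec_mulVec, ← Matrix.mulVec_mulVec, xOne_mulVec, yOne_mulVec,
    xOne_mulVec]
  fin_cases i
  all_goals
    simp
    repeat' apply And.intro
  all_goals
    field_simp
    ring

theorem extAct_bigY_mem_W4 {v : Ext4} (hv : v ∈ W4) (i : Fin 5) {z : ℂ} (hz : z ≠ 0) :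
    extAct (bigY i z) v ∈ W4 := by
  rw [bigY_eq hz, extAct_mul, extAct_mul]
  exact extAct_xOne_mem_W4 (extAct_yOne_mem_W4 (extAct_xOne_mem_W4 hv i _) i _) i _

theorem extAct_bigY_prod_mem_W4 {l : ℕ} (w : Fin l → Fin 5) {z : Fin l → ℂ} (hz : ∀ k, z k ≠ 0)
    {v : Ext4} (hv : v ∈ W4) :
    extAct (List.ofFn fun k => bigY (w k) (z k)).prod v ∈ W4 := by
  induction l with
  | zero => simpa [extAct_one] using hv
  | succ l ih =>
    rw [List.ofFn_succ, List.prod_cons, extAct_mul]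
    exact extAct_bigY_mem_W4 (ih (fun k => w k.succ) fun k => hz k.succ) _ (hz 0)

/-- The lift `x_i(-1) y_i(1) x_i(-1)` of the simple reflection `s_i`. -/
def weylLift (i : Fin 5) : Matrix (Fin 8) (Fin 8) ℂ := xOne i (-1) * yOne i 1 * xOne i (-1)

/-- The action of `weylLift i` on coordinate vectors, over an arbitrary ring; over `ℤ` the
resulting identities between basis vectors are decidable. -/
def weylLiftVec {R : Type} [Neg R] (i : Fin 5) (v : Fin 8 → R) : Fin 8 → R :=
  ![![-v 7, v 1, v 2, v 3, v 4, v 5, v 6, v 0],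
    ![-v 1, v 0, v 2, v 3, v 4, v 5, -v 7, v 6],
    ![v 0, -v 2, v 1, v 3, v 4, -v 6, v 5, v 7],
    ![v 0, v 1, -v 3, v 2, -v 5, v 4, v 6, v 7],
    ![v 0, v 1, v 2, -v 4, v 3, v 5, v 6, v 7]] i

theorem weylLift_mulVec (i : Fin 5) (v : Fin 8 → ℂ) :
    (weylLift i).mulVec v = weylLiftVec i v := by
  rw [weylLift, weylLiftVec, ← Matrix.mulVec_mulVec, ← Matrix.mulVec_mulVec, xOne_mulVec,
    yOne_mulVec, xOne_mulVec]
  fin_cases i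
  all_goals simp

theorem weylLift_mulVec_single (i : Fin 5) {a b : Fin 8} {ε : ℤ}
    (h : weylLiftVec i (Pi.single a (1 : ℤ)) = Pi.single b ε) :
    (weylLift i).mulVec (Pi.single a 1) = Pi.single b (ε : ℂ) := by
  have hc (a : Fin 8) (ε : ℤ) : (Pi.single a (ε : ℂ) : Fin 8 → ℂ) =
      fun j => (((Pi.single a ε : Fin 8 → ℤ) j : ℤ) : ℂ) := by
    ext j
    simp only [Pi.single_apply]
    split_ifs <;> simp
  rw [hc b ε, ← h, weylLift_mulVec, ← Int.cast_one, hc a 1]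
  fin_cases i
  all_goals
    ext j
    fin_cases j <;> simp [weylLiftVec]

theorem extAct_weylLift_mem_W4 {v : Ext4} (hv : v ∈ W4) (i : Fin 5) :
    extAct (weylLift i) v ∈ W4 := by
  rw [weylLift, extAct_mul, extAct_mul]
  exact extAct_xOne_mem_W4 (extAct_yOne_mem_W4 (extAct_xOne_mem_W4 hv i _) i _) i _

/-- The wedge product of the basis vectors with the given indices. -/
def wedge (s : Fin 4 → Fin 8) : Ext4 := exteriorPower.ιMulti ℂ 4 fun k => Pi.single (s k) 1

theorem wedge_mem_W4_of_step {s : Fin 4 → Fin 8} (hs : wedge s ∈ W4) (i : Fin 5)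
    (t : Fin 4 → Fin 8)
    (h : ∀ k, weylLiftVec i (Pi.single (s k) (1 : ℤ)) = Pi.single (t k) 1) : wedge t ∈ W4 := by
  have := extAct_weylLift_mem_W4 hs i
  simpa [wedge, extAct_ιMulti, fun k => weylLift_mulVec_single i (h k)] using this

/-- The vectors `1 ∧ 3 ∧ 4̄ ∧ 2̄` and `4̄ ∧ 3̄ ∧ 2̄ ∧ 1̄` are reached from `1 ∧ 2 ∧ 3 ∧ 4` through
extremal weight vectors by lifts of simple reflections. -/
theorem wedge_mem_W4 : wedge ![0, 2, 4, 6] ∈ W4 ∧ lowVec ∈ W4 := by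
  have h0 : wedge ![0, 1, 2, 3] ∈ W4 := by
    convert highVec_mem_W4 using 1
    unfold wedge highVec
    congr 1
    ext k : 1
    fin_cases k <;> rfl
  -- the simple reflections are chosen so that no sign occurs
  have h1 := wedge_mem_W4_of_step h0 4 ![0, 1, 2, 4] (by decide)
  have h2 := wedge_mem_W4_of_step h1 3 ![0, 1, 3, 5] (by decide)
  have h3 := wedge_mem_W4_of_step h2 2 ![0, 2, 3, 6] (by decide)
  have h4 := wedge_mem_W4_of_step h3 4 ![0, 2, 4, 6] (by decide)
  have h5 := wedge_mem_W4_of_step h4 3 ![0, 3, 5, 6] (by decide)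
  have h6 := wedge_mem_W4_of_step h5 4 ![0, 4, 5, 6] (by decide)
  have h7 := wedge_mem_W4_of_step h6 1 ![1, 4, 5, 7] (by decide)
  have h8 := wedge_mem_W4_of_step h7 2 ![2, 4, 6, 7] (by decide)
  have h9 := wedge_mem_W4_of_step h8 3 ![3, 5, 6, 7] (by decide)
  have h10 := wedge_mem_W4_of_step h9 4 ![4, 5, 6, 7] (by decide)
  refine ⟨h4, ?_⟩
  convert h10 using 1
  unfold wedge lowVec
  congr 1
  ext k : 1
  fin_cases k <;> rfl

end ExteriorPower

/-! ### The zero weight space -/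

section WeightSpace

theorem extAct_coroot_wedge (i : Fin 5) {c : ℂ} (hc : c ≠ 0) (s : Fin 4 → Fin 8) :
    extAct (coroot i c) (wedge s) = c ^ (∑ k, corootDiag i (s k)) • wedge s := by
  have h (k : Fin 4) : (coroot i c).mulVec (Pi.single (s k) 1) =
      c ^ corootDiag i (s k) • Pi.single (s k) 1 := by
    rw [coroot, Matrix.diagonal_mulVec_single, mul_one, ← Pi.single_smul, smul_eq_mul, mul_one]
  rw [wedge, extAct_ιMulti, funext h, AlternatingMap.map_smul_univ]
  simp only [Fin.prod_univ_four, Fin.sum_univ_four, zpow_add₀ hc]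

theorem wedge_mem_weightSpace {v : Ext4} (hv : v ∈ W4) (hv' : v ∈ Submodule.span ℂ
    (wedge '' {s | ∀ i, ∑ k, corootDiag i (s k) = 0})) : v ∈ weightSpace 0 := by
  refine ⟨hv, ?_⟩
  suffices Submodule.span ℂ (wedge '' {s | ∀ i, ∑ k, corootDiag i (s k) = 0}) ≤
      ⨅ (i : Fin 5) (c : ℂˣ), LinearMap.ker (extAct (coroot i c) -
        ((c : ℂ) ^ (0 : Fin 5 → ℤ) i) • LinearMap.id) from this hv'
  rw [Submodule.span_le]
  rintro - ⟨s, hs, rfl⟩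
  simp only [SetLike.mem_coe, Submodule.mem_iInf, LinearMap.mem_ker, LinearMap.sub_apply]
  intro i c
  rw [extAct_coroot_wedge i c.ne_zero, hs i]
  simp

/-- The linear functional on the exterior power that sends a decomposable vector to the
determinant of the images of its factors under `π`. -/
noncomputable def minor (π : (Fin 8 → ℂ) →ₗ[ℂ] Fin 4 → ℂ) : Ext4 →ₗ[ℂ] ℂ :=
  exteriorPower.alternatingMapLinearEquiv (Matrix.detRowAlternating.compLinearMap π)

theorem minor_ιMulti (π : (Fin 8 → ℂ) →ₗ[ℂ] Fin 4 → ℂ) (v : Fin 4 → Fin 8 → ℂ) :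
    minor π (exteriorPower.ιMulti ℂ 4 v) = Matrix.det (Matrix.of fun k => π (v k)) := by
  rw [minor, exteriorPower.alternatingMapLinearEquiv_apply_ιMulti]
  rfl

/-- The vector `f_1 f_3 (1 ∧ 3 ∧ 4̄ ∧ 2̄)`, of weight zero. -/
noncomputable def zeroWeightVec : Ext4 :=
  wedge ![0, 2, 5, 7] + wedge ![0, 3, 4, 7] + wedge ![1, 2, 5, 6] + wedge ![1, 3, 4, 6]

/-- The part of `(p₀ + p₁) (p₂ + p₃) (p₄ + p₅) (p₆ + p₇)` of degree one in `(p₁, p₇)` and of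
degree one in `(p₃, p₅)`, as an alternating sum over the signs of these two pairs. It extracts the
action of `f_1 f_3` from the action of `y_1(±1) y_3(±1)`. -/
theorem four_mul_eq_polarization {R : Type} [Ring R] (p₀ p₁ p₂ p₃ p₄ p₅ p₆ p₇ : R) :
    4 * (p₀ * (p₂ * (p₅ * p₇)) + p₀ * (p₃ * (p₄ * p₇)) + p₁ * (p₂ * (p₅ * p₆)) +
      p₁ * (p₃ * (p₄ * p₆))) =
    (p₀ + p₁) * ((p₂ + p₃) * ((p₄ + p₅) * (p₆ + p₇))) -
      (p₀ + p₁) * ((p₂ - p₃) * ((p₄ - p₅) * (p₆ + p₇))) -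
      (p₀ - p₁) * ((p₂ + p₃) * ((p₄ + p₅) * (p₆ - p₇))) +
      (p₀ - p₁) * ((p₂ - p₃) * ((p₄ - p₅) * (p₆ - p₇))) := by
  noncomm_ring

theorem Submodule.exists_of_finrank_le_one {K V : Type*} [Field K] [AddCommGroup V] [Module K V]
    [FiniteDimensional K V] {S : Submodule K V} (h : Module.finrank K S ≤ 1) :
    ∃ v, ∀ w ∈ S, ∃ c : K, c • v = w := by
  obtain ⟨v, hv⟩ := finrank_le_one_iff.1 h
  refine ⟨v, fun w hw => ?_⟩
  obtain ⟨c, hc⟩ := hv ⟨w, hw⟩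
  exact ⟨c, congrArg Subtype.val hc⟩

theorem zeroWeightVec_mem_W4 : zeroWeightVec ∈ W4 := by
  obtain ⟨h, -⟩ := wedge_mem_W4
  have hy (s t : ℂ) (k : Fin 4) : (yOne 1 s).mulVec ((yOne 3 t).mulVec
      (Pi.single ((![0, 2, 4, 6] : Fin 4 → Fin 8) k) 1)) =
      Pi.single ((![0, 2, 4, 6] : Fin 4 → Fin 8) k) 1 +
        (![s, t, t, s] : Fin 4 → ℂ) k • Pi.single ((![1, 3, 5, 7] : Fin 4 → Fin 8) k) 1 := by
    rw [yOne_mulVec, yOne_mulVec]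
    ext j
    fin_cases k <;> fin_cases j <;> simp
  -- the mixed difference in the parameters of `y_1` and `y_3`, which isolates `f_1 f_3`
  have e : zeroWeightVec = (1 / 4 : ℂ) •
      (extAct (yOne 1 1) (extAct (yOne 3 1) (wedge ![0, 2, 4, 6])) -
        extAct (yOne 1 1) (extAct (yOne 3 (-1)) (wedge ![0, 2, 4, 6])) -
        extAct (yOne 1 (-1)) (extAct (yOne 3 1) (wedge ![0, 2, 4, 6])) +
        extAct (yOne 1 (-1)) (extAct (yOne 3 (-1)) (wedge ![0, 2, 4, 6]))) := by
    rw [one_div, eq_inv_smul_iff₀ (by norm_num : (4 : ℂ) ≠ 0)]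
    refine Subtype.ext ?_
    simp only [wedge, extAct_ιMulti, hy]
    simp only [zeroWeightVec, wedge, Submodule.coe_smul, Submodule.coe_add, Submodule.coe_sub,
      exteriorPower.ιMulti_apply_coe, ExteriorAlgebra.ιMulti_apply, List.ofFn_succ,
      List.ofFn_zero, List.prod_cons, List.prod_nil, map_add, map_smul]
    have h4 (a : ExteriorAlgebra ℂ (Fin 8 → ℂ)) : (4 : ℂ) • a = 4 * a := by
      rw [Algebra.smul_def, map_ofNat]
    simp only [h4]
    simpa [mul_assoc, ← sub_eq_add_neg] using four_mul_eq_polarization _ _ _ _ _ _ _ _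
  rw [e]
  refine Submodule.smul_mem _ _ (add_mem (sub_mem (sub_mem ?_ ?_) ?_) ?_) <;>
    exact extAct_yOne_mem_W4 (extAct_yOne_mem_W4 h 3 _) 1 _

theorem extAct_weylLift_wedge (i : Fin 5) {s t : Fin 4 → Fin 8} {ε : Fin 4 → ℤ}
    (h : ∀ k, weylLiftVec i (Pi.single (s k) (1 : ℤ)) = Pi.single (t k) (ε k)) :
    extAct (weylLift i) (wedge s) = ((∏ k, ε k : ℤ) : ℂ) • wedge t := by
  have h' (k : Fin 4) : (weylLift i).mulVec (Pi.single (s k) 1) =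
      (ε k : ℂ) • (Pi.single (t k) 1 : Fin 8 → ℂ) := by
    rw [weylLift_mulVec_single i (h k), ← Pi.single_smul, smul_eq_mul, mul_one]
  rw [wedge, extAct_ιMulti, funext h', AlternatingMap.map_smul_univ, Int.cast_prod]
  rfl

theorem extAct_weylLift_zeroWeightVec : extAct (weylLift 2) zeroWeightVec =
    -wedge ![0, 1, 6, 7] + wedge ![0, 3, 4, 7] + wedge ![2, 1, 6, 5] - wedge ![2, 3, 4, 5] := by
  rw [zeroWeightVec, map_add, map_add, map_add,
    extAct_weylLift_wedge 2 (s := ![0, 2, 5, 7]) (t := ![0, 1, 6, 7]) (ε := ![1, -1, 1, 1])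
      (by decide),
    extAct_weylLift_wedge 2 (s := ![0, 3, 4, 7]) (t := ![0, 3, 4, 7]) (ε := ![1, 1, 1, 1])
      (by decide),
    extAct_weylLift_wedge 2 (s := ![1, 2, 5, 6]) (t := ![2, 1, 6, 5]) (ε := ![1, -1, 1, -1])
      (by decide),
    extAct_weylLift_wedge 2 (s := ![1, 3, 4, 6]) (t := ![2, 3, 4, 5]) (ε := ![1, 1, 1, -1])
      (by decide)]
  have hn (w : Ext4) : (-1 : ℂ) • w = -w := neg_one_smul ℂ w
  simp [Fin.prod_univ_succ, sub_eq_add_neg, hn]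

/-- The vector `zeroWeightVec` and its image under the lift of `s_2` are two linearly independent
vectors of weight zero. -/
theorem not_isMultiplicityFreeW4 : ¬ IsMultiplicityFreeW4 := by
  intro h
  have hw (s : Fin 4 → Fin 8) (hs : ∀ i, ∑ k, corootDiag i (s k) = 0) :
      wedge s ∈ Submodule.span ℂ (wedge '' {s | ∀ i, ∑ k, corootDiag i (s k) = 0}) :=
    Submodule.subset_span ⟨s, hs, rfl⟩
  have m1 : zeroWeightVec ∈ weightSpace 0 := by
    refine wedge_mem_weightSpace zeroWeightVec_mem_W4 ?_
    rw [zeroWeightVec]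
    exact add_mem (add_mem (add_mem (hw _ (by decide)) (hw _ (by decide))) (hw _ (by decide)))
      (hw _ (by decide))
  have m2 : extAct (weylLift 2) zeroWeightVec ∈ weightSpace 0 := by
    refine wedge_mem_weightSpace (extAct_weylLift_mem_W4 zeroWeightVec_mem_W4 2) ?_
    rw [extAct_weylLift_zeroWeightVec]
    exact sub_mem (add_mem (add_mem (neg_mem (hw _ (by decide))) (hw _ (by decide)))
      (hw _ (by decide))) (hw _ (by decide))
  obtain ⟨v, hv⟩ := Submodule.exists_of_finrank_le_one (h 0)
  obtain ⟨a, ha⟩ := hv _ m1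
  obtain ⟨b, hb⟩ := hv _ m2
  have hd (s : Fin 4 → Fin 8) (hs : Function.Injective s) :
      minor (LinearMap.funLeft ℂ ℂ s) (wedge s) = 1 := by
    rw [wedge, minor_ιMulti, ← Matrix.det_one (n := Fin 4)]
    congr 1
    ext k l
    simp [Pi.single_apply, LinearMap.funLeft_apply, Matrix.one_apply, hs.eq_iff, eq_comm]
  have h0 (s : Fin 4 → Fin 8) {t : Fin 4 → Fin 8} (k : Fin 4) (hk : ∀ l, s l ≠ t k) :
      minor (LinearMap.funLeft ℂ ℂ s) (wedge t) = 0 := by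
    rw [wedge, minor_ιMulti]
    refine Matrix.det_eq_zero_of_row_eq_zero k fun l => ?_
    simp [LinearMap.funLeft_apply, hk]
  rw [extAct_weylLift_zeroWeightVec] at hb
  rw [zeroWeightVec] at ha
  -- the coordinates `0, 2, 5, 7` and `0, 1, 6, 7` separate the two vectors
  have e1 := congrArg (minor (LinearMap.funLeft ℂ ℂ ![0, 2, 5, 7])) ha
  have e2 := congrArg (minor (LinearMap.funLeft ℂ ℂ ![0, 1, 6, 7])) ha
  have e3 := congrArg (minor (LinearMap.funLeft ℂ ℂ ![0, 1, 6, 7])) hb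
  simp only [map_add, map_smul] at e1 e2
  simp only [map_add, map_sub, map_neg, map_smul] at e3
  rw [hd _ (by decide), h0 ![0, 2, 5, 7] 1 (by decide), h0 ![0, 2, 5, 7] 0 (by decide),
    h0 ![0, 2, 5, 7] 0 (by decide)] at e1
  rw [h0 ![0, 1, 6, 7] 1 (by decide), h0 ![0, 1, 6, 7] 1 (by decide),
    h0 ![0, 1, 6, 7] 1 (by decide), h0 ![0, 1, 6, 7] 1 (by decide)] at e2
  rw [hd _ (by decide), h0 ![0, 1, 6, 7] 1 (by decide), h0 ![0, 1, 6, 7] 0 (by decide),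
    h0 ![0, 1, 6, 7] 0 (by decide)] at e3
  simp only [smul_eq_mul, add_zero, sub_zero, mul_eq_zero] at e1 e2 e3
  obtain rfl | hm := e2
  · simp at e1
  · simp [hm] at e3

end WeightSpace

/-! ### The factors `Y_i(z)` acting on graphs -/

section Graph

open Matrix

/-- The permutation matrix `K` that reverses the order of the coordinates. -/
def reversal : Matrix (Fin 4) (Fin 4) ℂ := !![0, 0, 0, 1; 0, 0, 1, 0; 0, 1, 0, 0; 1, 0, 0, 0]

/-- The diagonal matrix `E` with entries `1, -1, 1, -1`. -/
def alternatingSign : Matrix (Fin 4) (Fin 4) ℂ :=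
  !![1, 0, 0, 0; 0, -1, 0, 0; 0, 0, 1, 0; 0, 0, 0, -1]

/-- The matrix `-K S E`, whose graph is the Lagrangian subspace of `ℂ⁸` belonging to the symmetric
matrix `S`. -/
def graphMatrix (S : Matrix (Fin 4) (Fin 4) ℂ) : Matrix (Fin 4) (Fin 4) ℂ :=
  -(reversal * S * alternatingSign)

/-- The vector of `ℂ⁸` with the given first four and last four coordinates. -/
def stack : (Fin 4 → ℂ) × (Fin 4 → ℂ) →ₗ[ℂ] Fin 8 → ℂ where
  toFun p := ![p.1 0, p.1 1, p.1 2, p.1 3, p.2 0, p.2 1, p.2 2, p.2 3]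
  map_add' p q := by simp
  map_smul' c p := by simp

/-- The block of `Y_i(z)`, `i ≠ 0`, that acts on the span of `1, 2, 3, 4`. -/
noncomputable def letterTop (i : Fin 5) (z : ℂ) : Matrix (Fin 4) (Fin 4) ℂ :=
  ![1, !![z, 0, 0, 0; 1, 1 / z, 0, 0; 0, 0, 1, 0; 0, 0, 0, 1],
    !![1, 0, 0, 0; 0, z, 0, 0; 0, 1, 1 / z, 0; 0, 0, 0, 1],
    !![1, 0, 0, 0; 0, 1, 0, 0; 0, 0, z, 0; 0, 0, 1, 1 / z],
    !![1, 0, 0, 0; 0, 1, 0, 0; 0, 0, 1, 0; 0, 0, 0, z]] i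

/-- The block of `Y_i(z)`, `i ≠ 0`, that acts on the span of `4̄, 3̄, 2̄, 1̄`. -/
noncomputable def letterBottom (i : Fin 5) (z : ℂ) : Matrix (Fin 4) (Fin 4) ℂ :=
  ![1, !![1, 0, 0, 0; 0, 1, 0, 0; 0, 0, z, 0; 0, 0, 1, 1 / z],
    !![1, 0, 0, 0; 0, z, 0, 0; 0, 1, 1 / z, 0; 0, 0, 0, 1],
    !![z, 0, 0, 0; 1, 1 / z, 0, 0; 0, 0, 1, 0; 0, 0, 0, 1],
    !![1 / z, 0, 0, 0; 0, 1, 0, 0; 0, 0, 1, 0; 0, 0, 0, 1]] i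

/-- The block of `Y_i(z)`, `i ≠ 0`, from the span of `1, 2, 3, 4` to the span of `4̄, 3̄, 2̄,
1̄`. -/
def letterCorner (i : Fin 5) : Matrix (Fin 4) (Fin 4) ℂ :=
  if i = 4 then !![0, 0, 0, 1; 0, 0, 0, 0; 0, 0, 0, 0; 0, 0, 0, 0] else 0

theorem letterTop_det_ne_zero (i : Fin 5) {z : ℂ} (hz : z ≠ 0) : (letterTop i z).det ≠ 0 := by
  fin_cases i <;> simp [letterTop, Matrix.det_succ_row_zero, Fin.sum_univ_succ, Fin.succAbove, hz]

theorem bigY_mulVec_stack {i : Fin 5} (hi : i ≠ 0) {z : ℂ} (hz : z ≠ 0) (t b : Fin 4 → ℂ) :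
    bigY i z *ᵥ stack (t, b) =
      stack (letterTop i z *ᵥ t, letterBottom i z *ᵥ b + letterCorner i *ᵥ t) := by
  rw [bigY_mulVec hz]
  obtain rfl | rfl | rfl | rfl := eq_of_ne_zero_fin5 hi
  all_goals
    simp [stack, letterTop, letterBottom, letterCorner, dotProduct, Fin.sum_univ_succ,
      div_eq_inv_mul]
  all_goals ring1

/-- The operator `Y_i(z)`, `i ≠ 0`, maps the graph belonging to `S` to the graph belonging to
`letter i z S`. -/
theorem letter_graphMatrix {i : Fin 5} (hi : i ≠ 0) {z : ℂ} (hz : z ≠ 0)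
    (S : Matrix (Fin 4) (Fin 4) ℂ) :
    letterBottom i z * graphMatrix S + letterCorner i =
      graphMatrix (letter i z S) * letterTop i z := by
  have h1 : letterBottom i z * reversal = reversal * letterA i z := by
    obtain rfl | rfl | rfl | rfl := eq_of_ne_zero_fin5 hi <;>
      simp [letterBottom, reversal, letterA]
  have h2 : (letterA i z)ᵀ * alternatingSign * letterTop i z = alternatingSign := by
    rw [← Matrix.ext_iff]
    obtain rfl | rfl | rfl | rfl := eq_of_ne_zero_fin5 hi <;>
      simp [Fin.forall_fin_succ, letterTop, alternatingSign, letterA, Matrix.mul_apply,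
        Fin.sum_univ_succ, hz]
  have h3 : letterCorner i = -(reversal * letterB i z * alternatingSign * letterTop i z) := by
    rw [← Matrix.ext_iff]
    obtain rfl | rfl | rfl | rfl := eq_of_ne_zero_fin5 hi <;>
      simp [Fin.forall_fin_succ, letterTop, alternatingSign, letterB, reversal, letterCorner, hz]
  rw [h3]
  have e : graphMatrix (letter i z S) * letterTop i z =
      -(reversal * letterA i z * S * ((letterA i z)ᵀ * alternatingSign * letterTop i z)) -
        reversal * letterB i z * alternatingSign * letterTop i z := by
    simp only [graphMatrix, letter, Matrix.mul_add, Matrix.add_mul, Matrix.neg_mul,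
      Matrix.mul_assoc]
    abel
  rw [e, h2, ← h1, graphMatrix]
  simp only [Matrix.mul_neg, Matrix.mul_assoc]
  abel

theorem exists_prod_bigY_mulVec (L : List (Fin 5 × ℂ)) (hL : ∀ p ∈ L, p.1 ≠ 0 ∧ p.2 ≠ 0) :
    ∃ P : Matrix (Fin 4) (Fin 4) ℂ, P.det ≠ 0 ∧ ∀ t : Fin 4 → ℂ,
      (L.map fun p => bigY p.1 p.2).prod *ᵥ stack (t, 0) =
        stack (P *ᵥ t, graphMatrix (pointList L) *ᵥ (P *ᵥ t)) := by
  induction L with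
  | nil => exact ⟨1, by simp, fun t => by simp [pointList, graphMatrix]⟩
  | cons p L ih =>
    obtain ⟨P, hP, h⟩ := ih fun q hq => hL q (List.mem_cons_of_mem _ hq)
    obtain ⟨h1, h2⟩ := hL p List.mem_cons_self
    refine ⟨letterTop p.1 p.2 * P, ?_, fun t => ?_⟩
    · rw [Matrix.det_mul]
      exact mul_ne_zero (letterTop_det_ne_zero _ h2) hP
    · rw [List.map_cons, List.prod_cons, ← Matrix.mulVec_mulVec, h, bigY_mulVec_stack h1 h2]
      have e : pointList (p :: L) = letter p.1 p.2 (pointList L) := rfl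
      rw [e]
      simp only [Matrix.mulVec_mulVec]
      rw [← Matrix.add_mulVec, ← Matrix.mul_assoc, ← Matrix.add_mul, letter_graphMatrix h1 h2,
        Matrix.mul_assoc, ← Matrix.mul_assoc]

/-- In the coordinates `(-b, t)`, the operator `Y_{4-i}(z)` is given by the same blocks as
`Y_i(z)` in the coordinates `(t, b)`. -/
theorem bigY_rev_mulVec_stack {i : Fin 5} (hi : i ≠ 0) {z : ℂ} (hz : z ≠ 0) (t b : Fin 4 → ℂ) :
    bigY i.rev z *ᵥ stack (-b, t) =
      stack (-(letterBottom i z *ᵥ b + letterCorner i *ᵥ t), letterTop i z *ᵥ t) := by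
  rw [bigY_mulVec hz]
  obtain rfl | rfl | rfl | rfl := eq_of_ne_zero_fin5 hi
  all_goals
    simp [stack, letterTop, letterBottom, letterCorner, dotProduct, Fin.sum_univ_succ,
      div_eq_inv_mul, Fin.rev]
  all_goals ring1

theorem exists_prod_bigY_rev_mulVec (L : List (Fin 5 × ℂ)) (hL : ∀ p ∈ L, p.1 ≠ 0 ∧ p.2 ≠ 0) :
    ∃ P : Matrix (Fin 4) (Fin 4) ℂ, P.det ≠ 0 ∧ ∀ t : Fin 4 → ℂ,
      (L.map fun p => bigY p.1.rev p.2).prod *ᵥ stack (0, t) =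
        stack (-(graphMatrix (pointList L) *ᵥ (P *ᵥ t)), P *ᵥ t) := by
  induction L with
  | nil => exact ⟨1, by simp, fun t => by simp [pointList, graphMatrix]⟩
  | cons p L ih =>
    obtain ⟨P, hP, h⟩ := ih fun q hq => hL q (List.mem_cons_of_mem _ hq)
    obtain ⟨h1, h2⟩ := hL p List.mem_cons_self
    refine ⟨letterTop p.1 p.2 * P, ?_, fun t => ?_⟩
    · rw [Matrix.det_mul]
      exact mul_ne_zero (letterTop_det_ne_zero _ h2) hP
    · rw [List.map_cons, List.prod_cons, ← Matrix.mulVec_mulVec, h, bigY_rev_mulVec_stack h1 h2]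
      have e : pointList (p :: L) = letter p.1 p.2 (pointList L) := rfl
      rw [e]
      simp only [Matrix.mulVec_mulVec]
      rw [← Matrix.add_mulVec, ← Matrix.mul_assoc, ← Matrix.add_mul, letter_graphMatrix h1 h2,
        Matrix.mul_assoc, ← Matrix.mul_assoc]

theorem AlternatingMap.map_matrix_mulVec {M : Type*} [AddCommGroup M] [Module ℂ M] {n : ℕ}
    (f : (Fin n → ℂ) [⋀^Fin n]→ₗ[ℂ] M) (P : Matrix (Fin n) (Fin n) ℂ) :
    (f fun k => P *ᵥ Pi.single k 1) = P.det • f fun k => Pi.single k 1 := by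
  have h : f = (LinearMap.toSpanSingleton ℂ M (f (Pi.basisFun ℂ (Fin n)))).compAlternatingMap
      (Pi.basisFun ℂ (Fin n)).det := by
    -- both sides are alternating, so it is enough to compare them on permutations of the basis
    refine Module.Basis.ext_alternating (Pi.basisFun ℂ (Fin n)) fun i h => ?_
    let σ : Equiv.Perm (Fin n) := Equiv.ofBijective i (Finite.injective_iff_bijective.1 h)
    change f (Pi.basisFun ℂ (Fin n) ∘ σ) = LinearMap.toSpanSingleton ℂ M _
      ((Pi.basisFun ℂ (Fin n)).det (Pi.basisFun ℂ (Fin n) ∘ σ))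
    rw [AlternatingMap.map_perm, AlternatingMap.map_perm, Module.Basis.det_self]
    simp
  have h' := DFunLike.congr_fun h fun k => P *ᵥ Pi.single k 1
  rw [h']
  have e : (Pi.basisFun ℂ (Fin n)).det (fun k => P *ᵥ Pi.single k 1) = P.det := by
    rw [Pi.basisFun_det_apply, ← Matrix.det_transpose]
    congr 1
    ext j k
    simp
  have e' : (⇑(Pi.basisFun ℂ (Fin n))) = fun k => Pi.single k 1 := by
    ext k : 1
    simp
  rw [LinearMap.compAlternatingMap_apply, e, LinearMap.toSpanSingleton_apply, e']

end Graph

/-! ### Comparison of `V_1(x)` and `V_2(y)` -/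

section Planes

open Matrix

theorem AlternatingMap.map_graph {M : Type*} [AddCommGroup M] [Module ℂ M]
    (f : (Fin 8 → ℂ) [⋀^Fin 4]→ₗ[ℂ] M) (N P : Matrix (Fin 4) (Fin 4) ℂ) :
    (f fun k => stack (P *ᵥ Pi.single k 1, N *ᵥ (P *ᵥ Pi.single k 1))) =
      P.det • f fun k => stack (Pi.single k 1, N *ᵥ Pi.single k 1) :=
  AlternatingMap.map_matrix_mulVec
    (f.compLinearMap (stack ∘ₗ LinearMap.id.prod (Matrix.toLin' N))) P

theorem AlternatingMap.map_neg_graph {M : Type*} [AddCommGroup M] [Module ℂ M]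
    (f : (Fin 8 → ℂ) [⋀^Fin 4]→ₗ[ℂ] M) (N P : Matrix (Fin 4) (Fin 4) ℂ) :
    (f fun k => stack (-(N *ᵥ (P *ᵥ Pi.single k 1)), P *ᵥ Pi.single k 1)) =
      P.det • f fun k => stack (-(N *ᵥ Pi.single k 1), Pi.single k 1) :=
  AlternatingMap.map_matrix_mulVec
    (f.compLinearMap (stack ∘ₗ (-Matrix.toLin' N).prod LinearMap.id)) P

/-- The wedge product of a basis of the graph `{(t, N t)}`. -/
noncomputable def graphVec (N : Matrix (Fin 4) (Fin 4) ℂ) : Ext4 :=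
  exteriorPower.ιMulti ℂ 4 fun k => stack (Pi.single k 1, N *ᵥ Pi.single k 1)

/-- The wedge product of a basis of the subspace `{(-N t, t)}`. -/
noncomputable def negGraphVec (N : Matrix (Fin 4) (Fin 4) ℂ) : Ext4 :=
  exteriorPower.ιMulti ℂ 4 fun k => stack (-(N *ᵥ Pi.single k 1), Pi.single k 1)

theorem exists_vecV1_eq {x : Fin 10 → ℂ} (hx : ∀ k, x k ≠ 0) :
    ∃ a : ℂ, a ≠ 0 ∧ vecV1 x = a • graphVec (graphMatrix (chart x).sym) := by
  have hw : ∀ k, word1 k ≠ 0 := by decide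
  obtain ⟨P, hP, h⟩ := exists_prod_bigY_mulVec (List.ofFn fun k => (word1 k, x k)) (by
    intro p hp
    obtain ⟨k, rfl⟩ := List.mem_ofFn.1 hp
    exact ⟨hw k, hx k⟩)
  refine ⟨P.det, hP, ?_⟩
  have hs (k : Fin 4) : (Pi.single (Fin.castAdd 4 k) 1 : Fin 8 → ℂ) = stack (Pi.single k 1, 0) := by
    ext j
    fin_cases k <;> fin_cases j <;> simp [stack]
  rw [List.map_ofFn] at h
  rw [vecV1, highVec, extAct_ιMulti]
  simp only [hs]
  simp only [Function.comp_def] at h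
  simp only [h]
  rw [AlternatingMap.map_graph, ← point_word1 hx]
  rfl

theorem exists_vecV2_eq {y : Fin 10 → ℂ} (hy : ∀ k, y k ≠ 0) :
    ∃ a : ℂ, a ≠ 0 ∧ vecV2 y = a • negGraphVec (graphMatrix (chart y).sym) := by
  have hw : ∀ k, word1 k ≠ 0 := by decide
  obtain ⟨P, hP, h⟩ := exists_prod_bigY_rev_mulVec (List.ofFn fun k => (word1 k, y k)) (by
    intro p hp
    obtain ⟨k, rfl⟩ := List.mem_ofFn.1 hp
    exact ⟨hw k, hy k⟩)
  refine ⟨P.det, hP, ?_⟩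
  have hs (k : Fin 4) : (Pi.single (Fin.natAdd 4 k) 1 : Fin 8 → ℂ) = stack (0, Pi.single k 1) := by
    ext j
    fin_cases k <;> fin_cases j <;> simp [stack]
  have hr (k : Fin 10) : word2 k = (word1 k).rev := by
    revert k
    decide
  rw [List.map_ofFn] at h
  rw [vecV2, lowVec, extAct_ιMulti]
  simp only [hs, hr]
  simp only [Function.comp_def] at h
  simp only [h]
  rw [AlternatingMap.map_neg_graph, ← point_word1 hy]
  rfl

/-- The subspaces `{(t, N t)}` and `{(-N' t, t)}` coincide if and only if `N N' = -1`. -/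
theorem exists_smul_graphVec_eq_iff (N N' : Matrix (Fin 4) (Fin 4) ℂ) :
    (∃ a : ℂ, a • graphVec N = negGraphVec N') ↔ N * N' = -1 := by
  constructor
  · rintro ⟨a, h⟩
    ext m l
    let top : (Fin 8 → ℂ) →ₗ[ℂ] Fin 4 → ℂ := LinearMap.funLeft ℂ ℂ (Fin.castAdd 4)
    let bottom : (Fin 8 → ℂ) →ₗ[ℂ] Fin 4 → ℂ := LinearMap.funLeft ℂ ℂ (Fin.natAdd 4)
    have ht (t b : Fin 4 → ℂ) : top (stack (t, b)) = t := by
      ext j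
      fin_cases j <;> rfl
    have hb (t b : Fin 4 → ℂ) : bottom (stack (t, b)) = b := by
      ext j
      fin_cases j <;> rfl
    -- the last four coordinates, the `l`-th being replaced by the `m`-th coordinate of `b - N t`,
    -- which vanishes on the graph of `N`
    let π : (Fin 8 → ℂ) →ₗ[ℂ] Fin 4 → ℂ := LinearMap.pi fun j =>
      if j = l then LinearMap.proj m ∘ₗ (bottom - Matrix.toLin' N ∘ₗ top)
      else LinearMap.proj j ∘ₗ bottom
    have hπ (t b : Fin 4 → ℂ) : π (stack (t, b)) = Function.update b l ((b - N *ᵥ t) m) := by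
      ext j
      by_cases hj : j = l
      · subst hj
        simp [π, ht, hb]
      · simp [π, hj, hb]
    have h' := congrArg (minor π) h
    rw [map_smul, graphVec, negGraphVec, minor_ιMulti, minor_ιMulti] at h'
    simp only [hπ] at h'
    have e1 : Matrix.det (Matrix.of fun k => Function.update (N *ᵥ Pi.single k 1) l
        ((N *ᵥ Pi.single k 1 - N *ᵥ Pi.single k 1) m)) = 0 :=
      Matrix.det_eq_zero_of_column_eq_zero l fun k => by simp
    have e2 : Matrix.det (Matrix.of fun k => Function.update (Pi.single k 1 : Fin 4 → ℂ) l
        (((Pi.single k 1 : Fin 4 → ℂ) - N *ᵥ -(N' *ᵥ Pi.single k 1)) m)) = (1 + N * N') m l := by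
      have : (Matrix.of fun k => Function.update (Pi.single k 1 : Fin 4 → ℂ) l
          (((Pi.single k 1 : Fin 4 → ℂ) - N *ᵥ -(N' *ᵥ Pi.single k 1)) m)) =
          (1 : Matrix (Fin 4) (Fin 4) ℂ).updateCol l fun k => (1 + N * N') m k := by
        ext k j
        by_cases hj : j = l
        · subst hj
          simp [Matrix.mulVec_neg, Pi.single_apply, Matrix.one_apply]
          rfl
        · simp [hj, Pi.single_apply, Matrix.one_apply, eq_comm]
      rw [this, ← Matrix.cramer_apply, Matrix.cramer_one]
      rfl
    rw [e1, e2, smul_zero, Matrix.add_apply] at h'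
    rw [Matrix.neg_apply]
    exact (neg_eq_of_add_eq_zero_right h'.symm).symm
  -- conversely, `t ↦ -N' t` is the change of basis from one parametrization to the other
  · intro h
    refine ⟨(-N').det, ?_⟩
    rw [graphVec, ← AlternatingMap.map_graph, negGraphVec]
    congr 1
    ext k : 1
    rw [Matrix.mulVec_mulVec, Matrix.mul_neg, h, neg_neg, Matrix.one_mulVec, Matrix.neg_mulVec]

/-- The condition on the graphs, expressed through the symmetric matrices: `E K` is the matrix
`W`, and `K E = -W`. -/
theorem graphMatrix_mul_graphMatrix_iff (m m' : LDL ℂ) :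
    graphMatrix m.sym * graphMatrix m'.sym = -1 ↔ m'.sym * signedRev * m.sym = signedRev := by
  have h1 : alternatingSign * reversal = signedRev := by
    simp [alternatingSign, reversal, signedRev]
  have h2 : reversal * alternatingSign = -signedRev := by
    simp [alternatingSign, reversal, signedRev]
  have h3 : reversal * reversal = 1 := by
    rw [← Matrix.ext_iff]
    simp [Fin.forall_fin_succ, reversal]
  have h4 : alternatingSign * alternatingSign = 1 := by
    rw [← Matrix.ext_iff]
    simp [Fin.forall_fin_succ, alternatingSign]
  have h5 : (signedRev : Matrix (Fin 4) (Fin 4) ℂ)ᵀ = -signedRev := by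
    rw [← Matrix.ext_iff]
    simp [Fin.forall_fin_succ, signedRev]
  have hs (m : LDL ℂ) : m.symᵀ = m.sym := by
    ext j k
    exact LDL.sym_comm m k j
  have e : graphMatrix m.sym * graphMatrix m'.sym =
      reversal * (m.sym * signedRev * m'.sym) * alternatingSign := by
    rw [← h1]
    simp only [graphMatrix, Matrix.neg_mul, Matrix.mul_neg, neg_neg, Matrix.mul_assoc]
  have ht : m'.sym * signedRev * m.sym = signedRev ↔ m.sym * signedRev * m'.sym = signedRev := by
    rw [← Matrix.transpose_inj, Matrix.transpose_mul, Matrix.transpose_mul, hs, hs, h5,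
      Matrix.neg_mul, Matrix.mul_neg, neg_inj, Matrix.mul_assoc]
  rw [e, ht]
  constructor
  · intro h
    have h' := congrArg (fun M => reversal * M * alternatingSign) h
    rw [Matrix.mul_neg, Matrix.mul_one, Matrix.neg_mul, h2, neg_neg] at h'
    refine Eq.trans ?_ h'
    simp only [Matrix.mul_assoc, h4, Matrix.mul_one]
    rw [← Matrix.mul_assoc reversal reversal, h3, Matrix.one_mul]
  · intro h
    rw [h, ← neg_neg signedRev, ← h2, Matrix.mul_neg, Matrix.neg_mul, ← Matrix.mul_assoc, h3,
      Matrix.one_mul, h4]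

theorem exists_smul_vecV1_eq_iff {x y : Fin 10 → ℂ} (hx : ∀ k, x k ≠ 0) (hy : ∀ k, y k ≠ 0) :
    (∃ a : ℂ, a • vecV1 x = vecV2 y) ↔
      (chart y).sym * signedRev * (chart x).sym = signedRev := by
  obtain ⟨a, ha, h1⟩ := exists_vecV1_eq hx
  obtain ⟨b, hb, h2⟩ := exists_vecV2_eq hy
  rw [← graphMatrix_mul_graphMatrix_iff, ← exists_smul_graphVec_eq_iff, h1, h2]
  constructor
  · rintro ⟨c, hc⟩
    refine ⟨b⁻¹ * (c * a), ?_⟩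
    rw [mul_smul, mul_smul, hc, inv_smul_smul₀ hb]
  · rintro ⟨c, hc⟩
    refine ⟨b * c * a⁻¹, ?_⟩
    rw [mul_smul, inv_smul_smul₀ ha, mul_smul, hc]

theorem exists_smul_vecV1_eq_iff_sigma {x y : Fin 10 → ℂ} (hx : ∀ k, x k ≠ 0)
    (hy : ∀ k, y k ≠ 0) : (∃ a : ℂ, a • vecV1 x = vecV2 y) ↔ y = sigma x := by
  rw [exists_smul_vecV1_eq_iff hx hy]
  constructor
  · exact fun h => (eq_sigma_of_sym_mul hx hy h).2
  · rintro rfl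
    exact sym_mul_sigma hx hy

theorem eq_sigma_comm {x y : Fin 10 → ℂ} (hx : ∀ k, x k ≠ 0) (hy : ∀ k, y k ≠ 0) :
    y = sigma x ↔ x = sigma y := by
  constructor
  · rintro rfl
    exact (sigma_sigma hx hy).symm
  · rintro rfl
    exact (sigma_sigma hy hx).symm

end Planes

end GeomCrystal

theorem mainTheorem1 :
    -- the module `W(ϖ_4)` is not multiplicity-free
    ¬ GeomCrystal.IsMultiplicityFreeW4 ∧
    -- the vectors `V_1(x)` and `V_2(y)` lie in `W(ϖ_4)`
    (∀ x : Fin 10 → ℂ, (∀ k, x k ≠ 0) →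
      GeomCrystal.vecV1 x ∈ GeomCrystal.W4 ∧ GeomCrystal.vecV2 x ∈ GeomCrystal.W4) ∧
    -- the maps `σ̄` and `σ̄⁻¹` are the solutions of the equation `a(x) V_1(x) = V_2(y)`
    (∀ x y : Fin 10 → ℂ, (∀ k, x k ≠ 0) → (∀ k, y k ≠ 0) →
      ((∃ a : ℂ, a • GeomCrystal.vecV1 x = GeomCrystal.vecV2 y) ↔ y = GeomCrystal.sigma x) ∧
      ((∃ a : ℂ, a • GeomCrystal.vecV1 x = GeomCrystal.vecV2 y) ↔ x = GeomCrystal.sigmaInv y)) ∧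
    -- `σ̄` is birational with inverse `σ̄⁻¹`
    (GeomCrystal.sigmaInv (GeomCrystal.sigma
        (fun k : Fin 10 => (GeomCrystal.coord k : GeomCrystal.RatFun (Fin 10)))) =
      (fun k => GeomCrystal.coord k)) ∧
    (GeomCrystal.sigma (GeomCrystal.sigmaInv
        (fun k : Fin 10 => (GeomCrystal.coord k : GeomCrystal.RatFun (Fin 10)))) =
      (fun k => GeomCrystal.coord k)) ∧
    -- `𝒱_1` is a positive geometric crystal for `C_4^{(1)}`
    GeomCrystal.crystalV1.IsGeometricCrystal GeomCrystal.cartanC4 ∧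
    GeomCrystal.crystalV1.IsPositiveCrystal := by
  refine ⟨GeomCrystal.not_isMultiplicityFreeW4, fun x hx => ⟨?_, ?_⟩, fun x y hx hy => ?_,
    GeomCrystal.sigma_sigma_coord, GeomCrystal.sigma_sigma_coord,
    GeomCrystal.crystalV1_isGeometricCrystal, GeomCrystal.crystalV1_isPositiveCrystal⟩
  · exact GeomCrystal.extAct_bigY_prod_mem_W4 _ hx GeomCrystal.highVec_mem_W4
  · exact GeomCrystal.extAct_bigY_prod_mem_W4 _ hx GeomCrystal.wedge_mem_W4.2
  · have h := GeomCrystal.exists_smul_vecV1_eq_iff_sigma hx hy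
    rw [GeomCrystal.sigmaInv_eq_sigma]
    exact ⟨h, h.trans (GeomCrystal.eq_sigma_comm hx hy)⟩
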